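/- Fix $k\in(0,1)$, $k'=\sqrt{1-k^2}$, and let $\mathrm{sn},\mathrm{cn},\mathrm{dn}$ be the Jacobian elliptic functions, $K=K(k)$ and $K'=K(k')$ the complete elliptic integrals of the first kind. For $-k^{-2}<\epsilon<k'^{-2}$ put $a=(1+k^2\epsilon)^{1/2}$, $b=1$, $c=(1-k'^2\epsilon)^{1/2}$ (for $0<\epsilon<k'^{-2}$ these are the semi-axes of an ellipsoid $\mathcal E(\epsilon)$, which tends to the unit sphere as $\epsilon\to0$) and $$p(s)=\bigl(c^2\mathrm{cn}^2(s,k')+b^2\mathrm{sn}^2(s,k')\bigr)^{1/2},\qquad q(t)=\bigl(a^2\mathrm{cn}^2(t,k)+b^2\mathrm{sn}^2(t,k)\bigr)^{1/2}.$$ Let $m,n\in\mathbb N_0$, $\kappa=(\kappa_1,\kappa_2,\kappa_3)\in\{0,1\}^3$, $|\kappa|=\kappa_1+\kappa_2+\kappa_3$. For real $\lambda$ let $H_{m,\kappa}(\lambda,\epsilon)$ be the number $H$ for which $$\frac{d}{ds}\Bigl(\frac1{p}\frac{dv}{ds}\Bigr)+p\,\bigl(-H+\lambda\,\mathrm{dn}^2(s,k')\bigr)v=0,\qquad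 0\le s\le K',$$ has a nontrivial solution with exactly $m$ zeros in $(0,K')$ satisfying $v'(0)=0$ if $\kappa_3=0$, $v(0)=0$ if $\kappa_3=1$, $v'(K')=0$ if $\kappa_2=0$, $v(K')=0$ if $\kappa_2=1$; and let $h_{n,\kappa}(\lambda,\epsilon)$ be the number $h$ for which $$\frac{d}{dt}\Bigl(\frac1{q}\frac{dw}{dt}\Bigr)+q\,\bigl(h-\lambda k^2\mathrm{sn}^2(t,k)\bigr)w=0,\qquad 0\le t\le K,$$ has a nontrivial solution with exactly $n$ zeros in $(0,K)$ satisfying $w'(0)=0$ if $\kappa_1=0$, $w(0)=0$ if $\kappa_1=1$, $w'(K)=0$ if $\kappa_2=0$, $w(K)=0$ if $\kappa_2=1$. Let $\lambda_{m,n,\kappa}(\epsilon)$ be the solution $\lambda$ of $H_{m,\kappa}(\lambda,\epsilon)=h_{n,\kappa}(\lambda,\epsilon)$. Put $\ell=2m+2n+|\kappa|$ and $\Lambda=\Lambda_{m,n,\kappa}=\ell(\ell+1)$. A corresponding Lamé polynomial is a function $w(t)=\mathrm{sn}^{\kappa_1}(t,k)\,\mathrm{cn}^{\kappa_2}(t,k)\,\mathrm{dn}^{\kappa_3}(t,k)\,P(\mathrm{sn}^2(t,k))$,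 with $P$ a real polynomial of degree $m+n$, which solves $w''+(h_{n,\kappa}(\Lambda,0)-\Lambda k^2\mathrm{sn}^2(t,k))w=0$, has exactly $n$ zeros in $(0,K)$, and for which $v(s)=w(K+iK'-is)$ has exactly $m$ zeros in $(0,K')$. **Theorem.** Near $(\lambda,\epsilon)=(\Lambda,0)$ the numbers $H_{m,\kappa}(\lambda,\epsilon)$ and $h_{n,\kappa}(\lambda,\epsilon)$, and near $\epsilon=0$ the number $\lambda_{m,n,\kappa}(\epsilon)$, exist and are unique; a corresponding Lamé polynomial exists; and $\lambda_{m,n,\kappa}(0)=\Lambda$. The functions $H_{m,\kappa}$ and $h_{n,\kappa}$ are analytic at $(\Lambda,0)$, and for every corresponding Lamé polynomial $w$, with $v(s)=w(K+iK'-is)$, $$\frac{\partial H_{m,\kappa}}{\partial\lambda}(\Lambda,0)=\frac{\int_0^{K'}\mathrm{dn}^2(s,k')v(s)^2\,ds}{\int_0^{K'}v(s)^2\,ds},\qquad \frac{\partial H_{m,\kappa}}{\partial\epsilon}(\Lambda,0)=\frac{k'^2\int_0^{K'}\mathrm{cn}(s,k')v(s)\frac{d}{ds}\bigl(\mathrm{cn}(s,k')\frac{dv}{ds}\bigr)ds}{\int_0^{K'}v(s)^2\,ds},$$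 $$\frac{\partial h_{n,\kappa}}{\partial\lambda}(\Lambda,0)=\frac{k^2\int_0^{K}\mathrm{sn}^2(t,k)w(t)^2\,dt}{\int_0^{K}w(t)^2\,dt},\qquad \frac{\partial h_{n,\kappa}}{\partial\epsilon}(\Lambda,0)=\frac{k^2\int_0^{K}\mathrm{cn}(t,k)w(t)\frac{d}{dt}\bigl(\mathrm{cn}(t,k)\frac{dw}{dt}\bigr)dt}{\int_0^{K}w(t)^2\,dt}.$$ The function $\lambda_{m,n,\kappa}(\epsilon)$ is analytic at $\epsilon=0$, $\frac{\partial H_{m,\kappa}}{\partial\lambda}(\Lambda,0)\ne\frac{\partial h_{n,\kappa}}{\partial\lambda}(\Lambda,0)$, and $$\lambda_{m,n,\kappa}'(0)=-\frac{\frac{\partial H_{m,\kappa}}{\partial\epsilon}(\Lambda,0)-\frac{\partial h_{n,\kappa}}{\partial\epsilon}(\Lambda,0)}{\frac{\partial H_{m,\kappa}}{\partial\lambda}(\Lambda,0)-\frac{\partial h_{n,\kappa}}{\partial\lambda}(\Lambda,0)}.$$ -/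

import Mathlib

open Set Filter Topology Polynomial

noncomputable section

namespace NearSphere

/-! ### Jacobian elliptic functions of modulus `k ∈ (0,1)` -/

/-- The incomplete elliptic integral of the first kind. -/
def ellF (k φ : ℝ) : ℝ := ∫ θ in (0 : ℝ)..φ, 1 / √(1 - k ^ 2 * Real.sin θ ^ 2)

/-- The complete elliptic integral `K(k)`. -/
def ellK (k : ℝ) : ℝ := ellF k (Real.pi / 2)

/-- The complementary modulus `k' = √(1 - k²)`. -/
def kc (k : ℝ) : ℝ := √(1 - k ^ 2)

/-- The Jacobian amplitude: the inverse of the increasing bijection `φ ↦ ellF k φ` of `ℝ`. -/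
def am (k t : ℝ) : ℝ := Function.invFun (ellF k) t

def sn (k t : ℝ) : ℝ := Real.sin (am k t)

def cn (k t : ℝ) : ℝ := Real.cos (am k t)

def dn (k t : ℝ) : ℝ := √(1 - k ^ 2 * sn k t ^ 2)

/-- Common denominator in the formulas for `sn`, `cn`, `dn` at a complex argument `x + i y`;
it vanishes exactly at the poles. -/
def cden (k : ℝ) (z : ℂ) : ℝ :=
  cn (kc k) z.im ^ 2 + k ^ 2 * sn k z.re ^ 2 * sn (kc k) z.im ^ 2

/-- `sn(x + i y, k)` for complex arguments, in terms of the real functions of moduli `k` and `k'`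
(Jacobi's imaginary transformation together with the addition theorem). -/
def csn (k : ℝ) (z : ℂ) : ℂ :=
  (((sn k z.re * dn (kc k) z.im : ℝ) : ℂ)
    + Complex.I * ((cn k z.re * dn k z.re * sn (kc k) z.im * cn (kc k) z.im : ℝ) : ℂ))
  / ((cden k z : ℝ) : ℂ)

/-- `cn(x + i y, k)` for complex arguments. -/
def ccn (k : ℝ) (z : ℂ) : ℂ :=
  (((cn k z.re * cn (kc k) z.im : ℝ) : ℂ)
    - Complex.I * ((sn k z.re * dn k z.re * sn (kc k) z.im * dn (kc k) z.im : ℝ) : ℂ))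
  / ((cden k z : ℝ) : ℂ)

/-- `dn(x + i y, k)` for complex arguments. -/
def cdn (k : ℝ) (z : ℂ) : ℂ :=
  (((dn k z.re * cn (kc k) z.im * dn (kc k) z.im : ℝ) : ℂ)
    - Complex.I * ((k ^ 2 * sn k z.re * cn k z.re * sn (kc k) z.im : ℝ) : ℂ))
  / ((cden k z : ℝ) : ℂ)

/-! ### Regular Sturm--Liouville problems on `[0, L]` -/

/-- `y` with derivative `y₁` solves `(y' / p)' + p r y = 0` on `[0, L]`. -/
structure IsSLSolution (L : ℝ) (p r y y₁ : ℝ → ℝ) : Prop where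
  hasDeriv : ∀ x ∈ Icc 0 L, HasDerivWithinAt y (y₁ x) (Icc 0 L) x
  hasDeriv_div : ∀ x ∈ Icc 0 L,
    HasDerivWithinAt (fun u => y₁ u / p u) (-(p x * r x * y x)) (Icc 0 L) x

/-- Neumann condition `y'(x) = 0` for index `0`, Dirichlet condition `y(x) = 0` for index `1`. -/
def BdryCond (j : Fin 2) (y y₁ : ℝ → ℝ) (x : ℝ) : Prop :=
  if j = 0 then y₁ x = 0 else y x = 0

/-- `(y' / p)' + p r y = 0` has a nontrivial solution on `[0, L]` with the boundary conditions of
types `j₀` at `0` and `j₁` at `L` and with exactly `n` zeros in `(0, L)`. -/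
def HasSLEigenfunction (L : ℝ) (p r : ℝ → ℝ) (j₀ j₁ : Fin 2) (n : ℕ) : Prop :=
  ∃ y y₁ : ℝ → ℝ, IsSLSolution L p r y y₁ ∧ (∃ x ∈ Icc 0 L, y x ≠ 0) ∧
    BdryCond j₀ y y₁ 0 ∧ BdryCond j₁ y y₁ L ∧ {x ∈ Ioo 0 L | y x = 0}.encard = n

/-! ### The two-parameter problem for semi-axes `a, b, c` and modulus `k` -/

def pFun (k b c s : ℝ) : ℝ := √(c ^ 2 * cn (kc k) s ^ 2 + b ^ 2 * sn (kc k) s ^ 2)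

def qFun (k a b t : ℝ) : ℝ := √(a ^ 2 * cn k t ^ 2 + b ^ 2 * sn k t ^ 2)

/-- The semi-axis `a = (1 + k² ε)^{1/2}` of the ellipsoid `E(ε)`. -/
def axisA (k ε : ℝ) : ℝ := √(1 + k ^ 2 * ε)

/-- The semi-axis `c = (1 - k'² ε)^{1/2}` of the ellipsoid `E(ε)`. -/
def axisC (k ε : ℝ) : ℝ := √(1 - kc k ^ 2 * ε)

/-- `H` is the eigenvalue with oscillation number `m` of
`(v' / p)' + p (-H + l dn²(s, k')) v = 0` on `[0, K']` for the ellipsoid `E(ε)` and parity `κ`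
(the components of `κ` are `κ 0`, `κ 1`, `κ 2`). -/
def IsUpperEigenvalue (k : ℝ) (κ : Fin 3 → Fin 2) (m : ℕ) (l ε H : ℝ) : Prop :=
  HasSLEigenfunction (ellK (kc k)) (pFun k 1 (axisC k ε))
    (fun s => -H + l * dn (kc k) s ^ 2) (κ 2) (κ 1) m

/-- `h` is the eigenvalue with oscillation number `n` of
`(w' / q)' + q (h - l k² sn²(t, k)) w = 0` on `[0, K]` for the ellipsoid `E(ε)` and parity `κ`. -/
def IsLowerEigenvalue (k : ℝ) (κ : Fin 3 → Fin 2) (n : ℕ) (l ε h : ℝ) : Prop :=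
  HasSLEigenfunction (ellK k) (qFun k (axisA k ε) 1)
    (fun t => h - l * k ^ 2 * sn k t ^ 2) (κ 0) (κ 1) n

/-- The eigenvalue function `H_{m,κ}(l, ε)`. -/
def upperH (k : ℝ) (κ : Fin 3 → Fin 2) (m : ℕ) (l ε : ℝ) : ℝ :=
  Classical.epsilon (IsUpperEigenvalue k κ m l ε)

/-- The eigenvalue function `h_{n,κ}(l, ε)`. -/
def lowerH (k : ℝ) (κ : Fin 3 → Fin 2) (n : ℕ) (l ε : ℝ) : ℝ :=
  Classical.epsilon (IsLowerEigenvalue k κ n l ε)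

/-- The eigencurves of indices `m` and `n` meet at the abscissa `l`. -/
def IsIntersection (k : ℝ) (κ : Fin 3 → Fin 2) (m n : ℕ) (ε l : ℝ) : Prop :=
  ∃ h : ℝ, IsUpperEigenvalue k κ m l ε h ∧ IsLowerEigenvalue k κ n l ε h

/-- The eigenvalue `λ_{m,n,κ}(ε)`. -/
def eigenLam (k : ℝ) (κ : Fin 3 → Fin 2) (m n : ℕ) (ε : ℝ) : ℝ :=
  Classical.epsilon (IsIntersection k κ m n ε)

/-- `ℓ = 2m + 2n + |κ|`. -/
def ell (m n : ℕ) (κ : Fin 3 → Fin 2) : ℕ := 2 * m + 2 * n + ∑ i, (κ i : ℕ)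

/-- `Λ_{m,n,κ} = ℓ (ℓ + 1)`. -/
def sphereLam (m n : ℕ) (κ : Fin 3 → Fin 2) : ℝ := (ell m n κ : ℝ) * ((ell m n κ : ℝ) + 1)

/-! ### Lamé polynomials -/

/-- `sn^{κ₁} cn^{κ₂} dn^{κ₃} P(sn²)` on the complex plane. -/
def lameFun (k : ℝ) (κ : Fin 3 → Fin 2) (P : ℝ[X]) (z : ℂ) : ℂ :=
  csn k z ^ (κ 0 : ℕ) * ccn k z ^ (κ 1 : ℕ) * cdn k z ^ (κ 2 : ℕ) * aeval (csn k z ^ 2) P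

/-- `w(t)` for real `t`. -/
def lameW (k : ℝ) (κ : Fin 3 → Fin 2) (P : ℝ[X]) (t : ℝ) : ℂ := lameFun k κ P (t : ℂ)

/-- `v(s) = w(K + i K' - i s)`. -/
def lameV (k : ℝ) (κ : Fin 3 → Fin 2) (P : ℝ[X]) (s : ℝ) : ℂ :=
  lameFun k κ P ((ellK k : ℂ) + Complex.I * (ellK (kc k) : ℂ) - Complex.I * (s : ℂ))

/-- `P` defines a Lamé polynomial `W_{m,n,κ}`. -/
structure IsLamePolynomial (k : ℝ) (κ : Fin 3 → Fin 2) (m n : ℕ) (P : ℝ[X]) : Prop where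
  degree_eq : P.degree = ((m + n : ℕ) : WithBot ℕ)
  lame_eq : ∀ t : ℝ, deriv (deriv (lameW k κ P)) t
    + ((lowerH k κ n (sphereLam m n κ) 0 - sphereLam m n κ * k ^ 2 * sn k t ^ 2 : ℝ) : ℂ)
      * lameW k κ P t = 0
  zeros_v : {s ∈ Ioo 0 (ellK (kc k)) | lameV k κ P s = 0}.encard = m
  zeros_w : {t ∈ Ioo 0 (ellK k) | lameW k κ P t = 0}.encard = n

end NearSphere

end

open NearSphere

/-! At `ε = 0` both weights equal `1`, and the two problems are one equation: Lamé's equation on the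
segment from `0` to `K` and, through `t = K + iK' - is`, on the segment from `K + iK'` to `K`. In
the variable `x = sn²` the two segments become `0 < x < 1` and `1 < x < 1/k²`, and a product `sn^κ₁
cn^κ₂ dn^κ₃ P(sn²)` solves both equations with the same constant `h` as soon as `P` solves one
algebraic equation (`IsJacobiTriple.exists_deriv_lameReal`). Stieltjes' electrostatic argument
supplies such a `P` with `n` roots in the first interval and `m` in the second
(`exists_stieltjes_polynomial`, `exists_lame_polynomial`). So the two eigencurves meet at `l = Λ`
when `ε = 0`.

For `ε` near `0` both problems have the form `(y'/p)' + p (μ - l ρ) y = 0` with `p² = 1 + ε g`. The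
solution with fixed data at `0` comes from inverting the identity minus a Volterra operator on
`C([0, L])`, so it is analytic in `(l, ε, μ)`. The residual of the right boundary condition has a
simple zero in `μ`, because Lagrange's identity turns its derivative into `∫ y² > 0`; the implicit
function theorem then gives an analytic eigenvalue branch. The total rotation of the Prüfer angle is
continuous along this branch while the boundary conditions allow only discrete values, so the number
of zeros does not change. Dividing Lagrange's identity between the perturbed and unperturbed
solutions by the parameter increment gives the first derivatives. All this is
`exists_analytic_eigenvalue`; `integral_mul_deriv_mul` integrates the `ε`-derivative by parts.

Uniqueness is Sturm comparison (`HasSLEigenfunction.not_of_lt`): two strictly ordered potentials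
cannot both have an eigenfunction with the same number of zeros. For equal `l` this makes the
eigenvalue unique, so the functions defined by choice agree with the analytic branches. For
different `l`, the bounds `dn² > k²` and `sn² < 1` inside the intervals force secant slopes above
`k²` for the upper curve and below `k²` for the lower one, so the curves cross at most once. The
integral formulas give `∂H/∂λ > k² ≥ ∂h/∂λ` at the sphere; the crossing is transversal there, and a
second use of the implicit function theorem (`exists_analyticAt_crossing`) makes `λ(ε)` analytic
with the asserted derivative. -/

namespace NearSphere

/-! ### Jacobi elliptic functions on the real line. -/

section Elliptic

variable {k : ℝ}

theorem one_sub_sq_mul_sin_pos (hk : k ∈ Ioo (0 : ℝ) 1) (θ : ℝ) :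
    0 < 1 - k ^ 2 * Real.sin θ ^ 2 := by
  have h1 : k ^ 2 < 1 := by nlinarith [hk.1, hk.2]
  have h2 := Real.sin_sq_le_one θ
  nlinarith [sq_nonneg k, sq_nonneg (Real.sin θ)]

theorem continuous_ellF_integrand (hk : k ∈ Ioo (0 : ℝ) 1) :
    Continuous fun θ => 1 / √(1 - k ^ 2 * Real.sin θ ^ 2) := by
  refine continuous_const.div (by fun_prop) fun θ => ?_
  exact (Real.sqrt_pos.2 (one_sub_sq_mul_sin_pos hk θ)).ne'

theorem hasDerivAt_ellF (hk : k ∈ Ioo (0 : ℝ) 1) (φ : ℝ) :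
    HasDerivAt (ellF k) (1 / √(1 - k ^ 2 * Real.sin φ ^ 2)) φ :=
  intervalIntegral.integral_hasDerivAt_right
    ((continuous_ellF_integrand hk).intervalIntegrable _ _)
    ((continuous_ellF_integrand hk).stronglyMeasurableAtFilter _ _)
    (continuous_ellF_integrand hk).continuousAt

theorem ellF_zero (k : ℝ) : ellF k 0 = 0 := by simp [ellF]

theorem continuous_ellF (hk : k ∈ Ioo (0 : ℝ) 1) : Continuous (ellF k) :=
  continuous_iff_continuousAt.2 fun φ => (hasDerivAt_ellF hk φ).continuousAt

theorem strictMono_ellF (hk : k ∈ Ioo (0 : ℝ) 1) : StrictMono (ellF k) :=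
  strictMono_of_hasDerivAt_pos (hasDerivAt_ellF hk) fun φ =>
    one_div_pos.2 (Real.sqrt_pos.2 (one_sub_sq_mul_sin_pos hk φ))

/-- The integrand of the elliptic integral is at least `1`. The resulting linear growth is what
makes `ellF k` surjective, so that `am` is a genuine inverse. -/
theorem monotone_ellF_sub_id (hk : k ∈ Ioo (0 : ℝ) 1) : Monotone fun φ => ellF k φ - φ := by
  refine monotone_of_hasDerivAt_nonneg (fun φ => (hasDerivAt_ellF hk φ).sub (hasDerivAt_id φ))
    fun φ => ?_
  have h := Real.sqrt_pos.2 (one_sub_sq_mul_sin_pos hk φ)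
  have h' : √(1 - k ^ 2 * Real.sin φ ^ 2) ≤ 1 := by
    rw [Real.sqrt_le_left zero_le_one, one_pow]
    nlinarith [mul_nonneg (sq_nonneg k) (sq_nonneg (Real.sin φ))]
  have := (one_le_one_div h h')
  simpa using this

theorem surjective_ellF (hk : k ∈ Ioo (0 : ℝ) 1) : Function.Surjective (ellF k) := by
  refine (continuous_ellF hk).surjective ?_ ?_
  · refine tendsto_atTop_mono' _ ?_ tendsto_id
    filter_upwards [eventually_ge_atTop 0] with φ hφ
    have := monotone_ellF_sub_id hk hφ
    simp only [ellF_zero] at this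
    simp only [id]; linarith
  · refine tendsto_atBot_mono' _ ?_ tendsto_id
    filter_upwards [eventually_le_atBot 0] with φ hφ
    have := monotone_ellF_sub_id hk hφ
    simp only [ellF_zero] at this
    simp only [id]; linarith

theorem ellF_am (hk : k ∈ Ioo (0 : ℝ) 1) (t : ℝ) : ellF k (am k t) = t :=
  Function.invFun_eq (surjective_ellF hk t)

theorem am_ellF (hk : k ∈ Ioo (0 : ℝ) 1) (φ : ℝ) : am k (ellF k φ) = φ :=
  Function.leftInverse_invFun (strictMono_ellF hk).injective φ

theorem strictMono_am (hk : k ∈ Ioo (0 : ℝ) 1) : StrictMono (am k) := fun s t h => by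
  rwa [← (strictMono_ellF hk).lt_iff_lt, ellF_am hk, ellF_am hk]

theorem continuous_am (hk : k ∈ Ioo (0 : ℝ) 1) : Continuous (am k) :=
  (strictMono_am hk).monotone.continuous_of_surjective fun φ => ⟨_, am_ellF hk φ⟩

theorem dn_pos (hk : k ∈ Ioo (0 : ℝ) 1) (t : ℝ) : 0 < dn k t :=
  Real.sqrt_pos.2 (one_sub_sq_mul_sin_pos hk _)

theorem dn_sq (hk : k ∈ Ioo (0 : ℝ) 1) (t : ℝ) : dn k t ^ 2 = 1 - k ^ 2 * sn k t ^ 2 :=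
  Real.sq_sqrt (one_sub_sq_mul_sin_pos hk _).le

theorem cn_sq (k t : ℝ) : cn k t ^ 2 = 1 - sn k t ^ 2 := by
  have := Real.sin_sq_add_cos_sq (am k t)
  simp only [cn, sn]; linarith

theorem hasDerivAt_am (hk : k ∈ Ioo (0 : ℝ) 1) (t : ℝ) : HasDerivAt (am k) (dn k t) t := by
  have h := HasDerivAt.of_local_left_inverse (continuous_am hk).continuousAt
    (hasDerivAt_ellF hk (am k t))
    (one_div_pos.2 (Real.sqrt_pos.2 (one_sub_sq_mul_sin_pos hk _))).ne'
    (Eventually.of_forall (ellF_am hk))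
  simpa [dn, sn] using h

theorem hasDerivAt_sn (hk : k ∈ Ioo (0 : ℝ) 1) (t : ℝ) :
    HasDerivAt (sn k) (cn k t * dn k t) t := (hasDerivAt_am hk t).sin

theorem hasDerivAt_cn (hk : k ∈ Ioo (0 : ℝ) 1) (t : ℝ) :
    HasDerivAt (cn k) (-(sn k t * dn k t)) t := by
  rw [← neg_mul]; exact (hasDerivAt_am hk t).cos

theorem hasDerivAt_dn (hk : k ∈ Ioo (0 : ℝ) 1) (t : ℝ) :
    HasDerivAt (dn k) (-(k ^ 2 * sn k t * cn k t)) t := by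
  have h := (((hasDerivAt_sn hk t).pow 2).const_mul (k ^ 2)).const_sub 1
  have h2 := h.sqrt (one_sub_sq_mul_sin_pos hk (am k t)).ne'
  have hd := dn_pos hk t
  refine HasDerivAt.congr_deriv h2 ?_
  change _ / (2 * dn k t) = _
  field_simp
  simp
  ring

theorem continuous_sn (hk : k ∈ Ioo (0 : ℝ) 1) : Continuous (sn k) :=
  continuous_iff_continuousAt.2 fun t => (hasDerivAt_sn hk t).continuousAt

theorem continuous_cn (hk : k ∈ Ioo (0 : ℝ) 1) : Continuous (cn k) :=
  continuous_iff_continuousAt.2 fun t => (hasDerivAt_cn hk t).continuousAt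

theorem continuous_dn (hk : k ∈ Ioo (0 : ℝ) 1) : Continuous (dn k) :=
  continuous_iff_continuousAt.2 fun t => (hasDerivAt_dn hk t).continuousAt

theorem kc_mem (hk : k ∈ Ioo (0 : ℝ) 1) : kc k ∈ Ioo (0 : ℝ) 1 := by
  refine ⟨Real.sqrt_pos.2 (by nlinarith [hk.1, hk.2]), ?_⟩
  rw [kc, Real.sqrt_lt' one_pos]
  nlinarith [hk.1]

theorem kc_sq (hk : k ∈ Ioo (0 : ℝ) 1) : kc k ^ 2 = 1 - k ^ 2 :=
  Real.sq_sqrt (by nlinarith [hk.1, hk.2])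

theorem kc_kc (hk : k ∈ Ioo (0 : ℝ) 1) : kc (kc k) = k := by
  rw [kc, kc_sq hk, sub_sub_cancel, Real.sqrt_sq hk.1.le]

theorem am_zero (hk : k ∈ Ioo (0 : ℝ) 1) : am k 0 = 0 := by
  simpa [ellF_zero] using am_ellF hk 0

theorem am_ellK (hk : k ∈ Ioo (0 : ℝ) 1) : am k (ellK k) = Real.pi / 2 := am_ellF hk _

theorem ellK_pos (hk : k ∈ Ioo (0 : ℝ) 1) : 0 < ellK k := by
  rw [← ellF_zero k]; exact strictMono_ellF hk (show (0 : ℝ) < Real.pi / 2 by positivity)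

theorem sn_zero (hk : k ∈ Ioo (0 : ℝ) 1) : sn k 0 = 0 := by simp [sn, am_zero hk]
theorem cn_zero (hk : k ∈ Ioo (0 : ℝ) 1) : cn k 0 = 1 := by simp [cn, am_zero hk]
theorem dn_zero (hk : k ∈ Ioo (0 : ℝ) 1) : dn k 0 = 1 := by simp [dn, sn_zero hk]
theorem sn_ellK (hk : k ∈ Ioo (0 : ℝ) 1) : sn k (ellK k) = 1 := by simp [sn, am_ellK hk]
theorem cn_ellK (hk : k ∈ Ioo (0 : ℝ) 1) : cn k (ellK k) = 0 := by simp [cn, am_ellK hk]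
theorem dn_ellK (hk : k ∈ Ioo (0 : ℝ) 1) : dn k (ellK k) = kc k := by simp [dn, sn_ellK hk, kc]

theorem am_mem_Ioo (hk : k ∈ Ioo (0 : ℝ) 1) {t : ℝ} (ht : t ∈ Ioo 0 (ellK k)) :
    am k t ∈ Ioo 0 (Real.pi / 2) := by
  rw [← am_zero hk, ← am_ellK hk]
  exact ⟨strictMono_am hk ht.1, strictMono_am hk ht.2⟩

theorem sn_pos (hk : k ∈ Ioo (0 : ℝ) 1) {t : ℝ} (ht : t ∈ Ioo 0 (ellK k)) : 0 < sn k t :=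
  Real.sin_pos_of_pos_of_lt_pi (am_mem_Ioo hk ht).1
    (by linarith [(am_mem_Ioo hk ht).2, Real.pi_pos])

theorem cn_pos (hk : k ∈ Ioo (0 : ℝ) 1) {t : ℝ} (ht : t ∈ Ioo 0 (ellK k)) : 0 < cn k t :=
  Real.cos_pos_of_mem_Ioo ⟨by linarith [(am_mem_Ioo hk ht).1, Real.pi_pos], (am_mem_Ioo hk ht).2⟩

theorem sn_sq_lt_one (hk : k ∈ Ioo (0 : ℝ) 1) {t : ℝ} (ht : t ∈ Ioo 0 (ellK k)) :
    sn k t ^ 2 < 1 := by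
  have := cn_sq k t
  nlinarith [cn_pos hk ht]

theorem cn_sq_le_one (k t : ℝ) : cn k t ^ 2 ≤ 1 := by
  have := cn_sq k t; nlinarith [sq_nonneg (sn k t)]

theorem strictMonoOn_sn (hk : k ∈ Ioo (0 : ℝ) 1) : StrictMonoOn (sn k) (Icc 0 (ellK k)) := by
  intro s hs t ht h
  have h0 : am k 0 ≤ am k s := (strictMono_am hk).monotone hs.1
  have h1 : am k t ≤ am k (ellK k) := (strictMono_am hk).monotone ht.2
  rw [am_zero hk] at h0
  rw [am_ellK hk] at h1
  exact Real.sin_lt_sin_of_lt_of_le_pi_div_two (by linarith [Real.pi_pos]) h1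
    (strictMono_am hk h)

/-- Applying `ellF k` to the right-hand side and adding `s` gives a function with zero derivative,
whose value at `s = 0` is `K`. This is the source of the quarter-period formulas for `sn`, `cn`,
`dn`. -/
theorem am_ellK_sub (hk : k ∈ Ioo (0 : ℝ) 1) {s : ℝ} (hs : s ∈ Ico 0 (ellK k)) :
    am k (ellK k - s) = Real.pi / 2 - Real.arctan (kc k * sn k s / cn k s) := by
  have hkc := kc_mem hk
  have hcn : ∀ x ∈ Ico 0 (ellK k), 0 < cn k x := fun x hx => by
    rcases eq_or_lt_of_le hx.1 with h | h
    · rw [← h, cn_zero hk]; exact one_pos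
    · exact cn_pos hk ⟨h, hx.2⟩
  set φ : ℝ → ℝ := fun x => Real.pi / 2 - Real.arctan (kc k * sn k x / cn k x) with hφ
  have hder : ∀ x ∈ Ico 0 (ellK k), HasDerivAt (fun x => ellF k (φ x) + x) 0 x := by
    intro x hx
    have hc := hcn x hx
    have hd := dn_pos hk x
    have h1 : HasDerivAt φ (-(kc k / dn k x)) x := by
      have := ((((hasDerivAt_sn hk x).const_mul (kc k)).div (hasDerivAt_cn hk x)
        hc.ne').arctan).const_sub (Real.pi / 2)
      refine HasDerivAt.congr_deriv this ?_
      have e1 : 1 + (kc k * sn k x / cn k x) ^ 2 = dn k x ^ 2 / cn k x ^ 2 := by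
        field_simp
        rw [dn_sq hk, cn_sq, kc_sq hk]; ring
      simp only [Pi.div_apply]
      rw [e1]
      field_simp
      have := cn_sq k x
      linear_combination (-kc k) * this
    -- The sine of `φ x` is `cn / dn`, so the integrand of `ellF` at `φ x` is `dn / k'`, exactly the
    -- reciprocal of the speed of `φ` up to sign.
    have hs2 : 1 - k ^ 2 * Real.sin (φ x) ^ 2 = (kc k / dn k x) ^ 2 := by
      rw [hφ]
      simp only [Real.sin_pi_div_two_sub, Real.cos_sq_arctan]
      have e1 : 1 + (kc k * sn k x / cn k x) ^ 2 = dn k x ^ 2 / cn k x ^ 2 := by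
        field_simp
        rw [dn_sq hk, cn_sq, kc_sq hk]; ring
      rw [e1]
      field_simp
      rw [dn_sq hk, cn_sq, kc_sq hk]; ring
    have h2 := (hasDerivAt_ellF hk (φ x))
    rw [hs2, Real.sqrt_sq (div_pos hkc.1 hd).le] at h2
    refine HasDerivAt.congr_deriv ((h2.comp x h1).add (hasDerivAt_id x)) ?_
    have := hkc.1
    field_simp
    ring
  have hconst : ellF k (φ s) + s = ellF k (φ 0) + 0 := by
    refine constant_of_has_deriv_right_zero (a := 0) (b := s) (f := fun x => ellF k (φ x) + x)
      ?_ ?_ s ⟨hs.1, le_rfl⟩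
    · intro x hx
      exact (hder x ⟨hx.1, hx.2.trans_lt hs.2⟩).continuousAt.continuousWithinAt
    · intro x hx
      exact (hder x ⟨hx.1, hx.2.trans hs.2⟩).hasDerivWithinAt
  have h0 : φ 0 = Real.pi / 2 := by simp [hφ, sn_zero hk]
  rw [h0, add_zero] at hconst
  have : ellK k - s = ellF k (φ s) := by rw [ellK]; linarith
  rw [this, am_ellF hk]

theorem sn_ellK_sub (hk : k ∈ Ioo (0 : ℝ) 1) {s : ℝ} (hs : s ∈ Icc 0 (ellK k)) :
    sn k (ellK k - s) = cn k s / dn k s := by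
  rcases eq_or_lt_of_le hs.2 with h | h
  · rw [h, sub_self, sn_zero hk, cn_ellK hk, zero_div]
  have hd := dn_pos hk s
  have hc : 0 < cn k s := by
    rcases eq_or_lt_of_le hs.1 with h' | h'
    · rw [← h', cn_zero hk]; exact one_pos
    · exact cn_pos hk ⟨h', h⟩
  rw [sn, am_ellK_sub hk ⟨hs.1, h⟩, Real.sin_pi_div_two_sub, Real.cos_arctan]
  have e1 : 1 + (kc k * sn k s / cn k s) ^ 2 = (dn k s / cn k s) ^ 2 := by
    field_simp
    rw [dn_sq hk, cn_sq, kc_sq hk]; ring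
  rw [e1, Real.sqrt_sq (div_pos hd hc).le, one_div_div]

theorem dn_ellK_sub (hk : k ∈ Ioo (0 : ℝ) 1) {s : ℝ} (hs : s ∈ Icc 0 (ellK k)) :
    dn k (ellK k - s) = kc k / dn k s := by
  have hd := dn_pos hk s
  rw [← Real.sqrt_sq (dn_pos hk (ellK k - s)).le, ← Real.sqrt_sq (div_pos (kc_mem hk).1 hd).le,
    dn_sq hk, sn_ellK_sub hk hs]
  congr 1
  field_simp
  rw [dn_sq hk, cn_sq, kc_sq hk]; ring

theorem cn_ellK_sub (hk : k ∈ Ioo (0 : ℝ) 1) {s : ℝ} (hs : s ∈ Icc 0 (ellK k)) :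
    cn k (ellK k - s) = kc k * sn k s / dn k s := by
  have hd := dn_pos hk s
  have hnn : ∀ x ∈ Icc 0 (ellK k), 0 ≤ sn k x := fun x hx => by
    rw [← sn_zero hk]
    exact (strictMonoOn_sn hk).monotoneOn ⟨le_rfl, (ellK_pos hk).le⟩ hx hx.1
  have hcn : 0 ≤ cn k (ellK k - s) := by
    have h0 := (strictMono_am hk).monotone (show 0 ≤ ellK k - s by linarith [hs.2])
    have h1 := (strictMono_am hk).monotone (show ellK k - s ≤ ellK k by linarith [hs.1])
    rw [am_zero hk] at h0
    rw [am_ellK hk] at h1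
    exact Real.cos_nonneg_of_mem_Icc ⟨by linarith [Real.pi_pos], h1⟩
  rw [← Real.sqrt_sq hcn, cn_sq, sn_ellK_sub hk hs, ← Real.sqrt_sq (div_nonneg (mul_nonneg
    (kc_mem hk).1.le (hnn s hs)) hd.le)]
  congr 1
  field_simp
  rw [dn_sq hk, cn_sq, kc_sq hk]; ring

end Elliptic


/-! ### Prüfer angles, counting of zeros and Sturm comparison. -/

section Sturm

/-- A function with `|E'| ≤ C E` that is positive somewhere is positive everywhere. -/
theorem pos_of_abs_deriv_le {L C : ℝ} {E E' : ℝ → ℝ}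
    (hE : ∀ x ∈ Icc 0 L, HasDerivWithinAt E (E' x) (Icc 0 L) x)
    (hC : ∀ x ∈ Icc 0 L, |E' x| ≤ C * E x) {a : ℝ} (ha : a ∈ Icc 0 L) (hpos : 0 < E a)
    {x : ℝ} (hx : x ∈ Icc 0 L) : 0 < E x := by
  have key : ∀ c : ℝ, ∀ x ∈ Icc 0 L, HasDerivWithinAt (fun x => E x * Real.exp (c * x))
      ((E' x + c * E x) * Real.exp (c * x)) (Icc 0 L) x := fun c x hx => by
    have h1 : HasDerivAt (fun x => Real.exp (c * x)) (Real.exp (c * x) * (c * 1)) x :=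
      ((hasDerivAt_id x).const_mul c).exp
    exact ((hE x hx).mul h1.hasDerivWithinAt).congr_deriv (by ring)
  have hcont : ∀ c : ℝ, ContinuousOn (fun x => E x * Real.exp (c * x)) (Icc 0 L) :=
    fun c x hx => (key c x hx).continuousWithinAt
  rcases le_total a x with h | h
  · have hm : MonotoneOn (fun x => E x * Real.exp (C * x)) (Icc 0 L) :=
      monotoneOn_of_hasDerivWithinAt_nonneg (convex_Icc 0 L) (hcont C)
        (fun x hx => (key C x (interior_subset hx)).mono interior_subset)
        fun x hx => mul_nonneg (by
          have := (abs_le.1 (hC x (interior_subset hx))).1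
          linarith) (Real.exp_pos _).le
    have := hm ha hx h
    exact pos_of_mul_pos_left ((mul_pos hpos (Real.exp_pos _)).trans_le this) (Real.exp_pos _).le
  · have hm : AntitoneOn (fun x => E x * Real.exp (-C * x)) (Icc 0 L) :=
      antitoneOn_of_hasDerivWithinAt_nonpos (convex_Icc 0 L) (hcont (-C))
        (fun x hx => (key (-C) x (interior_subset hx)).mono interior_subset)
        fun x hx => mul_nonpos_of_nonpos_of_nonneg (by
          have := (abs_le.1 (hC x (interior_subset hx))).2
          linarith) (Real.exp_pos _).le
    have := hm hx ha h
    exact pos_of_mul_pos_left ((mul_pos hpos (Real.exp_pos _)).trans_le this) (Real.exp_pos _).le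

/-- A solution of a homogeneous linear first order equation with zero initial value vanishes. -/
theorem eq_zero_of_deriv_eq_mul {L : ℝ} {A c : ℝ → ℝ}
    (hA : ∀ x ∈ Icc 0 L, HasDerivWithinAt A (c x * A x) (Icc 0 L) x)
    (hc : ContinuousOn c (Icc 0 L)) (h0 : A 0 = 0) {x : ℝ} (hx : x ∈ Icc 0 L) : A x = 0 := by
  obtain ⟨C, hC⟩ := isCompact_Icc.exists_bound_of_continuousOn hc
  by_contra hne
  -- Positivity is propagated backwards: if `A x ≠ 0`, then `A²` would also be positive at `0`.
  have h := pos_of_abs_deriv_le (E := fun x => A x ^ 2) (E' := fun x => 2 * c x * A x ^ 2)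
    (C := 2 * C) (fun x hx => ((hA x hx).pow 2).congr_deriv (by simp; ring))
    (fun x hx => by
      have := hC x hx
      rw [Real.norm_eq_abs] at this
      rw [abs_mul, abs_mul, abs_two, abs_of_nonneg (sq_nonneg (A x))]
      nlinarith [sq_nonneg (A x)]) hx (by positivity)
    (show (0 : ℝ) ∈ Icc 0 L from ⟨le_rfl, hx.1.trans hx.2⟩)
  simp [h0] at h

variable {L : ℝ} {p r r₁ r₂ y y₁ θ θ₁ θ₂ : ℝ → ℝ}

theorem IsSLSolution.hasDeriv_mul (h : IsSLSolution L p r y y₁) (hp : ∀ x, 0 < p x) :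
    ∀ x ∈ Icc 0 L, HasDerivWithinAt y (p x * (y₁ x / p x)) (Icc 0 L) x := fun x hx => by
  rw [mul_div_cancel₀ _ (hp x).ne']; exact h.hasDeriv x hx

/-- With `u = y₁ / p` the energy `E = y² + u²` has derivative `2 p (1 - r) y u`, hence `|E'| ≤ C E`
on the compact interval. So a nontrivial solution never vanishes together with its derivative. -/
theorem IsSLSolution.sq_add_sq_pos (h : IsSLSolution L p r y y₁) (hp : ∀ x, 0 < p x)
    (hpc : Continuous p) (hr : Continuous r) {a : ℝ} (ha : a ∈ Icc 0 L)
    (hne : y a ≠ 0 ∨ y₁ a ≠ 0) {x : ℝ} (hx : x ∈ Icc 0 L) : 0 < y x ^ 2 + (y₁ x / p x) ^ 2 := by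
  obtain ⟨C, hC⟩ := isCompact_Icc.exists_bound_of_continuousOn
    (s := Icc 0 L) (f := fun x => p x * (1 - r x)) (by fun_prop)
  refine pos_of_abs_deriv_le (E := fun x => y x ^ 2 + (y₁ x / p x) ^ 2)
    (E' := fun x => 2 * (p x * (1 - r x)) * (y x * (y₁ x / p x))) (C := C) ?_ ?_ ha ?_ hx
  · intro x hx
    refine (((h.hasDeriv_mul hp x hx).pow 2).add ((h.hasDeriv_div x hx).pow 2)).congr_deriv ?_
    simp; ring
  · intro x hx
    have h1 := hC x hx
    rw [Real.norm_eq_abs] at h1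
    rw [abs_mul, abs_mul, abs_two]
    have h2 : 2 * |y x * (y₁ x / p x)| ≤ y x ^ 2 + (y₁ x / p x) ^ 2 := by
      rw [← abs_two, ← abs_mul, abs_le]
      constructor
      · nlinarith [sq_nonneg (y x + y₁ x / p x)]
      · nlinarith [sq_nonneg (y x - y₁ x / p x)]
    calc 2 * |p x * (1 - r x)| * |y x * (y₁ x / p x)|
        = |p x * (1 - r x)| * (2 * |y x * (y₁ x / p x)|) := by ring
      _ ≤ C * (y x ^ 2 + (y₁ x / p x) ^ 2) :=
        mul_le_mul h1 h2 (by positivity) ((abs_nonneg _).trans h1)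
  · have := hp a
    rcases hne with h | h <;> positivity

/-- `θ` is a Prüfer angle of the solution `y` of `(y' / p)' + p r y = 0` with derivative `y₁`. -/
structure IsPrufer (L : ℝ) (p r y y₁ θ : ℝ → ℝ) : Prop where
  continuous : Continuous θ
  hasDerivAt : ∀ x ∈ Icc 0 L,
    HasDerivAt θ (-(p x * (Real.sin (θ x) ^ 2 + r x * Real.cos (θ x) ^ 2))) x
  cos_eq_zero_iff : ∀ x ∈ Icc 0 L, Real.cos (θ x) = 0 ↔ y x = 0
  sin_eq_zero_iff : ∀ x ∈ Icc 0 L, Real.sin (θ x) = 0 ↔ y₁ x = 0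

/-- The angle is defined as the integral of the derivative it must have, which avoids lifting an
argument continuously; that it really is an angle of `(y, y₁ / p)` is checked afterwards. The
explicit value at `L` matters later: it depends continuously on the solution. -/
theorem IsSLSolution.exists_prufer (h : IsSLSolution L p r y y₁) (hL : 0 ≤ L) (hp : ∀ x, 0 < p x)
    (hpc : Continuous p) (hr : Continuous r) {a : ℝ} (ha : a ∈ Icc 0 L)
    (hne : y a ≠ 0 ∨ y₁ a ≠ 0) {θ₀ : ℝ} (hθ₀ : y 0 * Real.sin θ₀ = y₁ 0 / p 0 * Real.cos θ₀) :
    ∃ θ : ℝ → ℝ, IsPrufer L p r y y₁ θ ∧ θ 0 = θ₀ ∧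
      θ L = θ₀ - ∫ x in (0 : ℝ)..L, p x * (r x * y x ^ 2 + (y₁ x / p x) ^ 2) /
        (y x ^ 2 + (y₁ x / p x) ^ 2) := by
  set u : ℝ → ℝ := fun x => y₁ x / p x with hu
  have hpos : ∀ x ∈ Icc 0 L, 0 < y x ^ 2 + u x ^ 2 := fun x hx =>
    h.sq_add_sq_pos hp hpc hr ha hne hx
  have hyc : ContinuousOn y (Icc 0 L) := fun x hx => (h.hasDeriv x hx).continuousWithinAt
  have huc : ContinuousOn u (Icc 0 L) := fun x hx => (h.hasDeriv_div x hx).continuousWithinAt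
  set f : ℝ → ℝ := fun x => p x * (r x * y x ^ 2 + u x ^ 2) / (y x ^ 2 + u x ^ 2) with hf
  have hfc : ContinuousOn f (Icc 0 L) :=
    ContinuousOn.div (by fun_prop) (by fun_prop) fun x hx => (hpos x hx).ne'
  -- The integrand is extended by its end values, so that the angle is differentiable on all of `ℝ`.
  set F : ℝ → ℝ := IccExtend hL ((Icc 0 L).domRestrict f) with hF
  have hFc : Continuous F := (continuousOn_iff_continuous_domRestrict.1 hfc).Icc_extend'
  have hFf : ∀ x ∈ Icc 0 L, F x = f x := fun x hx => by
    rw [hF, IccExtend_of_mem hL _ hx]; rfl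
  set θ : ℝ → ℝ := fun x => θ₀ - ∫ t in (0 : ℝ)..x, F t with hθ
  have hder : ∀ x, HasDerivAt θ (-(F x)) x := fun x =>
    (intervalIntegral.integral_hasDerivAt_right (hFc.intervalIntegrable _ _)
      (hFc.stronglyMeasurableAtFilter _ _) hFc.continuousAt).const_sub θ₀
  have hθc : Continuous θ := continuous_iff_continuousAt.2 fun x => (hder x).continuousAt
  have hθ0 : θ 0 = θ₀ := by simp [hθ]
  have hA : ∀ x ∈ Icc 0 L, y x * Real.sin (θ x) - u x * Real.cos (θ x) = 0 := by
    intro x hx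
    -- Put `A = y sin θ - u cos θ` and `B = y cos θ + u sin θ`. Since `y² + u² = A² + B²`, the
    -- derivative `A'` is a multiple of `A` itself; `c` is the resulting factor.
    refine eq_zero_of_deriv_eq_mul (L := L)
      (A := fun x => y x * Real.sin (θ x) - u x * Real.cos (θ x))
      (c := fun x => ((y x * Real.sin (θ x) - u x * Real.cos (θ x)) *
        (p x * u x * Real.sin (θ x) + p x * r x * y x * Real.cos (θ x)) +
        (y x * Real.cos (θ x) + u x * Real.sin (θ x)) *
        (-(p x * r x * y x) * Real.sin (θ x) + p x * u x * Real.cos (θ x))) /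
          (y x ^ 2 + u x ^ 2)) ?_ ?_ ?_ hx
    · intro x hx
      have hs := (hder x).sin.hasDerivWithinAt (s := Icc 0 L)
      have hc := (hder x).cos.hasDerivWithinAt (s := Icc 0 L)
      refine (((h.hasDeriv_mul hp x hx).mul hs).sub ((h.hasDeriv_div x hx).mul hc)).congr_deriv ?_
      have hne := (hpos x hx).ne'
      have e := Real.sin_sq_add_cos_sq (θ x)
      have eF : F x * (y x ^ 2 + u x ^ 2) = p x * (r x * y x ^ 2 + u x ^ 2) := by
        rw [hFf x hx, hf, div_mul_cancel₀ _ hne]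
      change p x * u x * _ + _ - (_ + u x * _) = _
      have hdiv : ∀ {X N ρ A : ℝ}, ρ ≠ 0 → X * ρ = N * A → X = N / ρ * A := fun hρ h => by
        rw [div_mul_eq_mul_div, eq_div_iff hρ, h]
      refine hdiv hne ?_
      linear_combination (-(y x * Real.cos (θ x) + u x * Real.sin (θ x))) * eF -
        ((p x * u x * Real.sin (θ x) + p x * r x * y x * Real.cos (θ x)) * (y x ^ 2 + u x ^ 2) -
          p x * (r x * y x ^ 2 + u x ^ 2) * (y x * Real.cos (θ x) + u x * Real.sin (θ x))) * e
    · refine ContinuousOn.div ?_ (by fun_prop) fun x hx => (hpos x hx).ne'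
      fun_prop
    · simp only [hθ0]; rw [hθ₀]; simp [hu]
  have hcos : ∀ x ∈ Icc 0 L, (y x ^ 2 + u x ^ 2) * Real.cos (θ x) ^ 2 = y x ^ 2 := fun x hx => by
    linear_combination (-(y x * Real.sin (θ x)) - u x * Real.cos (θ x)) * hA x hx +
      y x ^ 2 * Real.sin_sq_add_cos_sq (θ x)
  have hsin : ∀ x ∈ Icc 0 L, (y x ^ 2 + u x ^ 2) * Real.sin (θ x) ^ 2 = u x ^ 2 := fun x hx => by
    linear_combination (y x * Real.sin (θ x) + u x * Real.cos (θ x)) * hA x hx +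
      u x ^ 2 * Real.sin_sq_add_cos_sq (θ x)
  refine ⟨θ, ⟨hθc, fun x hx => (hder x).congr_deriv ?_, fun x hx => ?_, fun x hx => ?_⟩, hθ0, ?_⟩
  · have hp' := hpos x hx
    rw [hFf x hx, hf, neg_inj, div_eq_iff hp'.ne']
    linear_combination (-p x) * hsin x hx - p x * r x * hcos x hx
  · rw [← pow_eq_zero_iff two_ne_zero, ← pow_eq_zero_iff (a := y x) two_ne_zero, ← hcos x hx]
    simp [(hpos x hx).ne']
  · have : y₁ x = 0 ↔ u x = 0 := by simp [hu, (hp x).ne']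
    rw [this, ← pow_eq_zero_iff two_ne_zero, ← pow_eq_zero_iff (a := u x) two_ne_zero, ← hsin x hx]
    simp [(hpos x hx).ne']
  · change θ₀ - _ = θ₀ - _
    congr 1
    refine intervalIntegral.integral_congr fun x hx => ?_
    rw [uIcc_of_le hL] at hx
    exact hFf x hx

/-- A Prüfer angle passes downwards through each zero of the cosine. -/
theorem IsPrufer.lt_of_le (h : IsPrufer L p r y y₁ θ) (hp : ∀ x, 0 < p x) {c : ℝ}
    (hc : Real.cos c = 0) {a x : ℝ} (ha : 0 ≤ a) (hax : a < x) (hx : x ≤ L) (hac : θ a ≤ c) :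
    θ x < c := by
  -- Where the cosine vanishes the term with `r` drops out and the slope of the angle is `-p x`,
  -- whatever the potential is.
  have hd : ∀ x ∈ Icc 0 L, θ x = c →
      -(p x * (Real.sin (θ x) ^ 2 + r x * Real.cos (θ x) ^ 2)) < 0 := fun x hx hxc => by
    have := Real.sin_sq_add_cos_sq c
    rw [hxc, Real.sin_sq, hc]
    have := hp x
    simpa using this
  have hle : ∀ z ∈ Icc a x, θ z ≤ c := by
    intro z hz
    refine image_le_of_deriv_right_lt_deriv_boundary' (f := θ) (B := fun _ => c)
      (B' := fun _ => 0) h.continuous.continuousOn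
      (fun z hz => (h.hasDerivAt z ⟨ha.trans hz.1, hz.2.le.trans hx⟩).hasDerivWithinAt) hac
      continuousOn_const (fun z _ => (hasDerivAt_const z c).hasDerivWithinAt)
      (fun z hz hzc => hd z ⟨ha.trans hz.1, hz.2.le.trans hx⟩ hzc) hz
  -- Equality at `x` would require nonnegative left difference quotients there, against the negative
  -- slope.
  refine lt_of_le_of_ne (hle x ⟨hax.le, le_rfl⟩) fun hxc => ?_
  have hmem : x ∈ Icc 0 L := ⟨ha.trans hax.le, hx⟩
  have h1 := (h.hasDerivAt x hmem).hasDerivWithinAt (s := Iic x)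
  have h2 : HasDerivWithinAt θ (-(p x * (Real.sin (θ x) ^ 2 + r x * Real.cos (θ x) ^ 2)))
      (Iio x) x := h1.mono Iio_subset_Iic_self
  rw [hasDerivWithinAt_iff_tendsto_slope' (by simp)] at h2
  have h3 := h2.eventually_lt_const (hd x hmem hxc)
  have h4 : ∀ᶠ z in 𝓝[<] x, z ∈ Ioo a x := Ioo_mem_nhdsLT hax
  obtain ⟨z, hz3, hz4⟩ := (h3.and h4).exists
  have h5 := hle z ⟨hz4.1.le, hz4.2.le⟩
  rw [slope_def_field, hxc] at hz3
  have : 0 ≤ (θ z - c) / (z - x) := div_nonneg_of_nonpos (by linarith) (by linarith [hz4.2])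
  linarith

theorem cos_neg_pi_div_two_sub (j : ℤ) : Real.cos (-(Real.pi / 2) - j * Real.pi) = 0 := by
  rw [Real.cos_eq_zero_iff]
  exact ⟨-j - 1, by push_cast; ring⟩

/-- The Prüfer angle at the right end point counts the interior zeros of the solution. -/
theorem IsPrufer.encard_zeros_eq_iff (h : IsPrufer L p r y y₁ θ) (hL : 0 < L)
    (hp : ∀ x, 0 < p x) {j₀ j₁ : Fin 2} (h0 : θ 0 = Real.pi / 2 * (j₀ : ℕ))
    (hbc : BdryCond j₁ y y₁ L) (n : ℕ) :
    {x ∈ Ioo 0 L | y x = 0}.encard = n ↔ θ L = -(n * Real.pi) - Real.pi / 2 * (j₁ : ℕ) := by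
  have hpi := Real.pi_pos
  -- A Dirichlet start sits on the level `π / 2`; it is left downwards at once and so contributes no
  -- interior zero.
  have hlt : ∀ x ∈ Ioc 0 L, θ x < Real.pi / 2 := fun x hx =>
    h.lt_of_le hp Real.cos_pi_div_two le_rfl hx.1 hx.2 (by
      rw [h0]
      fin_cases j₀
      · simp; positivity
      · simp)
  have hge : -(Real.pi / 2) < θ 0 := by
    rw [h0]; fin_cases j₀ <;> simp <;> linarith
  -- These are the zeros of the cosine below the starting angle. Each one above `θ L` is crossed
  -- exactly once, so interior zeros of `y` correspond to the indices in `J`.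
  set c : ℕ → ℝ := fun j => -(Real.pi / 2) - j * Real.pi with hc
  have hcos : ∀ j, Real.cos (c j) = 0 := fun j => by
    simpa [hc] using cos_neg_pi_div_two_sub (j : ℤ)
  set J : Set ℕ := {j | θ L < c j} with hJ
  have hex : ∀ j ∈ J, ∃ x ∈ Ioo 0 L, θ x = c j := fun j hj => by
    have := intermediate_value_Ioo' hL.le h.continuous.continuousOn
    obtain ⟨x, hx, hxj⟩ := this (show c j ∈ Ioo (θ L) (θ 0) from ⟨hj, by
      have : (0 : ℝ) ≤ j * Real.pi := by positivity
      simp only [hc]; linarith⟩)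
    exact ⟨x, hx, hxj⟩
  choose! f hf hfc using hex
  have himg : f '' J = {x ∈ Ioo 0 L | y x = 0} := by
    ext x
    constructor
    · rintro ⟨j, hj, rfl⟩
      refine ⟨hf j hj, ?_⟩
      rw [← h.cos_eq_zero_iff _ (Ioo_subset_Icc_self (hf j hj)), hfc j hj]
      exact hcos j
    · rintro ⟨hx, hy⟩
      rw [← h.cos_eq_zero_iff _ (Ioo_subset_Icc_self hx), Real.cos_eq_zero_iff] at hy
      obtain ⟨i, hi⟩ := hy
      have h1 := hlt x ⟨hx.1, hx.2.le⟩
      have hi0 : i < 0 := by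
        by_contra hcon
        have : (0 : ℝ) ≤ i := by exact_mod_cast not_lt.1 hcon
        nlinarith
      obtain ⟨j, hj⟩ := Int.eq_ofNat_of_zero_le (show 0 ≤ -i - 1 by lia)
      have hxj : θ x = c j := by
        have : (i : ℝ) = -j - 1 := by
          have : i = -j - 1 := by lia
          rw [this]; push_cast; ring
        rw [hi, this]; simp only [hc]; ring
      have hjJ : j ∈ J := h.lt_of_le hp (hcos j) hx.1.le hx.2 le_rfl hxj.le
      refine ⟨j, hjJ, ?_⟩
      rcases lt_trichotomy (f j) x with hlt' | heq | hgt
      · have := h.lt_of_le hp (hcos j) (hf j hjJ).1.le hlt' hx.2.le (hfc j hjJ).le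
        exact absurd hxj this.ne
      · exact heq
      · have := h.lt_of_le hp (hcos j) hx.1.le hgt (hf j hjJ).2.le hxj.le
        exact absurd (hfc j hjJ) this.ne
  have hinj : InjOn f J := fun i hi j hj hij => by
    have := hfc i hi
    rw [hij, hfc j hj] at this
    simp only [hc] at this
    have h2 : ((j : ℝ) - i) * Real.pi = 0 := by linarith
    have h3 : (j : ℝ) - i = 0 := by simpa [hpi.ne'] using h2
    have : (j : ℝ) = i := by linarith
    exact_mod_cast this.symm
  -- The right boundary condition restricts `θ L` to a discrete set, and `θ L < π / 2` makes the
  -- index nonnegative.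
  obtain ⟨N, hN⟩ : ∃ N : ℕ, θ L = -(N * Real.pi) - Real.pi / 2 * (j₁ : ℕ) := by
    have h1 := hlt L ⟨hL, le_rfl⟩
    have hLmem : L ∈ Icc 0 L := ⟨hL.le, le_rfl⟩
    fin_cases j₁
    · have hs : Real.sin (θ L) = 0 := (h.sin_eq_zero_iff L hLmem).2 (by simpa [BdryCond] using hbc)
      obtain ⟨i, hi⟩ := Real.sin_eq_zero_iff.1 hs
      have hi0 : i ≤ 0 := by
        by_contra hcon
        have : (1 : ℝ) ≤ i := by exact_mod_cast not_le.1 hcon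
        nlinarith
      obtain ⟨j, hj⟩ := Int.eq_ofNat_of_zero_le (show 0 ≤ -i by lia)
      refine ⟨j, ?_⟩
      have : (i : ℝ) = -j := by
        have : i = -j := by lia
        rw [this]; push_cast; ring
      rw [← hi, this]; simp
    · have hs : Real.cos (θ L) = 0 := (h.cos_eq_zero_iff L hLmem).2 (by simpa [BdryCond] using hbc)
      obtain ⟨i, hi⟩ := Real.cos_eq_zero_iff.1 hs
      have hi0 : i < 0 := by
        by_contra hcon
        have : (0 : ℝ) ≤ i := by exact_mod_cast not_lt.1 hcon
        nlinarith
      obtain ⟨j, hj⟩ := Int.eq_ofNat_of_zero_le (show 0 ≤ -i - 1 by lia)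
      refine ⟨j, ?_⟩
      have : (i : ℝ) = -j - 1 := by
        have : i = -j - 1 := by lia
        rw [this]; push_cast; ring
      rw [hi, this]; simp; ring
  -- For a Neumann end `θ L` lies midway between two levels. For a Dirichlet end `θ L = c N`; that
  -- level is reached only at `L`, and the strict inequality in `J` leaves it out.
  have hJN : J = ↑(Finset.range N) := by
    ext j
    simp only [hJ, hc, hN, mem_ofPred_eq, Finset.coe_range, mem_Iio]
    rw [← Nat.cast_lt (α := ℝ)]
    fin_cases j₁
    · simp only [Nat.cast_zero, mul_zero, sub_zero]
      constructor
      · intro h; nlinarith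
      · intro h
        have : (j : ℝ) + 1 ≤ N := by exact_mod_cast Nat.succ_le_of_lt (by exact_mod_cast h)
        nlinarith
    · simp only [Nat.cast_one, mul_one]
      constructor
      · intro h; nlinarith
      · intro h; nlinarith
  rw [← himg, hinj.encard_image, hJN, encard_coe_eq_coe_finsetCard, Finset.card_range, hN]
  constructor
  · intro h
    rw [show N = n by exact_mod_cast h]
  · intro h
    have : ((N : ℝ) - n) * Real.pi = 0 := by linarith
    have h3 : (N : ℝ) - n = 0 := by simpa [hpi.ne'] using this
    have : (N : ℝ) = n := by linarith
    exact_mod_cast this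

/-- Strict comparison of Prüfer angles. -/
theorem IsPrufer.lt_of_potential_lt {z z₁ : ℝ → ℝ} (h₁ : IsPrufer L p r₁ y y₁ θ₁)
    (h₂ : IsPrufer L p r₂ z z₁ θ₂) (hL : 0 < L) (hp : ∀ x, 0 < p x)
    (hpc : Continuous p) (hr₁ : Continuous r₁) (h0 : θ₁ 0 = θ₂ 0)
    (hle : ∀ x ∈ Icc 0 L, r₁ x ≤ r₂ x) (hlt : ∀ x ∈ Ioo 0 L, r₁ x < r₂ x)
    (hz : ∃ x ∈ Ioo 0 L, z x ≠ 0) : θ₂ L < θ₁ L := by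
  have hc₁ := h₁.continuous
  have hc₂ := h₂.continuous
  -- The difference `δ = θ₁ - θ₂` satisfies `δ' = c δ + p (r₂ - r₁) cos² θ₂`, because `cos² θ₂ -
  -- cos² θ₁ = sin (θ₁ + θ₂) sin δ`; `sinc` divides `sin δ` by `δ` without a singularity. The
  -- exponential in `W` is the integrating factor.
  set c : ℝ → ℝ := fun x => p x * (r₁ x - 1) * Real.sin (θ₁ x + θ₂ x) * Real.sinc (θ₁ x - θ₂ x)
  have hcc : Continuous c := by
    have := Real.continuous_sinc
    fun_prop
  have hC : ∀ x, HasDerivAt (fun x => ∫ t in (0 : ℝ)..x, c t) (c x) x := fun x =>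
    intervalIntegral.integral_hasDerivAt_right (hcc.intervalIntegrable _ _)
      (hcc.stronglyMeasurableAtFilter _ _) hcc.continuousAt
  set W : ℝ → ℝ := fun x => (θ₁ x - θ₂ x) * Real.exp (-∫ t in (0 : ℝ)..x, c t) with hW
  have hW' : ∀ x ∈ Icc 0 L, HasDerivAt W (p x * (r₂ x - r₁ x) * Real.cos (θ₂ x) ^ 2 *
      Real.exp (-∫ t in (0 : ℝ)..x, c t)) x := by
    intro x hx
    refine (((h₁.hasDerivAt x hx).sub (h₂.hasDerivAt x hx)).mul (hC x).neg.exp).congr_deriv ?_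
    have e1 : (θ₁ x - θ₂ x) * Real.sinc (θ₁ x - θ₂ x) = Real.sin (θ₁ x - θ₂ x) := by
      by_cases h : θ₁ x - θ₂ x = 0
      · simp [h]
      · rw [Real.sinc_of_ne_zero h, mul_div_cancel₀ _ h]
    have e2 : Real.sin (θ₁ x + θ₂ x) * Real.sin (θ₁ x - θ₂ x) =
        Real.cos (θ₂ x) ^ 2 - Real.cos (θ₁ x) ^ 2 := by
      rw [Real.sin_add, Real.sin_sub]
      linear_combination Real.cos (θ₂ x) ^ 2 * Real.sin_sq_add_cos_sq (θ₁ x) -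
        Real.cos (θ₁ x) ^ 2 * Real.sin_sq_add_cos_sq (θ₂ x)
    have s1 := Real.sin_sq_add_cos_sq (θ₁ x)
    have s2 := Real.sin_sq_add_cos_sq (θ₂ x)
    simp only [c, Pi.sub_apply]
    linear_combination (Real.exp (-∫ t in (0 : ℝ)..x, c t)) *
      (-(p x * (r₁ x - 1) * Real.sin (θ₁ x + θ₂ x)) * e1 - p x * (r₁ x - 1) * e2
        - p x * s1 + p x * s2)
  have hmono : MonotoneOn W (Icc 0 L) := by
    refine monotoneOn_of_hasDerivWithinAt_nonneg (convex_Icc 0 L)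
      (fun x hx => (hW' x hx).continuousAt.continuousWithinAt)
      (fun x hx => (hW' x (interior_subset hx)).hasDerivWithinAt) fun x hx => ?_
    have := hle x (interior_subset hx)
    have hpx := hp x
    have : 0 ≤ r₂ x - r₁ x := by linarith
    positivity
  have hW0 : W 0 = 0 := by simp [hW, h0]
  -- Otherwise the monotone function `W` is zero at `0` and nonpositive at `L`, hence identically
  -- zero, although its derivative is positive wherever `z` does not vanish inside.
  by_contra hcon
  have h0m : (0 : ℝ) ∈ Icc 0 L := ⟨le_rfl, hL.le⟩
  have hLm : L ∈ Icc 0 L := ⟨hL.le, le_rfl⟩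
  have hWL : W L ≤ 0 := mul_nonpos_of_nonpos_of_nonneg (by linarith) (Real.exp_pos _).le
  have hWz : ∀ x ∈ Icc 0 L, W x = 0 := fun x hx =>
    le_antisymm ((hmono hx hLm hx.2).trans hWL) (hW0 ▸ hmono h0m hx hx.1)
  obtain ⟨x, hx, hzx⟩ := hz
  have hev : W =ᶠ[𝓝 x] fun _ => 0 := by
    filter_upwards [Icc_mem_nhds hx.1 hx.2] with t ht using hWz t ht
  have hxm := Ioo_subset_Icc_self hx
  have := (hW' x hxm).unique ((hasDerivAt_const x (0 : ℝ)).congr_of_eventuallyEq hev)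
  have hcosne : Real.cos (θ₂ x) ≠ 0 := fun hcos => hzx ((h₂.cos_eq_zero_iff x hxm).1 hcos)
  have hpos : 0 < r₂ x - r₁ x := by linarith [hlt x hx]
  have hpx := hp x
  have : 0 < p x * (r₂ x - r₁ x) * Real.cos (θ₂ x) ^ 2 *
      Real.exp (-∫ t in (0 : ℝ)..x, c t) := by positivity
  linarith

/-- The starting angle depends only on the type of the left boundary condition. Solutions to be
compared therefore start from the same angle. -/
theorem pruferInit {j₀ : Fin 2} {a q : ℝ} (hbc : BdryCond j₀ y y₁ a) :
    y a * Real.sin (Real.pi / 2 * (j₀ : ℕ)) = y₁ a / q * Real.cos (Real.pi / 2 * (j₀ : ℕ)) := by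
  fin_cases j₀
  · have : y₁ a = 0 := by simpa [BdryCond] using hbc
    simp [this]
  · have : y a = 0 := by simpa [BdryCond] using hbc
    simp [this]

/-- Sturm: for strictly ordered potentials the eigenfunctions of the same boundary value problem
have different numbers of zeros. -/
theorem HasSLEigenfunction.not_of_lt {j₀ j₁ : Fin 2} {n : ℕ}
    (h₁ : HasSLEigenfunction L p r₁ j₀ j₁ n) (h₂ : HasSLEigenfunction L p r₂ j₀ j₁ n)
    (hL : 0 < L) (hp : ∀ x, 0 < p x) (hpc : Continuous p) (hr₁ : Continuous r₁)
    (hr₂ : Continuous r₂) (hle : ∀ x ∈ Icc 0 L, r₁ x ≤ r₂ x)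
    (hlt : ∀ x ∈ Ioo 0 L, r₁ x < r₂ x) : False := by
  obtain ⟨y, y₁, hs, ⟨a, ha, hya⟩, hb0, hbL, hn⟩ := h₁
  obtain ⟨z, z₁, ht, ⟨b, hb, hzb⟩, hc0, hcL, hm⟩ := h₂
  obtain ⟨θ₁, hθ₁, h10, -⟩ := hs.exists_prufer hL.le hp hpc hr₁ ha (Or.inl hya) (pruferInit hb0)
  obtain ⟨θ₂, hθ₂, h20, -⟩ := ht.exists_prufer hL.le hp hpc hr₂ hb (Or.inl hzb) (pruferInit hc0)
  have e1 := (hθ₁.encard_zeros_eq_iff hL hp h10 hbL n).1 hn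
  have e2 := (hθ₂.encard_zeros_eq_iff hL hp h20 hcL n).1 hm
  -- Equal numbers of zeros force equal terminal angles, while the comparison makes them strictly
  -- ordered.
  refine absurd (hθ₁.lt_of_potential_lt hθ₂ hL hp hpc hr₁ (h10.trans h20.symm) hle hlt ?_)
    (by rw [e1, e2]; exact lt_irrefl _)
  by_contra hcon
  push Not at hcon
  have : {x ∈ Ioo 0 L | z x = 0} = Ioo 0 L := by
    ext x; exact ⟨fun h => h.1, fun h => ⟨h, hcon x h⟩⟩
  rw [this, (Ioo_infinite hL).encard_eq] at hm
  simp at hm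

end Sturm


/-! ### Implicit functions and analytic dependence of solutions on the coefficients. -/

section Volterra

open scoped ContDiff

/-- The analytic implicit function theorem for one scalar equation in one scalar unknown. -/
theorem exists_analyticAt_implicit {X : Type*} [NormedAddCommGroup X] [NormedSpace ℝ X]
    [CompleteSpace X] {F : X × ℝ → ℝ} {x₀ : X} {a d : ℝ} (hF : AnalyticAt ℝ F (x₀, a))
    (h : HasDerivAt (fun t => F (x₀, t)) d a) (hd : d ≠ 0) :
    ∃ φ : X → ℝ, AnalyticAt ℝ φ x₀ ∧ φ x₀ = a ∧ ∀ᶠ x in 𝓝 x₀, F (x, φ x) = F (x₀, a) := by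
  have cdf : ContDiffAt ℝ ω F (x₀, a) := hF.contDiffAt
  have h1 : fderiv ℝ F (x₀, a) (0, 1) = d := by
    have h2 : HasDerivAt (fun t : ℝ => (x₀, t)) ((0 : X), (1 : ℝ)) a :=
      (hasDerivAt_const a x₀).prodMk (hasDerivAt_id a)
    exact (hF.differentiableAt.hasFDerivAt.comp_hasDerivAt a h2).unique h
  have hinv : (fderiv ℝ F (x₀, a) ∘L .inr ℝ X ℝ).IsInvertible := by
    refine ContinuousLinearMap.IsInvertible.of_inverse
      (g := d⁻¹ • ContinuousLinearMap.id ℝ ℝ) ?_ ?_ <;>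
    · ext
      simp [h1, hd]
  refine ⟨cdf.implicitFunction (by simp) hinv, ?_,
    cdf.implicitFunction_apply_self (by simp) hinv,
    cdf.eventually_apply_implicitFunction (by simp) hinv⟩
  exact (cdf.contDiffAt_implicitFunction (by simp) hinv).analyticAt

theorem analyticAt_one_sub_comp {E X : Type*} [NormedAddCommGroup E] [NormedSpace ℝ E]
    [NormedAddCommGroup X] [NormedSpace ℝ X] (P : E →L[ℝ] E) {A B : X → E →L[ℝ] E} {x₀ : X}
    (hA : AnalyticAt ℝ A x₀) (hB : AnalyticAt ℝ B x₀) :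
    AnalyticAt ℝ (fun x => 1 - P ∘L (A x + B x ∘L P)) x₀ :=
  analyticAt_const.sub (((ContinuousLinearMap.compL ℝ E E E P).analyticAt _).comp
    (hA.add ((((ContinuousLinearMap.compL ℝ E E E).flip P).analyticAt _).comp hB)))

theorem analyticAt_apply {E X : Type*} [NormedAddCommGroup E] [NormedSpace ℝ E]
    [NormedAddCommGroup X] [NormedSpace ℝ X] {A : X → E →L[ℝ] E} {v : X → E} {x₀ : X}
    (hA : AnalyticAt ℝ A x₀) (hv : AnalyticAt ℝ v x₀) : AnalyticAt ℝ (fun x => A x (v x)) x₀ :=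
  ((ContinuousLinearMap.id ℝ (E →L[ℝ] E)).analyticAt_bilinear (A x₀, v x₀)).comp_of_eq
    (hA.prod hv) rfl

variable {L : ℝ} (hL : 0 ≤ L)

/-- The primitive vanishing at `0`, as a bounded operator on `C([0, L])`. -/
noncomputable def primLin : C(Icc (0 : ℝ) L, ℝ) →ₗ[ℝ] C(Icc (0 : ℝ) L, ℝ) where
  toFun f := ⟨fun x => ∫ t in (0 : ℝ)..x, IccExtend hL f t, by
    have hc : Continuous (IccExtend hL f) := f.continuous.Icc_extend'
    have := intervalIntegral.continuous_primitive (μ := MeasureTheory.volume)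
      (fun a b => hc.intervalIntegrable a b) 0
    exact this.comp continuous_subtype_val⟩
  map_add' f g := by
    ext x
    have hf : Continuous (IccExtend hL f) := f.continuous.Icc_extend'
    have hg : Continuous (IccExtend hL g) := g.continuous.Icc_extend'
    exact intervalIntegral.integral_add (hf.intervalIntegrable _ _) (hg.intervalIntegrable _ _)
  map_smul' c f := by
    ext x
    exact intervalIntegral.integral_const_mul c _

theorem primLin_apply (f : C(Icc (0 : ℝ) L, ℝ)) (x : Icc (0 : ℝ) L) :
    primLin hL f x = ∫ t in (0 : ℝ)..x, IccExtend hL f t := rfl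

/-- Each integration gains a factor `x / (n + 1)`. Iterating this produces the factorial decay of
powers of a Volterra operator. -/
theorem abs_primLin_le (f : C(Icc (0 : ℝ) L, ℝ)) {A : ℝ} {n : ℕ}
    (hf : ∀ x, |f x| ≤ A * (x : ℝ) ^ n / n.factorial) (x : Icc (0 : ℝ) L) :
    |primLin hL f x| ≤ A * (x : ℝ) ^ (n + 1) / (n + 1).factorial := by
  have h := intervalIntegral.norm_integral_le_of_norm_le (μ := MeasureTheory.volume)
    (f := IccExtend hL f) (g := fun t => A * t ^ n / n.factorial) x.2.1
    (Eventually.of_forall fun t ht => by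
      have htm : t ∈ Icc 0 L := ⟨ht.1.le, ht.2.trans x.2.2⟩
      rw [IccExtend_of_mem hL _ htm]
      exact hf ⟨t, htm⟩) (Continuous.intervalIntegrable (by fun_prop) _ _)
  rw [primLin_apply, ← Real.norm_eq_abs]
  refine h.trans (le_of_eq ?_)
  rw [intervalIntegral.integral_div, intervalIntegral.integral_const_mul, integral_pow,
    Nat.factorial_succ]
  push_cast
  have : ((n : ℝ) + 1) ≠ 0 := by positivity
  field_simp
  simp

/-- The primitive vanishing at `0`, as a bounded operator on `C([0, L])`. -/
noncomputable def prim : C(Icc (0 : ℝ) L, ℝ) →L[ℝ] C(Icc (0 : ℝ) L, ℝ) :=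
  (primLin hL).mkContinuous L fun f => by
    rw [ContinuousMap.norm_le _ (by positivity)]
    intro x
    have := abs_primLin_le hL f (A := ‖f‖) (n := 0)
      (fun x => by simpa using f.norm_coe_le_norm x) x
    rw [Real.norm_eq_abs]
    refine this.trans ?_
    have hx := x.2.2
    simp only [zero_add, pow_one, Nat.factorial_one, Nat.cast_one, div_one]
    nlinarith [norm_nonneg f]

theorem prim_apply (f : C(Icc (0 : ℝ) L, ℝ)) (x : Icc (0 : ℝ) L) :
    prim hL f x = ∫ t in (0 : ℝ)..x, IccExtend hL f t := rfl

/-- The operator `z ↦ ∫ (α z + β ∫ z)`. -/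
noncomputable def volterra (α β : C(Icc (0 : ℝ) L, ℝ)) :
    C(Icc (0 : ℝ) L, ℝ) →L[ℝ] C(Icc (0 : ℝ) L, ℝ) :=
  prim hL ∘L (ContinuousLinearMap.mul ℝ _ α + ContinuousLinearMap.mul ℝ _ β ∘L prim hL)

theorem volterra_apply (α β z : C(Icc (0 : ℝ) L, ℝ)) :
    volterra hL α β z = prim hL (α * z + β * prim hL z) := by
  simp [volterra]

theorem abs_volterra_pow_le (α β f : C(Icc (0 : ℝ) L, ℝ)) (n : ℕ) (x : Icc (0 : ℝ) L) :
    |(volterra hL α β ^ n) f x| ≤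
      (‖α‖ + L * ‖β‖) ^ n * ‖f‖ * (x : ℝ) ^ n / n.factorial := by
  induction n generalizing x with
  | zero => simpa using f.norm_coe_le_norm x
  | succ n ih =>
    rw [pow_succ', mul_apply_eq_comp, volterra_apply]
    refine (abs_primLin_le hL _ (A := (‖α‖ + L * ‖β‖) ^ (n + 1) * ‖f‖) (n := n) ?_ x)
    intro x
    set g := (volterra hL α β ^ n) f
    set A := (‖α‖ + L * ‖β‖) ^ n * ‖f‖
    have hA : 0 ≤ A * (x : ℝ) ^ n / n.factorial := (abs_nonneg _).trans (ih x)
    have h1 : |prim hL g x| ≤ L * (A * (x : ℝ) ^ n / n.factorial) := by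
      refine (abs_primLin_le hL g ih x).trans ?_
      rw [Nat.factorial_succ, pow_succ]
      push_cast
      have hx := x.2
      have hn : (1 : ℝ) ≤ n + 1 := by have : (0 : ℝ) ≤ n := n.cast_nonneg; linarith
      calc A * ((x : ℝ) ^ n * x) / ((n + 1) * n.factorial)
          = (x / (n + 1)) * (A * (x : ℝ) ^ n / n.factorial) := by field_simp
        _ ≤ L * (A * (x : ℝ) ^ n / n.factorial) := by
          refine mul_le_mul_of_nonneg_right ?_ hA
          rw [div_le_iff₀ (by linarith)]
          nlinarith [hx.1, hx.2]
    have hα : |α x| ≤ ‖α‖ := α.norm_coe_le_norm x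
    have hβ : |β x| ≤ ‖β‖ := β.norm_coe_le_norm x
    calc |(α * g + β * prim hL g) x| ≤ |α x| * |g x| + |β x| * |prim hL g x| := by
          rw [← abs_mul, ← abs_mul]; exact abs_add_le _ _
      _ ≤ ‖α‖ * (A * (x : ℝ) ^ n / n.factorial) +
          ‖β‖ * (L * (A * (x : ℝ) ^ n / n.factorial)) := by
        gcongr
        exact ih x
      _ = _ := by simp only [A]; rw [pow_succ]; ring

/-- The operator `T` itself need not be small, but `‖T ^ n‖ ≤ (C L) ^ n / n!` falls below `1` for
some `n`. Then `1 - T ^ n` is invertible, and it factors into `1 - T` and a commuting geometric sum.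
-/
theorem isUnit_one_sub_volterra (α β : C(Icc (0 : ℝ) L, ℝ)) :
    IsUnit (1 - volterra hL α β) := by
  set T := volterra hL α β
  set C := ‖α‖ + L * ‖β‖
  have hC : 0 ≤ C := by positivity
  obtain ⟨n, hn⟩ := ((FloorSemiring.tendsto_pow_div_factorial_atTop (C * L)).eventually_lt_const
    one_pos).exists
  have h1 : ‖T ^ n‖ < 1 := by
    refine lt_of_le_of_lt (ContinuousLinearMap.opNorm_le_bound _ (by positivity) fun f => ?_) hn
    rw [ContinuousMap.norm_le _ (by positivity)]
    intro x
    refine (abs_volterra_pow_le hL α β f n x).trans ?_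
    have hx := x.2
    have : (x : ℝ) ^ n ≤ L ^ n := pow_le_pow_left₀ hx.1 hx.2 n
    calc C ^ n * ‖f‖ * (x : ℝ) ^ n / n.factorial ≤ C ^ n * ‖f‖ * L ^ n / n.factorial := by gcongr
      _ = _ := by rw [mul_pow]; ring
  have h2 : IsUnit (1 - T ^ n) := isUnit_one_sub_of_norm_lt_one
    (R := C(Icc (0 : ℝ) L, ℝ) →L[ℝ] C(Icc (0 : ℝ) L, ℝ)) h1
  have hcomm : Commute (1 - T) (∑ i ∈ Finset.range n, T ^ i) := by
    rw [Commute, SemiconjBy, mul_neg_geom_sum, geom_sum_mul_neg]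
  rw [← mul_neg_geom_sum, hcomm.isUnit_mul_iff] at h2
  exact h2.1

/-- Derivative of the solution of `y' = z`, `z' = α z + β y`, `y(0) = c₀`, `z(0) = c₁`. -/
noncomputable def linSolDeriv (c₀ c₁ : ℝ) (α β : C(Icc (0 : ℝ) L, ℝ)) : C(Icc (0 : ℝ) L, ℝ) :=
  Ring.inverse (1 - volterra hL α β) (c₁ • (1 : C(Icc (0 : ℝ) L, ℝ)) + c₀ • prim hL β)

/-- The solution of `y' = z`, `z' = α z + β y`, `y(0) = c₀`, `z(0) = c₁`. -/
noncomputable def linSol (c₀ c₁ : ℝ) (α β : C(Icc (0 : ℝ) L, ℝ)) : C(Icc (0 : ℝ) L, ℝ) :=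
  c₀ • (1 : C(Icc (0 : ℝ) L, ℝ)) + prim hL (linSolDeriv hL c₀ c₁ α β)

theorem linSolDeriv_eq (c₀ c₁ : ℝ) (α β : C(Icc (0 : ℝ) L, ℝ)) :
    linSolDeriv hL c₀ c₁ α β = c₁ • (1 : C(Icc (0 : ℝ) L, ℝ)) +
      prim hL (α * linSolDeriv hL c₀ c₁ α β + β * linSol hL c₀ c₁ α β) := by
  have h : (1 - volterra hL α β) (linSolDeriv hL c₀ c₁ α β) =
      c₁ • (1 : C(Icc (0 : ℝ) L, ℝ)) + c₀ • prim hL β := by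
    rw [linSolDeriv, ← mul_apply_eq_comp,
      Ring.mul_inverse_cancel _ (isUnit_one_sub_volterra hL α β), one_apply_eq_self]
  rw [sub_apply, one_apply_eq_self, volterra_apply,
    sub_eq_iff_eq_add] at h
  conv_lhs => rw [h]
  rw [linSol, mul_add, mul_smul_comm, mul_one, map_add, map_add, map_add, map_smul]
  abel

/-- Substituting `y` turns the integrated system into `(1 - T) z = c₁ + c₀ ∫ β`, which has one
solution. This identifies a given eigenfunction with a member of the constructed family. -/
theorem linSolDeriv_unique {c₀ c₁ : ℝ} {α β y z : C(Icc (0 : ℝ) L, ℝ)}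
    (hy : y = c₀ • (1 : C(Icc (0 : ℝ) L, ℝ)) + prim hL z)
    (hz : z = c₁ • (1 : C(Icc (0 : ℝ) L, ℝ)) + prim hL (α * z + β * y)) :
    linSolDeriv hL c₀ c₁ α β = z ∧ linSol hL c₀ c₁ α β = y := by
  have h : (1 - volterra hL α β) z = c₁ • (1 : C(Icc (0 : ℝ) L, ℝ)) + c₀ • prim hL β := by
    rw [sub_apply, one_apply_eq_self, volterra_apply,
      sub_eq_iff_eq_add]
    conv_lhs => rw [hz, hy]
    rw [mul_add, mul_smul_comm, mul_one, map_add, map_add, map_add, map_smul]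
    abel
  have h1 : linSolDeriv hL c₀ c₁ α β = z := by
    rw [linSolDeriv, ← h, ← mul_apply_eq_comp,
      Ring.inverse_mul_cancel _ (isUnit_one_sub_volterra hL α β), one_apply_eq_self]
  exact ⟨h1, by rw [linSol, h1, ← hy]⟩

theorem hasDerivWithinAt_of_eq_prim {c : ℝ} {f g : C(Icc (0 : ℝ) L, ℝ)}
    (h : f = c • (1 : C(Icc (0 : ℝ) L, ℝ)) + prim hL g) {x : ℝ} (hx : x ∈ Icc 0 L) :
    HasDerivWithinAt (IccExtend hL f) (IccExtend hL g x) (Icc 0 L) x := by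
  have hg : Continuous (IccExtend hL g) := g.continuous.Icc_extend'
  have h1 : HasDerivAt (fun x => c + ∫ t in (0 : ℝ)..x, IccExtend hL g t) (IccExtend hL g x) x :=
    (intervalIntegral.integral_hasDerivAt_right (hg.intervalIntegrable _ _)
      (hg.stronglyMeasurableAtFilter _ _) hg.continuousAt).const_add c
  have h2 : ∀ x ∈ Icc 0 L, IccExtend hL f x = c + ∫ t in (0 : ℝ)..x, IccExtend hL g t :=
    fun x hx => by
      rw [IccExtend_of_mem hL _ hx, h]
      simp [prim_apply]
  exact h1.hasDerivWithinAt.congr h2 (h2 x hx)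

/-- The coefficients enter the operator and the right-hand side through continuous affine maps, and
inversion is analytic at units of the Banach algebra of operators. -/
theorem analyticAt_linSolDeriv (c₀ c₁ : ℝ) {X : Type*} [NormedAddCommGroup X] [NormedSpace ℝ X]
    {α β : X → C(Icc (0 : ℝ) L, ℝ)} {x₀ : X} (hα : AnalyticAt ℝ α x₀) (hβ : AnalyticAt ℝ β x₀) :
    AnalyticAt ℝ (fun x => linSolDeriv hL c₀ c₁ (α x) (β x)) x₀ := by
  have h1 : AnalyticAt ℝ (fun x => 1 - volterra hL (α x) (β x)) x₀ := by
    have hm := fun f => ContinuousLinearMap.analyticAt (𝕜 := ℝ) (E := C(Icc (0 : ℝ) L, ℝ))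
      (F := C(Icc (0 : ℝ) L, ℝ) →L[ℝ] C(Icc (0 : ℝ) L, ℝ)) (ContinuousLinearMap.mul ℝ _) f
    exact analyticAt_one_sub_comp (prim hL) ((hm _).comp hα) ((hm _).comp hβ)
  have h2 : AnalyticAt ℝ Ring.inverse (1 - volterra hL (α x₀) (β x₀)) :=
    analyticAt_inverse (𝕜 := ℝ) (A := C(Icc (0 : ℝ) L, ℝ) →L[ℝ] C(Icc (0 : ℝ) L, ℝ))
      (isUnit_one_sub_volterra hL (α x₀) (β x₀)).unit
  have h3 : AnalyticAt ℝ (fun x => c₁ • (1 : C(Icc (0 : ℝ) L, ℝ)) + c₀ • prim hL (β x)) x₀ :=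
    analyticAt_const.add ((c₀ • prim hL).analyticAt _ |>.comp hβ)
  exact analyticAt_apply (h2.comp_of_eq h1 rfl) h3

theorem analyticAt_linSol (c₀ c₁ : ℝ) {X : Type*} [NormedAddCommGroup X] [NormedSpace ℝ X]
    {α β : X → C(Icc (0 : ℝ) L, ℝ)} {x₀ : X} (hα : AnalyticAt ℝ α x₀) (hβ : AnalyticAt ℝ β x₀) :
    AnalyticAt ℝ (fun x => linSol hL c₀ c₁ (α x) (β x)) x₀ :=
  analyticAt_const.add (((prim hL).analyticAt _).comp (analyticAt_linSolDeriv hL c₀ c₁ hα hβ))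

end Volterra


/-! ### Lagrange's identity and the analytic family of equations. -/

section Perturbation

variable {L : ℝ}

/-- This kills the boundary terms in Lagrange's identity. The denominator `q` is arbitrary because
one of the two factors in each product is already zero. -/
theorem BdryCond.wronskian_eq_zero {j : Fin 2} {y y₁ v v₁ : ℝ → ℝ} {x q : ℝ}
    (h : BdryCond j y y₁ x) (h' : BdryCond j v v₁ x) : y x * (v₁ x / q) - y₁ x * v x = 0 := by
  fin_cases j
  · have h1 : y₁ x = 0 := by simpa [BdryCond] using h
    have h2 : v₁ x = 0 := by simpa [BdryCond] using h'
    simp [h1, h2]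
  · have h1 : y x = 0 := by simpa [BdryCond] using h
    have h2 : v x = 0 := by simpa [BdryCond] using h'
    simp [h1, h2]

/-- Lagrange's identity. -/
theorem IsSLSolution.integral_lagrange {y y₁ v v₁ r₀ r p : ℝ → ℝ} (hL : 0 ≤ L)
    (h₀ : IsSLSolution L (fun _ => 1) r₀ y y₁) (h : IsSLSolution L p r v v₁)
    (hp : ∀ x, 0 < p x) (hpc : Continuous p) (hr₀ : Continuous r₀) (hr : Continuous r) :
    ∫ x in (0 : ℝ)..L, (y₁ x * v₁ x * ((p x)⁻¹ - 1) + (r₀ x - p x * r x) * y x * v x) =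
      (y L * (v₁ L / p L) - y₁ L * v L) - (y 0 * (v₁ 0 / p 0) - y₁ 0 * v 0) := by
  have hy : ContinuousOn y (Icc 0 L) := fun x hx => (h₀.hasDeriv x hx).continuousWithinAt
  have hv : ContinuousOn v (Icc 0 L) := fun x hx => (h.hasDeriv x hx).continuousWithinAt
  have hy₁' : ∀ x ∈ Icc 0 L, HasDerivWithinAt y₁ (-(r₀ x * y x)) (Icc 0 L) x := fun x hx => by
    simpa using h₀.hasDeriv_div x hx
  have hy₁ : ContinuousOn y₁ (Icc 0 L) := fun x hx => (hy₁' x hx).continuousWithinAt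
  have hu : ContinuousOn (fun x => v₁ x / p x) (Icc 0 L) :=
    fun x hx => (h.hasDeriv_div x hx).continuousWithinAt
  have hv₁ : ContinuousOn v₁ (Icc 0 L) := by
    refine (hpc.continuousOn.mul hu).congr fun x _ => ?_
    rw [Pi.mul_apply, mul_div_cancel₀ _ (hp x).ne']
  have hpi : Continuous fun x => (p x)⁻¹ := hpc.inv₀ fun x => (hp x).ne'
  refine intervalIntegral.integral_eq_sub_of_hasDerivAt_of_le hL
    (f := fun x => y x * (v₁ x / p x) - y₁ x * v x) (by fun_prop) (fun x hx => ?_)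
    (ContinuousOn.intervalIntegrable_of_Icc hL
      (((hy₁.mul hv₁).mul (hpi.continuousOn.sub continuousOn_const)).add (by fun_prop)))
  have hxm := Ioo_subset_Icc_self hx
  have hn := Icc_mem_nhds hx.1 hx.2
  have d1 := (h₀.hasDeriv x hxm).hasDerivAt hn
  have d2 := (h.hasDeriv_div x hxm).hasDerivAt hn
  have d3 := (hy₁' x hxm).hasDerivAt hn
  have d4 := (h.hasDeriv x hxm).hasDerivAt hn
  refine ((d1.mul d2).sub (d3.mul d4)).congr_deriv ?_
  have := (hp x).ne'
  field_simp
  ring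

/-- If `(f x - f a) A x = (x - a) B x` near `a`, then `f' a * A a = B a`. -/
theorem deriv_mul_eq_of_sub_mul_eq {f A B : ℝ → ℝ} {a d : ℝ} (hf : HasDerivAt f d a)
    (hA : ContinuousAt A a) (hB : ContinuousAt B a)
    (h : ∀ᶠ x in 𝓝 a, (f x - f a) * A x = (x - a) * B x) : d * A a = B a := by
  have h1 := (hasDerivAt_iff_tendsto_slope.1 hf).mul (hA.tendsto.mono_left nhdsWithin_le_nhds)
  have h2 : Tendsto B (𝓝[≠] a) (𝓝 (B a)) := hB.tendsto.mono_left nhdsWithin_le_nhds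
  refine tendsto_nhds_unique (h1.congr' ?_) h2
  filter_upwards [h.filter_mono nhdsWithin_le_nhds, self_mem_nhdsWithin] with x hx hxa
  have : x - a ≠ 0 := sub_ne_zero.2 hxa
  rw [slope_def_field, div_mul_eq_mul_div, hx, mul_div_cancel_left₀ _ this]

theorem ringInverse_apply {f : C(Icc (0 : ℝ) L, ℝ)} (hf : ∀ x, f x ≠ 0) (x : Icc (0 : ℝ) L) :
    Ring.inverse f x = (f x)⁻¹ := by
  have h := Ring.mul_inverse_cancel f ((ContinuousMap.isUnit_iff_forall_ne_zero f).2 hf)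
  have := DFunLike.congr_fun h x
  rw [ContinuousMap.mul_apply, ContinuousMap.one_apply] at this
  exact eq_inv_of_mul_eq_one_right this

variable (hL : 0 ≤ L)

/-- Integration over `[0, L]` as a functional. -/
noncomputable def intL : C(Icc (0 : ℝ) L, ℝ) →L[ℝ] ℝ :=
  ContinuousMap.evalCLM ℝ (⟨L, hL, le_rfl⟩ : Icc (0 : ℝ) L) ∘L prim hL

theorem intL_eq {F : C(Icc (0 : ℝ) L, ℝ)} {f : ℝ → ℝ}
    (h : ∀ x (hx : x ∈ Icc 0 L), F ⟨x, hx⟩ = f x) : intL hL F = ∫ x in (0 : ℝ)..L, f x := by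
  change ∫ x in (0 : ℝ)..L, _ = _
  refine intervalIntegral.integral_congr fun x hx => ?_
  rw [uIcc_of_le hL] at hx
  rw [IccExtend_of_mem hL _ hx, h]

/-- First order coefficient of `y'' = α y' + β y`, the expanded form of
`(y' / p)' + p (μ - l ρ) y = 0` with `p² = 1 + ε g`; the parameters are `((l, ε), μ)`. -/
noncomputable def famα (G G₁ : C(Icc (0 : ℝ) L, ℝ)) (q : (ℝ × ℝ) × ℝ) : C(Icc (0 : ℝ) L, ℝ) :=
  (q.1.2 / 2) • (G₁ * Ring.inverse (1 + q.1.2 • G))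

/-- Zeroth order coefficient of `y'' = α y' + β y`. -/
noncomputable def famβ (G R : C(Icc (0 : ℝ) L, ℝ)) (q : (ℝ × ℝ) × ℝ) : C(Icc (0 : ℝ) L, ℝ) :=
  -((1 + q.1.2 • G) * (q.2 • (1 : C(Icc (0 : ℝ) L, ℝ)) - q.1.1 • R))

theorem analyticAt_famα (G G₁ : C(Icc (0 : ℝ) L, ℝ)) (l μ : ℝ) :
    AnalyticAt ℝ (famα G G₁) ((l, 0), μ) := by
  have h1 : AnalyticAt ℝ (fun q : (ℝ × ℝ) × ℝ => q.1.2) ((l, 0), μ) :=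
    (ContinuousLinearMap.snd ℝ ℝ ℝ ∘L ContinuousLinearMap.fst ℝ (ℝ × ℝ) ℝ).analyticAt _
  have h2 : AnalyticAt ℝ (fun q : (ℝ × ℝ) × ℝ => 1 + q.1.2 • G) ((l, 0), μ) :=
    analyticAt_const.add (h1.smul analyticAt_const)
  have h3 : AnalyticAt ℝ (Ring.inverse : C(Icc (0 : ℝ) L, ℝ) → _) (1 + (0 : ℝ) • G) := by
    simpa using analyticAt_inverse (𝕜 := ℝ) (1 : C(Icc (0 : ℝ) L, ℝ)ˣ)
  exact (h1.div_const).smul (analyticAt_const.mul (h3.comp_of_eq h2 rfl))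

theorem analyticAt_famβ (G R : C(Icc (0 : ℝ) L, ℝ)) (q : (ℝ × ℝ) × ℝ) :
    AnalyticAt ℝ (famβ G R) q := by
  have h1 : AnalyticAt ℝ (fun q : (ℝ × ℝ) × ℝ => q.1.2) q :=
    (ContinuousLinearMap.snd ℝ ℝ ℝ ∘L ContinuousLinearMap.fst ℝ (ℝ × ℝ) ℝ).analyticAt _
  have h2 : AnalyticAt ℝ (fun q : (ℝ × ℝ) × ℝ => q.1.1) q :=
    (ContinuousLinearMap.fst ℝ ℝ ℝ ∘L ContinuousLinearMap.fst ℝ (ℝ × ℝ) ℝ).analyticAt _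
  have h3 : AnalyticAt ℝ (fun q : (ℝ × ℝ) × ℝ => q.2) q :=
    (ContinuousLinearMap.snd ℝ (ℝ × ℝ) ℝ).analyticAt _
  exact ((analyticAt_const.add (h1.smul analyticAt_const)).mul
    ((h3.smul analyticAt_const).sub (h2.smul analyticAt_const))).neg

/-- Restriction of a continuous function to `[0, L]`. -/
def restr (L : ℝ) (f : ℝ → ℝ) (hf : Continuous f) : C(Icc (0 : ℝ) L, ℝ) :=
  ⟨fun x => f x, hf.comp continuous_subtype_val⟩

theorem one_add_mul_pos {ε g : ℝ} (hε : |ε| < 1) (hg : |g| ≤ 1) : 0 < 1 + ε * g := by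
  have : |ε * g| < 1 := by
    rw [abs_mul]; nlinarith [abs_nonneg ε, abs_nonneg g]
  linarith [(abs_lt.1 this).1]

variable {g g₁ ρ : ℝ → ℝ}

/-- Expanding `(y' / p)'` with `p² = 1 + ε g` gives `y'' = (p' / p) y' - p² r y`, and `p' / p = ε g'
/ (2 p²)` contains no square root. The bound on `g` keeps `p` positive for `|ε| < 1`. -/
theorem isSLSolution_fam (hg : ∀ x, HasDerivAt g (g₁ x) x) (hgc : Continuous g)
    (hg₁ : Continuous g₁) (hgb : ∀ x, |g x| ≤ 1) (hρ : Continuous ρ) (c₀ c₁ l ε μ : ℝ)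
    (hε : |ε| < 1) :
    IsSLSolution L (fun x => √(1 + ε * g x)) (fun x => μ - l * ρ x)
      (IccExtend hL (linSol hL c₀ c₁ (famα (restr L g hgc) (restr L g₁ hg₁) ((l, ε), μ))
        (famβ (restr L g hgc) (restr L ρ hρ) ((l, ε), μ))))
      (IccExtend hL (linSolDeriv hL c₀ c₁ (famα (restr L g hgc) (restr L g₁ hg₁) ((l, ε), μ))
        (famβ (restr L g hgc) (restr L ρ hρ) ((l, ε), μ)))) := by
  set α := famα (restr L g hgc) (restr L g₁ hg₁) ((l, ε), μ) with hα
  set β := famβ (restr L g hgc) (restr L ρ hρ) ((l, ε), μ) with hβ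
  set Y := linSol hL c₀ c₁ α β with hY
  set Z := linSolDeriv hL c₀ c₁ α β with hZ
  refine ⟨fun x hx => hasDerivWithinAt_of_eq_prim hL hY hx, fun x hx => ?_⟩
  have hW := one_add_mul_pos hε (hgb x)
  have hp : 0 < √(1 + ε * g x) := Real.sqrt_pos.2 hW
  have hαx : α ⟨x, hx⟩ = ε * g₁ x / (2 * (1 + ε * g x)) := by
    rw [hα, famα, ContinuousMap.smul_apply, ContinuousMap.mul_apply, ringInverse_apply]
    · simp [restr]; field_simp
    · intro x
      simpa [restr] using (one_add_mul_pos hε (hgb x)).ne'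
  have hβx : β ⟨x, hx⟩ = -((1 + ε * g x) * (μ - l * ρ x)) := by
    simp [hβ, famβ, restr]
  have d1 := hasDerivWithinAt_of_eq_prim hL (linSolDeriv_eq hL c₀ c₁ α β) hx
  have d2 := ((((hg x).const_mul ε).const_add 1).sqrt hW.ne').hasDerivWithinAt (s := Icc 0 L)
  refine (d1.div d2 hp.ne').congr_deriv ?_
  rw [IccExtend_of_mem hL _ hx, IccExtend_of_mem hL _ hx, IccExtend_of_mem hL _ hx,
    ContinuousMap.add_apply, ContinuousMap.mul_apply, ContinuousMap.mul_apply, hαx, hβx]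
  rw [← hY, ← hZ]
  have hsq : √(1 + ε * g x) ^ 2 = 1 + ε * g x := Real.sq_sqrt hW.le
  generalize √(1 + ε * g x) = P at *
  rw [← hsq]
  field_simp
  ring

end Perturbation


/-! ### The analytic eigenvalue branch and its first derivatives. -/

section EigenvaluePerturbation

variable {L : ℝ} {g g₁ ρ : ℝ → ℝ}

theorem linSol_zero (hL : 0 ≤ L) (c₀ c₁ : ℝ) (α β : C(Icc (0 : ℝ) L, ℝ)) :
    IccExtend hL (linSol hL c₀ c₁ α β) 0 = c₀ := by
  rw [IccExtend_of_mem hL _ ⟨le_rfl, hL⟩, linSol]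
  simp [prim_apply]

theorem linSolDeriv_zero (hL : 0 ≤ L) (c₀ c₁ : ℝ) (α β : C(Icc (0 : ℝ) L, ℝ)) :
    IccExtend hL (linSolDeriv hL c₀ c₁ α β) 0 = c₁ := by
  rw [IccExtend_of_mem hL _ ⟨le_rfl, hL⟩, linSolDeriv_eq]
  simp [prim_apply]

theorem eq_add_prim (hL : 0 ≤ L) {f f' : ℝ → ℝ} {F F' : C(Icc (0 : ℝ) L, ℝ)}
    (hf : ∀ x ∈ Icc 0 L, HasDerivWithinAt f (f' x) (Icc 0 L) x)
    (hF : ∀ x (hx : x ∈ Icc 0 L), F ⟨x, hx⟩ = f x)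
    (hF' : ∀ x (hx : x ∈ Icc 0 L), F' ⟨x, hx⟩ = f' x) :
    F = f 0 • (1 : C(Icc (0 : ℝ) L, ℝ)) + prim hL F' := by
  ext ⟨x, hx⟩
  have hc : Continuous (IccExtend hL F') := F'.continuous.Icc_extend'
  have h := intervalIntegral.integral_eq_sub_of_hasDerivAt_of_le hx.1 (f := f)
    (f' := IccExtend hL F')
    (fun t ht => (hf t ⟨ht.1, ht.2.trans hx.2⟩).continuousWithinAt.mono
      (Icc_subset_Icc_right hx.2))
    (fun t ht => by
      have htm : t ∈ Icc 0 L := ⟨ht.1.le, ht.2.le.trans hx.2⟩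
      rw [IccExtend_of_mem hL _ htm, hF']
      exact (hf t htm).hasDerivAt (Icc_mem_nhds ht.1 (ht.2.trans_le hx.2)))
    (hc.intervalIntegrable _ _)
  simp only [hF, ContinuousMap.add_apply, ContinuousMap.smul_apply, ContinuousMap.one_apply,
    prim_apply, h, smul_eq_mul]
  ring

/-- Value of the Prüfer angle forced by the boundary condition, given its approximate value. -/
theorem IsPrufer.eq_of_abs_sub_lt {p r y y₁ θ : ℝ → ℝ} (h : IsPrufer L p r y y₁ θ) (hL : 0 ≤ L)
    {j₁ : Fin 2} (hbc : BdryCond j₁ y y₁ L) {n : ℕ}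
    (habs : |θ L - (-(n * Real.pi) - Real.pi / 2 * (j₁ : ℕ))| < Real.pi) :
    θ L = -(n * Real.pi) - Real.pi / 2 * (j₁ : ℕ) := by
  rw [abs_lt] at habs
  rw [← sub_eq_zero, ← Real.sin_eq_zero_iff_of_lt_of_lt habs.1 habs.2]
  have hLm : L ∈ Icc 0 L := ⟨hL, le_rfl⟩
  have key : ∀ t : ℝ, Real.sin (t - (-(n * Real.pi) - Real.pi / 2 * (j₁ : ℕ))) =
      (-1) ^ n * Real.sin (t + Real.pi / 2 * (j₁ : ℕ)) := fun t => by
    rw [← Real.sin_add_nat_mul_pi]; congr 1; ring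
  rw [key]
  fin_cases j₁
  · have h1 : Real.sin (θ L) = 0 := (h.sin_eq_zero_iff L hLm).2 (by simpa [BdryCond] using hbc)
    simp [h1]
  · have h1 : Real.cos (θ L) = 0 := (h.cos_eq_zero_iff L hLm).2 (by simpa [BdryCond] using hbc)
    simp [Real.sin_add_pi_div_two, h1]

/-- Shooting from the left end with the initial data of `y` gives an analytic family of solutions.
The eigenvalue is the zero of the right-end residual, and Lagrange's identity against `y` provides
both the simplicity of that zero and the derivatives of the branch. -/
theorem exists_analytic_eigenvalue (hL : 0 < L) (hg : ∀ x, HasDerivAt g (g₁ x) x)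
    (hg₁ : Continuous g₁) (hgb : ∀ x, |g x| ≤ 1) (hρ : Continuous ρ) {j₀ j₁ : Fin 2} {n : ℕ}
    {l₀ μ₀ : ℝ} {y y₁ : ℝ → ℝ}
    (hs : IsSLSolution L (fun _ => 1) (fun x => μ₀ - l₀ * ρ x) y y₁)
    (hne : ∃ x ∈ Icc 0 L, y x ≠ 0) (hb₀ : BdryCond j₀ y y₁ 0) (hbL : BdryCond j₁ y y₁ L)
    (hn : {x ∈ Ioo 0 L | y x = 0}.encard = n) :
    ∃ M : ℝ × ℝ → ℝ, AnalyticAt ℝ M (l₀, 0) ∧ M (l₀, 0) = μ₀ ∧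
      (∀ᶠ x in 𝓝 (l₀, (0 : ℝ)), HasSLEigenfunction L (fun t => √(1 + x.2 * g t))
        (fun t => M x - x.1 * ρ t) j₀ j₁ n) ∧
      0 < ∫ x in (0 : ℝ)..L, y x ^ 2 ∧
      deriv (fun l => M (l, 0)) l₀ * (∫ x in (0 : ℝ)..L, y x ^ 2) =
        ∫ x in (0 : ℝ)..L, ρ x * y x ^ 2 ∧
      deriv (fun ε => M (l₀, ε)) 0 * (∫ x in (0 : ℝ)..L, y x ^ 2) =
        -(1 / 2) * ∫ x in (0 : ℝ)..L, g x * (y₁ x ^ 2 + (μ₀ - l₀ * ρ x) * y x ^ 2) := by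
  have hL' := hL.le
  have hgc : Continuous g := continuous_iff_continuousAt.2 fun x => (hg x).continuousAt
  have h0m : (0 : ℝ) ∈ Icc 0 L := ⟨le_rfl, hL'⟩
  have hLm : L ∈ Icc 0 L := ⟨hL', le_rfl⟩
  have hr : ∀ μ l : ℝ, Continuous fun x => μ - l * ρ x := fun μ l => by fun_prop
  have hp1 : ∀ x : ℝ, (0 : ℝ) < (fun _ => 1) x := fun _ => one_pos
  obtain ⟨a, ha, hya⟩ := hne
  set c₀ := y 0 with hc₀
  set c₁ := y₁ 0 with hc₁
  have hy : ContinuousOn y (Icc 0 L) := fun x hx => (hs.hasDeriv x hx).continuousWithinAt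
  have hy₁' : ∀ x ∈ Icc 0 L, HasDerivWithinAt y₁ (-((μ₀ - l₀ * ρ x) * y x)) (Icc 0 L) x :=
    fun x hx => by simpa using hs.hasDeriv_div x hx
  have hy₁ : ContinuousOn y₁ (Icc 0 L) := fun x hx => (hy₁' x hx).continuousWithinAt
  have hpos0 : ∀ x ∈ Icc 0 L, 0 < y x ^ 2 + y₁ x ^ 2 := fun x hx => by
    simpa using hs.sq_add_sq_pos hp1 continuous_const (hr _ _) ha (Or.inl hya) hx
  have hc : c₀ ≠ 0 ∨ c₁ ≠ 0 := by
    by_contra hcon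
    push Not at hcon
    have := hpos0 0 h0m
    rw [← hc₀, ← hc₁, hcon.1, hcon.2] at this
    simp at this
  -- the analytic family of solutions
  set G := restr L g hgc with hG
  set G₁ := restr L g₁ hg₁ with hG₁
  set R := restr L ρ hρ with hR
  set Y : (ℝ × ℝ) × ℝ → C(Icc (0 : ℝ) L, ℝ) :=
    fun q => linSol hL' c₀ c₁ (famα G G₁ q) (famβ G R q) with hY
  set Z : (ℝ × ℝ) × ℝ → C(Icc (0 : ℝ) L, ℝ) :=
    fun q => linSolDeriv hL' c₀ c₁ (famα G G₁ q) (famβ G R q) with hZ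
  set q₀ : (ℝ × ℝ) × ℝ := ((l₀, 0), μ₀) with hq₀
  have hYa : AnalyticAt ℝ Y q₀ :=
    analyticAt_linSol hL' c₀ c₁ (analyticAt_famα G G₁ l₀ μ₀) (analyticAt_famβ G R q₀)
  have hZa : AnalyticAt ℝ Z q₀ :=
    analyticAt_linSolDeriv hL' c₀ c₁ (analyticAt_famα G G₁ l₀ μ₀) (analyticAt_famβ G R q₀)
  set Y₀ : C(Icc (0 : ℝ) L, ℝ) :=
    ⟨(Icc 0 L).domRestrict y, continuousOn_iff_continuous_domRestrict.1 hy⟩ with hY₀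
  set Z₀ : C(Icc (0 : ℝ) L, ℝ) :=
    ⟨(Icc 0 L).domRestrict y₁, continuousOn_iff_continuous_domRestrict.1 hy₁⟩ with hZ₀
  -- At `q₀` the first order coefficient vanishes and the zeroth order one is `-(μ₀ - l₀ ρ)`, so by
  -- uniqueness the family passes through the given eigenfunction.
  have hbase : Z q₀ = Z₀ ∧ Y q₀ = Y₀ := by
    refine linSolDeriv_unique hL' (eq_add_prim hL' hs.hasDeriv (fun x hx => rfl) fun x hx => rfl)
      (eq_add_prim hL' hy₁' (fun x hx => rfl) fun x hx => ?_)
    simp [famα, famβ, hq₀, hR, restr, hY₀]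
    ring
  have hsol : ∀ q : (ℝ × ℝ) × ℝ, |q.1.2| < 1 →
      IsSLSolution L (fun x => √(1 + q.1.2 * g x)) (fun x => q.2 - q.1.1 * ρ x)
        (IccExtend hL' (Y q)) (IccExtend hL' (Z q)) := fun q hq =>
    isSLSolution_fam hL' hg hgc hg₁ hgb hρ c₀ c₁ q.1.1 q.1.2 q.2 hq
  have hpq : ∀ ε : ℝ, |ε| < 1 → ∀ x, 0 < √(1 + ε * g x) := fun ε hε x =>
    Real.sqrt_pos.2 (one_add_mul_pos hε (hgb x))
  have hpc : ∀ ε : ℝ, Continuous fun x => √(1 + ε * g x) := fun ε => by fun_prop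
  -- The initial data are frozen, so the left boundary condition holds for every parameter value.
  have hb₀q : ∀ q, BdryCond j₀ (IccExtend hL' (Y q)) (IccExtend hL' (Z q)) 0 := fun q => by
    unfold BdryCond
    rw [linSol_zero hL', linSolDeriv_zero hL']
    exact hb₀
  -- the leading coefficient as an element of `C([0, L])`
  set P : (ℝ × ℝ) × ℝ → C(Icc (0 : ℝ) L, ℝ) :=
    fun q => (⟨Real.sqrt, Real.continuous_sqrt⟩ : C(ℝ, ℝ)).comp (1 + q.1.2 • G) with hP
  have hPx : ∀ q x, P q x = √(1 + q.1.2 * g x) := fun q x => by simp [hP, hG, restr]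
  have hPpos : ∀ q : (ℝ × ℝ) × ℝ, |q.1.2| < 1 → ∀ x, 0 < P q x := fun q hq x => by
    rw [hPx]; exact hpq _ hq x
  have hPc : Continuous P := (ContinuousMap.continuous_postcomp _).comp (by fun_prop)
  have hP₀ : ∀ l μ : ℝ, P ((l, 0), μ) = 1 := fun l μ => by ext x; simp [hPx]
  have hinv : ∀ {F : (ℝ × ℝ) × ℝ → C(Icc (0 : ℝ) L, ℝ)}, ContinuousAt F q₀ →
      (∀ x, F q₀ x ≠ 0) → ContinuousAt (fun q => Ring.inverse (F q)) q₀ := fun {F} hF hne => by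
    have hu := (ContinuousMap.isUnit_iff_forall_ne_zero (F q₀)).2 hne
    have h1 : ContinuousAt Ring.inverse (F q₀) := NormedRing.inverse_continuousAt hu.unit
    exact ContinuousAt.comp (g := Ring.inverse) h1 hF
  have hYc := hYa.continuousAt
  have hZc := hZa.continuousAt
  have hPiq : ContinuousAt (fun q => Ring.inverse (P q)) q₀ := hinv hPc.continuousAt fun x => by
    rw [hP₀]; simp
  have hPix : ∀ q : (ℝ × ℝ) × ℝ, |q.1.2| < 1 → ∀ x, Ring.inverse (P q) x = (P q x)⁻¹ :=
    fun q hq x => ringInverse_apply (fun x => (hPpos q hq x).ne') x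
  -- The characteristic function: the residual of the right boundary condition, `y'` for Neumann and
  -- `y` for Dirichlet.
  set D : (ℝ × ℝ) × ℝ → ℝ := fun q =>
    if j₁ = 0 then Z q ⟨L, hLm⟩ else Y q ⟨L, hLm⟩ with hD
  have hDa : AnalyticAt ℝ D q₀ := by
    have h1 := ((ContinuousMap.evalCLM ℝ (⟨L, hLm⟩ : Icc (0 : ℝ) L)).analyticAt (Z q₀)).comp hZa
    have h2 := ((ContinuousMap.evalCLM ℝ (⟨L, hLm⟩ : Icc (0 : ℝ) L)).analyticAt (Y q₀)).comp hYa
    by_cases h : j₁ = 0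
    · simp only [hD, h, if_true]; exact h1
    · simp only [hD, h, if_false]; exact h2
  have hDbc : ∀ q, D q = 0 ↔ BdryCond j₁ (IccExtend hL' (Y q)) (IccExtend hL' (Z q)) L := by
    intro q
    rw [BdryCond, IccExtend_of_mem hL' _ hLm, IccExtend_of_mem hL' _ hLm]
    simp only [hD]
    split_ifs <;> rfl
  have hD₀ : D q₀ = 0 := by
    rw [hDbc, BdryCond, IccExtend_of_mem hL' _ hLm, IccExtend_of_mem hL' _ hLm, hbase.1, hbase.2]
    exact hbL
  -- Lagrange's identity
  have hLag : ∀ q : (ℝ × ℝ) × ℝ, |q.1.2| < 1 →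
      intL hL' (Z₀ * Z q * (Ring.inverse (P q) - 1) + ((μ₀ • 1 - l₀ • R) -
        P q * (q.2 • 1 - q.1.1 • R)) * Y₀ * Y q) =
      y L * (Z q ⟨L, hLm⟩ / √(1 + q.1.2 * g L)) - y₁ L * Y q ⟨L, hLm⟩ := by
    intro q hq
    have h1 := IsSLSolution.integral_lagrange hL' hs (hsol q hq) (hpq _ hq) (hpc _) (hr _ _)
      (hr _ _)
    rw [hb₀.wronskian_eq_zero (hb₀q q), sub_zero, IccExtend_of_mem hL' _ hLm,
      IccExtend_of_mem hL' _ hLm] at h1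
    rw [← h1]
    refine intL_eq hL' fun x hx => ?_
    rw [IccExtend_of_mem hL' _ hx, IccExtend_of_mem hL' _ hx]
    simp only [ContinuousMap.add_apply, ContinuousMap.mul_apply, ContinuousMap.sub_apply,
      ContinuousMap.smul_apply, ContinuousMap.one_apply, hPix q hq, hPx, smul_eq_mul, mul_one]
    rfl
  have hN : intL hL' (Y₀ * Y₀) = ∫ x in (0 : ℝ)..L, y x ^ 2 :=
    intL_eq hL' fun x hx => by rw [sq]; rfl
  have hNpos : 0 < ∫ x in (0 : ℝ)..L, y x ^ 2 :=
    intervalIntegral.integral_pos hL (hy.pow 2) (fun x _ => sq_nonneg _)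
      ⟨a, ha, by positivity⟩
  -- the characteristic function has a simple zero
  have hmkμ : ContinuousAt (fun μ : ℝ => ((l₀, (0 : ℝ)), μ)) μ₀ := by fun_prop
  have hDd : HasDerivAt (fun μ => D ((l₀, 0), μ)) (deriv (fun μ => D ((l₀, 0), μ)) μ₀) μ₀ := by
    have h1 : DifferentiableAt ℝ (fun μ : ℝ => ((l₀, (0 : ℝ)), μ)) μ₀ := by fun_prop
    exact (hDa.differentiableAt.comp μ₀ h1).hasDerivAt
  have hDne : deriv (fun μ => D ((l₀, 0), μ)) μ₀ ≠ 0 := by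
    -- The complementary boundary value, chosen so that `K * D` is the Wronskian boundary term at
    -- `L`. Lagrange's identity then reads `K * D = -(μ - μ₀) ∫ y Y`, and a zero derivative of `D`
    -- would give `∫ y² = 0`.
    set K : ℝ := if j₁ = 0 then y L else -(y₁ L) with hK
    have h1 := deriv_mul_eq_of_sub_mul_eq (A := fun _ => 1)
      (B := fun μ => -intL hL' (Y₀ * Y ((l₀, 0), μ))) (hDd.const_mul K)
      continuousAt_const ?_ (Eventually.of_forall fun μ => ?_)
    · intro h0
      rw [h0] at h1
      have h2 : Y ((l₀, 0), μ₀) = Y₀ := hbase.2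
      simp only [h2, hN] at h1
      linarith
    · exact ((intL hL').continuous.continuousAt.comp (f := fun μ => Y₀ * Y ((l₀, 0), μ))
        (continuousAt_const.mul (ContinuousAt.comp (g := Y) hYc hmkμ))).neg
    · have h2 := hLag ((l₀, 0), μ) (by simp)
      rw [hP₀, Ring.inverse_one, sub_self, mul_zero, zero_add, one_mul] at h2
      have h3 : ((μ₀ • (1 : C(Icc (0 : ℝ) L, ℝ)) - l₀ • R) - (μ • 1 - l₀ • R)) * Y₀ *
          Y ((l₀, 0), μ) = (μ₀ - μ) • (Y₀ * Y ((l₀, 0), μ)) := by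
        ext x; simp; ring
      simp only [] at h2
      rw [h3, map_smul, smul_eq_mul] at h2
      have h4 : K * D ((l₀, 0), μ) =
          y L * Z ((l₀, 0), μ) ⟨L, hLm⟩ - y₁ L * Y ((l₀, 0), μ) ⟨L, hLm⟩ := by
        by_cases h : j₁ = 0
        · have : y₁ L = 0 := by simpa [BdryCond, h] using hbL
          simp [hK, hD, h, this]
        · have : y L = 0 := by simpa [BdryCond, h] using hbL
          simp [hK, hD, h, this]
      have h5 : D ((l₀, 0), μ₀) = 0 := hD₀
      rw [h5, h4]
      simp only [zero_mul, add_zero, Real.sqrt_one, div_one] at h2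
      linear_combination -h2
  obtain ⟨M, hMa, hM₀, hMev⟩ := exists_analyticAt_implicit (X := ℝ × ℝ) hDa hDd hDne
  have hqc : ContinuousAt (fun x : ℝ × ℝ => (x, M x)) (l₀, 0) :=
    continuousAt_id.prodMk hMa.continuousAt
  have hqM : ((l₀, (0 : ℝ)), M (l₀, 0)) = q₀ := by rw [hM₀]
  have hεev : ∀ᶠ x : ℝ × ℝ in 𝓝 (l₀, 0), |x.2| < 1 := by
    have : ContinuousAt (fun x : ℝ × ℝ => |x.2|) (l₀, 0) := by fun_prop
    exact this.eventually_lt continuousAt_const (by simp)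
  have hDM : ∀ᶠ x : ℝ × ℝ in 𝓝 (l₀, 0), D (x, M x) = 0 := by
    filter_upwards [hMev] with x hx
    rw [hx]; exact hD₀
  have hLag0 : ∀ᶠ x : ℝ × ℝ in 𝓝 (l₀, 0),
      intL hL' (Z₀ * Z (x, M x) * (Ring.inverse (P (x, M x)) - 1) + ((μ₀ • 1 - l₀ • R) -
        P (x, M x) * (M x • 1 - x.1 • R)) * Y₀ * Y (x, M x)) = 0 := by
    filter_upwards [hεev, hDM] with x hx hxD
    rw [hLag (x, M x) hx]
    have h1 := hbL.wronskian_eq_zero (q := √(1 + x.2 * g L)) ((hDbc _).1 hxD)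
    rwa [IccExtend_of_mem hL' _ hLm, IccExtend_of_mem hL' _ hLm] at h1
  refine ⟨M, hMa, hM₀, ?_, hNpos, ?_, ?_⟩
  · -- the number of zeros is locally constant
    set S : (ℝ × ℝ) × ℝ → C(Icc (0 : ℝ) L, ℝ) :=
      fun q => Y q ^ 2 + (Z q * Ring.inverse (P q)) ^ 2 with hS
    have hSc : ContinuousAt S q₀ := (hYc.pow 2).add ((hZc.mul hPiq).pow 2)
    have hSx : ∀ q : (ℝ × ℝ) × ℝ, |q.1.2| < 1 → ∀ x, S q x = Y q x ^ 2 +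
        (Z q x / √(1 + q.1.2 * g x)) ^ 2 := fun q hq x => by
      simp only [hS, ContinuousMap.add_apply, ContinuousMap.pow_apply, ContinuousMap.mul_apply,
        hPix q hq, hPx, div_eq_mul_inv]
    have hSpos : ∀ q : (ℝ × ℝ) × ℝ, |q.1.2| < 1 → ∀ x, S q x ≠ 0 := fun q hq x => by
      have h1 := (hsol q hq).sq_add_sq_pos (hpq _ hq) (hpc _) (hr _ _) h0m
        (by rw [linSol_zero, linSolDeriv_zero]; exact hc) x.2
      rw [IccExtend_of_mem hL' _ x.2, IccExtend_of_mem hL' _ x.2] at h1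
      rw [hSx q hq]
      exact h1.ne'
    -- The total decrease of the Prüfer angle over `[0, L]`, written through `C([0, L])`-valued
    -- functions so that its continuity at `q₀` is visible.
    set Θ : (ℝ × ℝ) × ℝ → ℝ := fun q => intL hL' (P q * ((q.2 • 1 - q.1.1 • R) * Y q ^ 2 +
      (Z q * Ring.inverse (P q)) ^ 2) * Ring.inverse (S q)) with hΘ
    have hΘc : ContinuousAt Θ q₀ := by
      refine (intL hL').continuous.continuousAt.comp (ContinuousAt.mul (hPc.continuousAt.mul ?_)
        (hinv hSc (hSpos q₀ (by simp [hq₀]))))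
      refine ContinuousAt.add (ContinuousAt.mul ?_ (hYc.pow 2)) ((hZc.mul hPiq).pow 2)
      fun_prop
    have hΘeq : ∀ q : (ℝ × ℝ) × ℝ, |q.1.2| < 1 → ∀ v v₁ : ℝ → ℝ,
        (∀ x (hx : x ∈ Icc 0 L), Y q ⟨x, hx⟩ = v x) →
        (∀ x (hx : x ∈ Icc 0 L), Z q ⟨x, hx⟩ = v₁ x) →
        Θ q = ∫ x in (0 : ℝ)..L, √(1 + q.1.2 * g x) * ((q.2 - q.1.1 * ρ x) * v x ^ 2 +
          (v₁ x / √(1 + q.1.2 * g x)) ^ 2) / (v x ^ 2 + (v₁ x / √(1 + q.1.2 * g x)) ^ 2) := by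
      intro q hq v v₁ hv hv₁
      refine intL_eq hL' fun x hx => ?_
      rw [ContinuousMap.mul_apply, ringInverse_apply (hSpos q hq), hSx q hq, ← div_eq_mul_inv]
      simp only [ContinuousMap.add_apply, ContinuousMap.pow_apply, ContinuousMap.mul_apply,
        ContinuousMap.sub_apply, ContinuousMap.smul_apply, ContinuousMap.one_apply,
        hPix q hq, hPx, hv x hx, hv₁ x hx, smul_eq_mul, mul_one, ← div_eq_mul_inv]
      rfl
    have hbaseΘ : Real.pi / 2 * (j₀ : ℕ) - Θ q₀ = -(n * Real.pi) - Real.pi / 2 * (j₁ : ℕ) := by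
      obtain ⟨θ, hθ, hθ0, hθL⟩ := hs.exists_prufer hL' hp1 continuous_const (hr _ _) ha
        (Or.inl hya) (pruferInit hb₀)
      rw [← (hθ.encard_zeros_eq_iff hL hp1 hθ0 hbL n).1 hn, hθL,
        hΘeq q₀ (by simp [hq₀]) y y₁ (fun x hx => by rw [hbase.2]; rfl)
          (fun x hx => by rw [hbase.1]; rfl)]
      simp [hq₀]
    have hΘM : ContinuousAt (fun x : ℝ × ℝ => Θ (x, M x)) (l₀, 0) :=
      ContinuousAt.comp_of_eq (g := Θ) hΘc hqc hqM
    have hclose : ∀ᶠ x : ℝ × ℝ in 𝓝 (l₀, 0), |Θ (x, M x) - Θ q₀| < Real.pi := by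
      have h1 : ContinuousAt (fun x : ℝ × ℝ => |Θ (x, M x) - Θ q₀|) (l₀, 0) :=
        (hΘM.sub continuousAt_const).abs
      refine h1.eventually_lt continuousAt_const ?_
      rw [hqM, sub_self, abs_zero]
      exact Real.pi_pos
    filter_upwards [hεev, hDM, hclose] with x hx hxD hxΘ
    have hsx := hsol (x, M x) hx
    have hbx := (hDbc _).1 hxD
    obtain ⟨θ, hθ, hθ0, hθL⟩ := hsx.exists_prufer hL' (hpq _ hx) (hpc _) (hr _ _) h0m
      (by rw [linSol_zero, linSolDeriv_zero]; exact hc) (pruferInit (hb₀q _))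
    have e1 := hΘeq (x, M x) hx _ _ (fun t ht => (IccExtend_of_mem hL' (Y (x, M x)) ht).symm)
      (fun t ht => (IccExtend_of_mem hL' (Z (x, M x)) ht).symm)
    rw [← e1] at hθL
    -- Terminal angles compatible with the boundary condition are spaced by `π`, so one within `π`
    -- of the value for `n` zeros is that value.
    have e2 := hθ.eq_of_abs_sub_lt hL' hbx (n := n) (by
      rw [hθL, ← hbaseΘ, sub_sub_sub_cancel_left, abs_sub_comm]
      exact hxΘ)
    have e3 := (hθ.encard_zeros_eq_iff hL (hpq _ hx) hθ0 hbx n).2 e2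
    refine ⟨_, _, hsx, ?_, hb₀q _, hbx, e3⟩
    by_contra hcon
    push Not at hcon
    have : {t ∈ Ioo 0 L | IccExtend hL' (Y (x, M x)) t = 0} = Ioo 0 L := by
      ext t; exact ⟨fun h => h.1, fun h => ⟨h, hcon t (Ioo_subset_Icc_self h)⟩⟩
    rw [this, (Ioo_infinite hL).encard_eq] at e3
    simp at e3
  · have hl : ContinuousAt (fun l : ℝ => (l, (0 : ℝ))) l₀ := by fun_prop
    have hlq : ContinuousAt (fun l : ℝ => ((l, (0 : ℝ)), M (l, 0))) l₀ :=
      ContinuousAt.comp (g := fun x : ℝ × ℝ => (x, M x)) hqc hl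
    have hYl : ContinuousAt (fun l : ℝ => Y ((l, 0), M (l, 0))) l₀ :=
      ContinuousAt.comp_of_eq (g := Y) hYc hlq hqM
    have hd : HasDerivAt (fun l => M (l, 0)) (deriv (fun l => M (l, 0)) l₀) l₀ := by
      have h1 : DifferentiableAt ℝ (fun l : ℝ => (l, (0 : ℝ))) l₀ := by fun_prop
      exact (hMa.differentiableAt.comp l₀ h1).hasDerivAt
    -- With `ε = 0` Lagrange's identity is `(M - μ₀) ∫ y Y = (l - l₀) ∫ ρ y Y`. Dividing by `l - l₀`
    -- and passing to the limit gives the derivative without differentiating `Y`.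
    have key := deriv_mul_eq_of_sub_mul_eq (A := fun l => intL hL' (Y₀ * Y ((l, 0), M (l, 0))))
      (B := fun l => intL hL' (R * Y₀ * Y ((l, 0), M (l, 0)))) hd
      ((intL hL').continuous.continuousAt.comp (continuousAt_const.mul hYl))
      ((intL hL').continuous.continuousAt.comp (continuousAt_const.mul hYl)) (by
        filter_upwards [hl.eventually hLag0] with l hl0
        rw [hP₀, Ring.inverse_one, sub_self, mul_zero, zero_add, one_mul] at hl0
        have h3 : ((μ₀ • (1 : C(Icc (0 : ℝ) L, ℝ)) - l₀ • R) - (M (l, 0) • 1 - l • R)) * Y₀ *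
            Y ((l, 0), M (l, 0)) = (l - l₀) • (R * Y₀ * Y ((l, 0), M (l, 0))) -
            (M (l, 0) - μ₀) • (Y₀ * Y ((l, 0), M (l, 0))) := by
          ext x; simp; ring
        rw [h3, map_sub, map_smul, map_smul, smul_eq_mul, smul_eq_mul] at hl0
        rw [hM₀]
        linarith)
    simp only [hqM, hbase.2] at key
    rw [hN] at key
    rw [key]
    exact intL_eq hL' fun x hx => by rw [sq, ← mul_assoc]; rfl
  · have hl : ContinuousAt (fun ε : ℝ => (l₀, ε)) 0 := by fun_prop
    have hlq : ContinuousAt (fun ε : ℝ => ((l₀, ε), M (l₀, ε))) 0 :=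
      ContinuousAt.comp (g := fun x : ℝ × ℝ => (x, M x)) hqc hl
    have hYl : ContinuousAt (fun ε : ℝ => Y ((l₀, ε), M (l₀, ε))) 0 :=
      ContinuousAt.comp_of_eq (g := Y) hYc hlq hqM
    have hZl : ContinuousAt (fun ε : ℝ => Z ((l₀, ε), M (l₀, ε))) 0 :=
      ContinuousAt.comp_of_eq (g := Z) hZc hlq hqM
    have hPl : ContinuousAt (fun ε : ℝ => P ((l₀, ε), M (l₀, ε))) 0 :=
      ContinuousAt.comp_of_eq (g := P) hPc.continuousAt hlq hqM
    have hPil : ContinuousAt (fun ε : ℝ => Ring.inverse (P ((l₀, ε), M (l₀, ε)))) 0 :=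
      ContinuousAt.comp_of_eq (g := fun q => Ring.inverse (P q)) hPiq hlq hqM
    have hPnn : ∀ q x, 1 + P q x ≠ 0 := fun q x => by
      rw [hPx]; positivity
    have hQl : ContinuousAt (fun ε : ℝ => Ring.inverse (1 + P ((l₀, ε), M (l₀, ε)))) 0 :=
      ContinuousAt.comp_of_eq (g := fun q => Ring.inverse (1 + P q))
        (hinv (continuousAt_const.add hPc.continuousAt) (hPnn q₀)) hlq hqM
    have hd : HasDerivAt (fun ε => M (l₀, ε)) (deriv (fun ε => M (l₀, ε)) 0) 0 := by
      have h1 : DifferentiableAt ℝ (fun ε : ℝ => (l₀, ε)) 0 := by fun_prop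
      exact (hMa.differentiableAt.comp 0 h1).hasDerivAt
    -- The factor `ε` is extracted by `P - 1 = ε g / (1 + P)`, which follows from `P² = 1 + ε g`. At
    -- `ε = 0` the denominator `1 + P` equals `2`, whence the constant `-1/2`.
    have key := deriv_mul_eq_of_sub_mul_eq
      (A := fun ε => intL hL' (P ((l₀, ε), M (l₀, ε)) * Y₀ * Y ((l₀, ε), M (l₀, ε))))
      (B := fun ε => intL hL' (-(G * Ring.inverse (1 + P ((l₀, ε), M (l₀, ε)))) *
        (Z₀ * Z ((l₀, ε), M (l₀, ε)) * Ring.inverse (P ((l₀, ε), M (l₀, ε))) +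
          (μ₀ • 1 - l₀ • R) * Y₀ * Y ((l₀, ε), M (l₀, ε))))) hd
      ((intL hL').continuous.continuousAt.comp ((hPl.mul continuousAt_const).mul hYl))
      ((intL hL').continuous.continuousAt.comp ((continuousAt_const.mul hQl).neg.mul
        (((continuousAt_const.mul hZl).mul hPil).add (continuousAt_const.mul hYl)))) (by
        filter_upwards [hl.eventually hLag0, hl.eventually hεev] with ε hl0 hε
        have h3 : Z₀ * Z ((l₀, ε), M (l₀, ε)) * (Ring.inverse (P ((l₀, ε), M (l₀, ε))) - 1) +
            ((μ₀ • (1 : C(Icc (0 : ℝ) L, ℝ)) - l₀ • R) -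
              P ((l₀, ε), M (l₀, ε)) * (M (l₀, ε) • 1 - l₀ • R)) * Y₀ *
            Y ((l₀, ε), M (l₀, ε)) =
            ε • (-(G * Ring.inverse (1 + P ((l₀, ε), M (l₀, ε)))) *
        (Z₀ * Z ((l₀, ε), M (l₀, ε)) * Ring.inverse (P ((l₀, ε), M (l₀, ε))) +
          (μ₀ • 1 - l₀ • R) * Y₀ * Y ((l₀, ε), M (l₀, ε)))) -
            (M (l₀, ε) - μ₀) • (P ((l₀, ε), M (l₀, ε)) * Y₀ * Y ((l₀, ε), M (l₀, ε))) := by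
          ext x
          have hPp := hPpos ((l₀, ε), M (l₀, ε)) hε x
          have hsq : P ((l₀, ε), M (l₀, ε)) x ^ 2 = 1 + ε * G x := by
            rw [hPx]; exact Real.sq_sqrt (one_add_mul_pos hε (hgb x)).le
          have hi2 : Ring.inverse (1 + P ((l₀, ε), M (l₀, ε))) x =
              (1 + P ((l₀, ε), M (l₀, ε)) x)⁻¹ := ringInverse_apply (hPnn _) x
          simp only [ContinuousMap.add_apply, ContinuousMap.mul_apply, ContinuousMap.sub_apply,
            ContinuousMap.smul_apply, ContinuousMap.one_apply, ContinuousMap.neg_apply,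
            hPix ((l₀, ε), M (l₀, ε)) hε, hi2, smul_eq_mul, mul_one]
          generalize P ((l₀, ε), M (l₀, ε)) x = p at *
          have hp1' : 1 + p ≠ 0 := by positivity
          have hεG : ε * G x = (p - 1) * (p + 1) := by linear_combination -hsq
          field_simp
          linear_combination (Z₀ x * Z ((l₀, ε), M (l₀, ε)) x +
            p * (μ₀ - l₀ * R x) * Y₀ x * Y ((l₀, ε), M (l₀, ε)) x) * hεG
        rw [h3, map_sub, map_smul, map_smul, smul_eq_mul, smul_eq_mul] at hl0
        rw [hM₀]
        linarith)
    simp only [hqM, hbase.1, hbase.2] at key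
    have hPq₀ : P q₀ = 1 := hP₀ _ _
    rw [hPq₀, one_mul, hN] at key
    rw [key, ← intervalIntegral.integral_const_mul]
    refine intL_eq hL' fun x hx => ?_
    have hi2 : Ring.inverse (1 + (1 : C(Icc (0 : ℝ) L, ℝ))) ⟨x, hx⟩ = 1 / 2 := by
      rw [ringInverse_apply (fun x => by
        rw [ContinuousMap.add_apply, ContinuousMap.one_apply]; norm_num)]
      rw [ContinuousMap.add_apply, ContinuousMap.one_apply]; norm_num
    simp only [ContinuousMap.add_apply, ContinuousMap.mul_apply, ContinuousMap.sub_apply,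
      ContinuousMap.smul_apply, ContinuousMap.one_apply, ContinuousMap.neg_apply,
      Ring.inverse_one, hi2, smul_eq_mul, mul_one]
    change -(g x * (1 / 2)) * (y₁ x * y₁ x + (μ₀ - l₀ * ρ x) * y x * y x) = _
    ring

end EigenvaluePerturbation


/-! ### Stieltjes' maximum principle and polynomial solutions. -/

section Stieltjes

/-- The one-particle weight in Stieltjes' product. -/
def stieltjesWeight (e : ℝ) (a b c : ℕ) (t : ℝ) : ℝ :=
  t ^ (2 * a) * (t - 1) ^ (2 * b) * (t - e) ^ (2 * c)

theorem stieltjesWeight_nonneg (e : ℝ) (a b c : ℕ) (t : ℝ) : 0 ≤ stieltjesWeight e a b c t := by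
  simp only [stieltjesWeight, pow_mul]; positivity

variable {ι : Type*} [Fintype ι] [DecidableEq ι]

/-- Stieltjes' product, to be maximized. -/
def stieltjesProd (e : ℝ) (a b c : ℕ) (x : ι → ℝ) : ℝ :=
  (∏ j, stieltjesWeight e a b c (x j)) * ∏ j, ∏ l ∈ Finset.univ.erase j, (x j - x l) ^ 4

/-- Isolates the dependence on one coordinate. The product runs over ordered pairs, so a pair
containing `i` occurs twice and its exponent `4` becomes `8`. -/
theorem stieltjesProd_update (e : ℝ) (a b c : ℕ) (x : ι → ℝ) (i : ι) (t : ℝ) :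
    stieltjesProd e a b c (Function.update x i t) =
      ((∏ j ∈ Finset.univ.erase i, stieltjesWeight e a b c (x j)) *
        ∏ j ∈ Finset.univ.erase i, ∏ l ∈ (Finset.univ.erase j).erase i, (x j - x l) ^ 4) *
      (stieltjesWeight e a b c t * (∏ l ∈ Finset.univ.erase i, (t - x l)) ^ 8) := by
  have h1 : ∏ j, stieltjesWeight e a b c (Function.update x i t j) =
      stieltjesWeight e a b c t * ∏ j ∈ Finset.univ.erase i, stieltjesWeight e a b c (x j) := by
    rw [← Finset.mul_prod_erase _ _ (Finset.mem_univ i), Function.update_self]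
    congr 1
    refine Finset.prod_congr rfl fun j hj => ?_
    rw [Function.update_of_ne (Finset.ne_of_mem_erase hj)]
  have h2 : ∏ j, ∏ l ∈ Finset.univ.erase j,
      (Function.update x i t j - Function.update x i t l) ^ 4 =
      (∏ l ∈ Finset.univ.erase i, (t - x l)) ^ 8 *
        ∏ j ∈ Finset.univ.erase i, ∏ l ∈ (Finset.univ.erase j).erase i, (x j - x l) ^ 4 := by
    rw [← Finset.mul_prod_erase _ _ (Finset.mem_univ i), Function.update_self]
    have e1 : ∏ l ∈ Finset.univ.erase i, (t - Function.update x i t l) ^ 4 =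
        (∏ l ∈ Finset.univ.erase i, (t - x l)) ^ 4 := by
      rw [← Finset.prod_pow]
      refine Finset.prod_congr rfl fun j hj => ?_
      rw [Function.update_of_ne (Finset.ne_of_mem_erase hj)]
    have e2 : ∏ j ∈ Finset.univ.erase i, ∏ l ∈ Finset.univ.erase j,
        (Function.update x i t j - Function.update x i t l) ^ 4 =
        ∏ j ∈ Finset.univ.erase i, ((t - x j) ^ 4 *
          ∏ l ∈ (Finset.univ.erase j).erase i, (x j - x l) ^ 4) := by
      refine Finset.prod_congr rfl fun j hj => ?_
      have hji := Finset.ne_of_mem_erase hj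
      have him : i ∈ Finset.univ.erase j := Finset.mem_erase.2 ⟨hji.symm, Finset.mem_univ i⟩
      rw [← Finset.mul_prod_erase _ _ him, Function.update_self, Function.update_of_ne hji]
      congr 1
      · ring
      · refine Finset.prod_congr rfl fun l hl => ?_
        rw [Function.update_of_ne (Finset.ne_of_mem_erase hl)]
    rw [e1, e2, Finset.prod_mul_distrib, Finset.prod_pow]
    ring
  rw [stieltjesProd, h1, h2]
  ring

theorem continuous_stieltjesProd (e : ℝ) (a b c : ℕ) :
    Continuous (stieltjesProd e a b c : (ι → ℝ) → ℝ) := by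
  unfold stieltjesProd stieltjesWeight
  fun_prop

/-- Equilibrium condition at an interior maximum of Stieltjes' product. -/
theorem stieltjes_equilibrium {e : ℝ} {a b c : ℕ} (x : ι → ℝ) (i : ι)
    (hpos : stieltjesProd e a b c x ≠ 0)
    (hmax : ∀ᶠ t in 𝓝 (x i), stieltjesProd e a b c (Function.update x i t) ≤
      stieltjesProd e a b c x) (h0 : x i ≠ 0) (h1 : x i ≠ 1) (he : x i ≠ e) :
    a / x i + b / (x i - 1) + c / (x i - e) +
      4 * logDeriv (fun t => ∏ l ∈ Finset.univ.erase i, (t - x l)) (x i) = 0 := by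
  set R : ℝ → ℝ := fun t => ∏ l ∈ Finset.univ.erase i, (t - x l) with hR
  have hup : ∀ t, stieltjesProd e a b c (Function.update x i t) = _ :=
    stieltjesProd_update e a b c x i
  set C := ((∏ j ∈ Finset.univ.erase i, stieltjesWeight e a b c (x j)) *
        ∏ j ∈ Finset.univ.erase i, ∏ l ∈ (Finset.univ.erase j).erase i, (x j - x l) ^ 4) with hC
  have hself := hup (x i)
  rw [Function.update_eq_self] at hself
  have hCnn : 0 ≤ C := mul_nonneg (Finset.prod_nonneg fun _ _ => stieltjesWeight_nonneg ..)
    (Finset.prod_nonneg fun _ _ => Finset.prod_nonneg fun _ _ => by positivity)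
  rw [hself] at hpos
  have hCpos : 0 < C := lt_of_le_of_ne hCnn (Ne.symm (left_ne_zero_of_mul hpos))
  have hRne : R (x i) ≠ 0 := by
    have := right_ne_zero_of_mul (right_ne_zero_of_mul hpos)
    exact fun h => this (by rw [show ∏ l ∈ Finset.univ.erase i, (x i - x l) = 0 from h]; simp)
  have hloc : IsLocalMax (fun t => stieltjesWeight e a b c t * R t ^ 8) (x i) := by
    filter_upwards [hmax] with t ht
    rw [hup, hself] at ht
    exact le_of_mul_le_mul_left ht hCpos
  have hRd : DifferentiableAt ℝ R (x i) := by
    rw [hR]; fun_prop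
  have hd := hloc.deriv_eq_zero
  -- The logarithmic derivative of the one-variable factor has coefficients `2a`, `2b`, `2c` and
  -- `8`; the equilibrium condition is half of it.
  have hlog : logDeriv (fun t => stieltjesWeight e a b c t * R t ^ 8) (x i) = 0 := by
    rw [logDeriv_apply, hd, zero_div]
  have hsub : ∀ s : ℝ, logDeriv (fun t : ℝ => t - s) (x i) = 1 / (x i - s) := fun s => by
    rw [logDeriv_apply]; simp
  have h1' : x i - 1 ≠ 0 := sub_ne_zero.2 h1
  have he' : x i - e ≠ 0 := sub_ne_zero.2 he
  simp only [stieltjesWeight] at hlog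
  rw [logDeriv_mul (f := fun t => t ^ (2 * a) * (t - 1) ^ (2 * b) * (t - e) ^ (2 * c))
      (g := fun t => R t ^ 8) _ (by positivity) (by positivity) (by fun_prop) (by fun_prop),
    logDeriv_mul (f := fun t => t ^ (2 * a) * (t - 1) ^ (2 * b))
      (g := fun t => (t - e) ^ (2 * c)) _ (by positivity) (by positivity) (by fun_prop)
      (by fun_prop),
    logDeriv_mul (f := fun t => t ^ (2 * a))
      (g := fun t => (t - 1) ^ (2 * b)) _ (by positivity) (by positivity) (by fun_prop)
      (by fun_prop), logDeriv_fun_pow (by fun_prop), logDeriv_fun_pow (by fun_prop),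
    logDeriv_fun_pow (by fun_prop), logDeriv_fun_pow hRd, hsub, hsub] at hlog
  have h0' : logDeriv (fun t : ℝ => t) (x i) = 1 / x i := by rw [logDeriv_apply]; simp
  rw [h0'] at hlog
  push_cast at hlog
  linear_combination hlog / 2

/-- The product is maximized over a compact box with `n` coordinates in `[0, 1]` and `m` in `[1,
e]`. As `a`, `b`, `c` are nonzero, it vanishes when a coordinate is `0`, `1` or `e`, and also when
two coordinates coincide; a maximizer with positive value is therefore injective and interior. -/
theorem exists_stieltjes {e : ℝ} (he : 1 < e) {a b c : ℕ} (ha : a ≠ 0) (hb : b ≠ 0) (hc : c ≠ 0)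
    (n m : ℕ) : ∃ x : Fin n ⊕ Fin m → ℝ, Function.Injective x ∧
      (∀ i, x (Sum.inl i) ∈ Ioo 0 1) ∧ (∀ i, x (Sum.inr i) ∈ Ioo 1 e) ∧
      ∀ i, a / x i + b / (x i - 1) + c / (x i - e) +
        4 * logDeriv (fun t => ∏ l ∈ Finset.univ.erase i, (t - x l)) (x i) = 0 := by
  set lo : Fin n ⊕ Fin m → ℝ := Sum.elim (fun _ => 0) (fun _ => 1) with hlo
  set hi : Fin n ⊕ Fin m → ℝ := Sum.elim (fun _ => 1) (fun _ => e) with hhi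
  set B : Set (Fin n ⊕ Fin m → ℝ) := Set.pi univ fun i => Icc (lo i) (hi i) with hB
  have hBc : IsCompact B := isCompact_univ_pi fun i => isCompact_Icc
  -- a point where the product is positive
  set z : Fin n ⊕ Fin m → ℝ := Sum.elim (fun i => ((i : ℕ) + 1 : ℝ) / (n + 1))
    (fun i => 1 + (e - 1) * (((i : ℕ) + 1 : ℝ) / (m + 1))) with hz
  have hfrac : ∀ (N : ℕ) (i : Fin N), ((i : ℕ) + 1 : ℝ) / (N + 1) ∈ Ioo (0 : ℝ) 1 := fun N i => by
    have h1 : ((i : ℕ) : ℝ) < N := by exact_mod_cast i.2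
    refine ⟨by positivity, ?_⟩
    rw [div_lt_one (by positivity)]
    linarith
  have hzl : ∀ i, z (Sum.inl i) ∈ Ioo 0 1 := fun i => hfrac n i
  have hzr : ∀ i, z (Sum.inr i) ∈ Ioo 1 e := fun i => by
    have := hfrac m i
    simp only [hz, Sum.elim_inr]
    constructor <;> nlinarith [this.1, this.2]
  have hfinj : ∀ (N : ℕ) (i j : Fin N), ((i : ℕ) + 1 : ℝ) / (N + 1) = ((j : ℕ) + 1 : ℝ) / (N + 1) →
      i = j := fun N i j h => by
    have hN : (N : ℝ) + 1 ≠ 0 := by positivity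
    rw [div_left_inj' hN, add_left_inj] at h
    exact Fin.ext (by exact_mod_cast h)
  have hzinj : Function.Injective z := by
    rintro (i | i) (j | j) h
    · rw [hfinj n i j h]
    · have h1 := (hzl i).2; have h2 := (hzr j).1
      rw [h] at h1; exact absurd h1 (not_lt.2 h2.le)
    · have h1 := (hzr i).1; have h2 := (hzl j).2
      rw [h] at h1; exact absurd h1 (not_lt.2 h2.le)
    · have he1 : e - 1 ≠ 0 := by linarith
      have h' := mul_left_cancel₀ he1 (add_left_cancel h)
      rw [hfinj m i j h']
  have hzB : z ∈ B := by
    rintro (i | i) -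
    · exact Ioo_subset_Icc_self (hzl i)
    · exact Ioo_subset_Icc_self (hzr i)
  have hzpos : 0 < stieltjesProd e a b c z := by
    refine mul_pos (Finset.prod_pos fun i _ => ?_)
      (Finset.prod_pos fun i _ => Finset.prod_pos fun j hj => ?_)
    · refine lt_of_le_of_ne (stieltjesWeight_nonneg ..) (Ne.symm ?_)
      rcases i with i | i
      · have := hzl i
        exact mul_ne_zero (mul_ne_zero (pow_ne_zero _ this.1.ne')
          (pow_ne_zero _ (by linarith [this.2]))) (pow_ne_zero _ (by linarith [this.2]))
      · have := hzr i
        exact mul_ne_zero (mul_ne_zero (pow_ne_zero _ (by linarith [this.1]))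
          (pow_ne_zero _ (by linarith [this.1]))) (pow_ne_zero _ (by linarith [this.2]))
    · have : z i - z j ≠ 0 := sub_ne_zero.2 fun h => Finset.ne_of_mem_erase hj (hzinj h).symm
      positivity
  obtain ⟨x, hxB, hxmax⟩ := hBc.exists_isMaxOn ⟨z, hzB⟩
    (continuous_stieltjesProd e a b c).continuousOn
  have hxpos : stieltjesProd e a b c x ≠ 0 := (hzpos.trans_le (hxmax hzB)).ne'
  have hw : ∀ i, stieltjesWeight e a b c (x i) ≠ 0 := fun i =>
    Finset.prod_ne_zero_iff.1 (left_ne_zero_of_mul hxpos) i (Finset.mem_univ i)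
  have hw0 : ∀ i, x i ≠ 0 := fun i h => hw i (by simp [stieltjesWeight, h, ha])
  have hw1 : ∀ i, x i ≠ 1 := fun i h => hw i (by simp [stieltjesWeight, h, hb])
  have hwe : ∀ i, x i ≠ e := fun i h => hw i (by simp [stieltjesWeight, h, hc])
  have hint : ∀ i, x i ∈ Ioo (lo i) (hi i) := by
    rintro (i | i)
    · have := hxB (Sum.inl i) (mem_univ _)
      exact ⟨lt_of_le_of_ne this.1 (Ne.symm (hw0 _)), lt_of_le_of_ne this.2 (hw1 _)⟩
    · have := hxB (Sum.inr i) (mem_univ _)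
      exact ⟨lt_of_le_of_ne this.1 (Ne.symm (hw1 _)), lt_of_le_of_ne this.2 (hwe _)⟩
  refine ⟨x, fun i j hij => ?_, fun i => hint (Sum.inl i), fun i => hint (Sum.inr i), fun i =>
    stieltjes_equilibrium x i hxpos ?_ (hw0 i) (hw1 i) (hwe i)⟩
  · by_contra hne
    have h1 := Finset.prod_ne_zero_iff.1 (right_ne_zero_of_mul hxpos) i (Finset.mem_univ i)
    exact Finset.prod_ne_zero_iff.1 h1 j (Finset.mem_erase.2 ⟨Ne.symm hne, Finset.mem_univ j⟩)
      (by rw [hij, sub_self]; simp)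
  · filter_upwards [Icc_mem_nhds (hint i).1 (hint i).2] with t ht
    refine hxmax fun j _ => ?_
    by_cases hj : j = i
    · subst hj; simpa using ht
    · rw [Function.update_of_ne hj]; exact hxB j (mem_univ j)

/-- Leading coefficient of the image of a monic polynomial under a Lamé type operator. -/
theorem coeff_lame_operator {P : ℝ[X]} (hP : P.Monic) (e : ℝ) (a b c : ℕ) :
    (2 * (X * (X - 1) * (X - C e)) * derivative (derivative P) +
      ((a : ℝ[X]) * ((X - 1) * (X - C e)) + (b : ℝ[X]) * (X * (X - C e)) +
        (c : ℝ[X]) * (X * (X - 1))) * derivative P).coeff (P.natDegree + 1) =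
      (P.natDegree : ℝ) * (2 * ((P.natDegree : ℝ) - 1) + a + b + c) := by
  have hN : P.coeff P.natDegree = 1 := hP
  have hN1 : ∀ i, P.natDegree < i → P.coeff i = 0 := fun i hi => coeff_eq_zero_of_natDegree_lt hi
  have e1 : (2 * (X * (X - 1) * (X - C e)) * derivative (derivative P) +
      ((a : ℝ[X]) * ((X - 1) * (X - C e)) + (b : ℝ[X]) * (X * (X - C e)) +
        (c : ℝ[X]) * (X * (X - 1))) * derivative P) =
      C 2 * (X ^ 3 * derivative (derivative P)) - C (2 * (1 + e)) * (X ^ 2 * derivative (derivative P))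
      + C (2 * e) * (X ^ 1 * derivative (derivative P)) +
      (C (a + b + c : ℝ) * (X ^ 2 * derivative P) -
      C (a * (1 + e) + b * e + c) * (X ^ 1 * derivative P) + C (a * e) * derivative P) := by
    simp only [map_add, map_mul, map_one, map_natCast, map_ofNat]
    ring
  rw [e1]
  simp only [coeff_add, coeff_sub, coeff_C_mul, coeff_X_pow_mul', coeff_derivative]
  generalize P.natDegree = N at *
  rcases N with _ | _ | N
  · simp [hN1]
  · simp [hN1, hN]
  · simp [hN1, hN]
    ring

theorem natDegree_lame_operator_le (P : ℝ[X]) (e : ℝ) (a b c : ℕ) :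
    (2 * (X * (X - 1) * (X - C e)) * derivative (derivative P) +
      ((a : ℝ[X]) * ((X - 1) * (X - C e)) + (b : ℝ[X]) * (X * (X - C e)) +
        (c : ℝ[X]) * (X * (X - 1))) * derivative P).natDegree ≤ P.natDegree + 1 := by
  rcases Nat.eq_zero_or_pos P.natDegree with h | h
  · rw [eq_C_of_natDegree_eq_zero h]; simp
  have h1 : (derivative P).natDegree ≤ P.natDegree - 1 := natDegree_derivative_le P
  by_cases h2 : P.natDegree = 1
  · have h3 : derivative (derivative P) = 0 := by
      rw [h2] at h1
      rw [eq_C_of_natDegree_eq_zero (Nat.le_zero.1 h1)]; simp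
    rw [h3, mul_zero, zero_add]
    refine natDegree_mul_le.trans ?_
    have : ((a : ℝ[X]) * ((X - 1) * (X - C e)) + (b : ℝ[X]) * (X * (X - C e)) +
        (c : ℝ[X]) * (X * (X - 1))).natDegree ≤ 2 := by compute_degree
    lia
  · have h3 : (derivative (derivative P)).natDegree ≤ P.natDegree - 1 - 1 :=
      (natDegree_derivative_le _).trans (Nat.sub_le_sub_right h1 1)
    refine natDegree_add_le_of_degree_le (natDegree_mul_le.trans ?_) (natDegree_mul_le.trans ?_)
    · have : (2 * (X * (X - 1) * (X - C e)) : ℝ[X]).natDegree ≤ 3 := by compute_degree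
      lia
    · have : ((a : ℝ[X]) * ((X - 1) * (X - C e)) + (b : ℝ[X]) * (X * (X - C e)) +
        (c : ℝ[X]) * (X * (X - 1))).natDegree ≤ 2 := by compute_degree
      lia

/-- Stieltjes' theorem on polynomial solutions of Lamé's equation with prescribed distribution of
the zeros. -/
theorem exists_stieltjes_polynomial {e : ℝ} (he : 1 < e) {a b c : ℕ} (ha : a ≠ 0) (hb : b ≠ 0)
    (hc : c ≠ 0) (n m : ℕ) : ∃ (x : Fin n ⊕ Fin m → ℝ) (s : ℝ), Function.Injective x ∧
      (∀ i, x (Sum.inl i) ∈ Ioo 0 1) ∧ (∀ i, x (Sum.inr i) ∈ Ioo 1 e) ∧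
      ∀ P : ℝ[X], P = ∏ i, (X - C (x i)) → ∀ z : ℝ,
        2 * (z * (z - 1) * (z - e)) * (derivative (derivative P)).eval z +
        (a * ((z - 1) * (z - e)) + b * (z * (z - e)) + c * (z * (z - 1))) *
          (derivative P).eval z =
        ((n + m : ℝ) * (2 * ((n + m : ℝ) - 1) + a + b + c) * z + s) * P.eval z := by
  obtain ⟨x, hinj, hl, hr, heq⟩ := exists_stieltjes he ha hb hc n m
  set P : ℝ[X] := ∏ i, (X - C (x i)) with hP
  have hmonic : P.Monic := monic_prod_of_monic _ _ fun i _ => monic_X_sub_C _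
  have hdeg : P.natDegree = n + m := by
    rw [hP, natDegree_prod_of_monic _ _ fun i _ => monic_X_sub_C _]
    simp
  set F : ℝ[X] := 2 * (X * (X - 1) * (X - C e)) * derivative (derivative P) +
      ((a : ℝ[X]) * ((X - 1) * (X - C e)) + (b : ℝ[X]) * (X * (X - C e)) +
        (c : ℝ[X]) * (X * (X - 1))) * derivative P with hF
  -- Writing `P = (X - x i) R`, one has `P' = R` and `P'' = 2 R'` at `x i`. The equilibrium
  -- condition, cleared of denominators, says exactly that `F` vanishes there.
  have hroot : ∀ i, F.eval (x i) = 0 := by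
    intro i
    set R : ℝ[X] := ∏ l ∈ Finset.univ.erase i, (X - C (x l)) with hR
    have hPR : P = (X - C (x i)) * R := (Finset.mul_prod_erase _ _ (Finset.mem_univ i)).symm
    have h1 : (derivative P).eval (x i) = R.eval (x i) := by
      rw [hPR]; simp [derivative_mul]
    have h2 : (derivative (derivative P)).eval (x i) = 2 * (derivative R).eval (x i) := by
      rw [hPR]; simp [derivative_mul]; ring
    have hRf : (fun t => ∏ l ∈ Finset.univ.erase i, (t - x l)) = fun t => R.eval t := by
      funext t; simp [hR, eval_prod]
    have h3 := heq i
    rw [hRf, logDeriv_apply, Polynomial.deriv] at h3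
    have hRne : R.eval (x i) ≠ 0 := by
      rw [hR, eval_prod]
      refine Finset.prod_ne_zero_iff.2 fun l hl => ?_
      simpa [sub_eq_zero] using fun h => Finset.ne_of_mem_erase hl (hinj h).symm
    have hx : x i ≠ 0 ∧ x i - 1 ≠ 0 ∧ x i - e ≠ 0 := by
      rcases i with i | i
      · have := hl i; exact ⟨this.1.ne', by linarith [this.2], by linarith [this.2]⟩
      · have := hr i
        exact ⟨by linarith [this.1], by linarith [this.1], by linarith [this.2]⟩
    obtain ⟨hx0, hx1, hxe⟩ := hx
    simp only [hF, eval_add, eval_mul, eval_sub, eval_X, eval_C, eval_one, eval_natCast,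
      eval_ofNat, h1, h2]
    field_simp at h3
    linear_combination h3
  -- The roots are distinct, so `P` divides `F`; the degree bound makes the quotient linear. Its
  -- leading coefficient is forced, and its constant term is the accessory parameter.
  have hdvd : P ∣ F := by
    refine Finset.prod_dvd_of_coprime (fun i _ j _ hij => pairwise_coprime_X_sub_C hinj hij)
      fun i _ => dvd_iff_isRoot.2 (hroot i)
  obtain ⟨S, hS⟩ := hdvd
  have hSdeg : S.natDegree ≤ 1 := by
    by_cases hS0 : S = 0
    · simp [hS0]
    have h1 := natDegree_lame_operator_le P e a b c
    rw [← hF, hS, hmonic.natDegree_mul' hS0] at h1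
    lia
  have hlead : S.coeff 1 = (n + m : ℝ) * (2 * ((n + m : ℝ) - 1) + a + b + c) := by
    have h1 := coeff_lame_operator hmonic e a b c
    rw [← hF, hS, coeff_mul_add_eq_of_natDegree_le le_rfl hSdeg, hdeg] at h1
    have h2 : P.coeff (n + m) = 1 := by rw [← hdeg]; exact hmonic
    rw [h2, one_mul] at h1
    rw [h1]; push_cast; ring
  refine ⟨x, S.coeff 0, hinj, hl, hr, fun Q hQ z => ?_⟩
  rw [hQ, ← hP]
  have h1 : F.eval z = (S.coeff 1 * z + S.coeff 0) * P.eval z := by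
    rw [hS, eval_mul]
    conv_lhs => rw [eq_X_add_C_of_natDegree_le_one hSdeg]
    simp; ring
  rw [hlead] at h1
  rw [← h1]
  simp only [hF, eval_add, eval_mul, eval_sub, eval_X, eval_C, eval_one, eval_natCast, eval_ofNat]

end Stieltjes


/-! ### Lamé's equation in elliptic and algebraic form. -/

section LameEquation

/-- A triple of functions with the derivatives and quadratic relations of `sn`, `cn`, `dn`, either
on the real axis (`σ = 1`) or on a line parallel to the imaginary axis (`σ = -1`). -/
structure IsJacobiTriple (σ k : ℝ) (S C D : ℝ → ℝ) : Prop where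
  sq_sign : σ ^ 2 = 1
  hasDerivAt_S : ∀ t, HasDerivAt S (σ * C t * D t) t
  hasDerivAt_C : ∀ t, HasDerivAt C (-(S t * D t)) t
  hasDerivAt_D : ∀ t, HasDerivAt D (-(σ * k ^ 2 * S t * C t)) t
  sq_C : ∀ t, C t ^ 2 = σ * (1 - S t ^ 2)
  sq_D : ∀ t, D t ^ 2 = 1 - k ^ 2 * S t ^ 2

/-- The prefactor `S^a C^b D^c` of a Lamé function. -/
def lamePre (a b c : ℕ) (S C D : ℝ → ℝ) (t : ℝ) : ℝ := S t ^ a * C t ^ b * D t ^ c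

/-- `S^a C^b D^c P(S²)`. -/
noncomputable def lameReal (a b c : ℕ) (P : ℝ[X]) (S C D : ℝ → ℝ) (t : ℝ) : ℝ :=
  lamePre a b c S C D t * P.eval (S t ^ 2)

/-- The algebraic form of Lamé's operator. -/
noncomputable def lameOp (k : ℝ) (a b c : ℕ) (P : ℝ[X]) (x : ℝ) : ℝ :=
  4 * (x * (1 - x) * (1 - k ^ 2 * x)) * (derivative (derivative P)).eval x +
  2 * ((1 + 2 * a) * ((1 - x) * (1 - k ^ 2 * x)) - (1 + 2 * b) * (x * (1 - k ^ 2 * x)) -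
    (1 + 2 * c) * (k ^ 2 * x * (1 - x))) * (derivative P).eval x +
  ((a + b + c) * (a + b + c + 1) * k ^ 2 * x - ((a + b) ^ 2 + k ^ 2 * (a + c) ^ 2)) * P.eval x

variable {σ k : ℝ} {S C D : ℝ → ℝ}

/-- A finite check over the eight parities. The third clause supplies the cross term `2 f₁ x' P'`
for `x = S²`, `x' = 2 σ S C D`; the last one supplies the Neumann conditions. -/
theorem IsJacobiTriple.exists_deriv_lamePre (h : IsJacobiTriple σ k S C D) {a b c : ℕ}
    (ha : a ≤ 1) (hb : b ≤ 1) (hc : c ≤ 1) : ∃ f₁ : ℝ → ℝ,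
      (∀ t, HasDerivAt (lamePre a b c S C D) (f₁ t) t) ∧
      (∀ t, HasDerivAt f₁ (σ * ((a + b + c) * (a + b + c + 1) * k ^ 2 * S t ^ 2 -
        ((a + b) ^ 2 + k ^ 2 * (a + c) ^ 2)) * lamePre a b c S C D t) t) ∧
      (∀ t, f₁ t * (2 * σ * S t * C t * D t) = 2 * σ * (a * ((1 - S t ^ 2) *
        (1 - k ^ 2 * S t ^ 2)) - b * (S t ^ 2 * (1 - k ^ 2 * S t ^ 2)) -
        c * (k ^ 2 * S t ^ 2 * (1 - S t ^ 2))) * lamePre a b c S C D t) ∧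
      ∀ t, (a = 0 ∧ S t = 0 ∨ b = 0 ∧ C t = 0 ∨ c = 0 ∧ D t = 0) → f₁ t = 0 := by
  have hσ := h.sq_sign
  have hS := h.hasDerivAt_S
  have hC := h.hasDerivAt_C
  have hD := h.hasDerivAt_D
  have hC2 := h.sq_C
  have hD2 := h.sq_D
  unfold lamePre
  interval_cases a <;> interval_cases b <;> interval_cases c <;>
    simp only [pow_zero, pow_one, one_mul, mul_one, Nat.cast_zero, Nat.cast_one]
  · exact ⟨fun _ => 0, fun t => hasDerivAt_const t 1,
      fun t => (hasDerivAt_const t (0 : ℝ)).congr_deriv (by ring), fun t => by ring, fun _ _ => rfl⟩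
  · refine ⟨fun t => -(σ * k ^ 2) * (S t * C t), fun t => (hD t).congr_deriv (by ring),
      fun t => (((hS t).mul (hC t)).const_mul (-(σ * k ^ 2))).congr_deriv ?_, fun t => ?_, fun t ht => ?_⟩
    · have := hC2 t; have := hD2 t; grind
    · have := hC2 t; have := hD2 t; grind
    · rcases ht with ⟨h1, h2⟩ | ⟨h1, h2⟩ | ⟨h1, h2⟩ <;> first | simp at h1 | simp [h2]
  · refine ⟨fun t => -(S t * D t), fun t => hC t,
      fun t => ((hS t).mul (hD t)).neg.congr_deriv ?_, fun t => ?_, fun t ht => ?_⟩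
    · have := hC2 t; have := hD2 t; grind
    · have := hC2 t; have := hD2 t; grind
    · rcases ht with ⟨h1, h2⟩ | ⟨h1, h2⟩ | ⟨h1, h2⟩ <;> first | simp at h1 | simp [h2]
  · refine ⟨fun t => -(S t * (D t * D t)) - (σ * k ^ 2) * (S t * (C t * C t)), fun t =>
      ((hC t).mul (hD t)).congr_deriv (by ring),
      fun t => ((((hS t).mul ((hD t).mul (hD t))).neg).sub
        (((hS t).mul ((hC t).mul (hC t))).const_mul (σ * k ^ 2))).congr_deriv ?_, fun t => ?_, fun t ht => ?_⟩
    · have := hC2 t; have := hD2 t; simp only [Pi.mul_apply]; grind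
    · have := hC2 t; have := hD2 t; grind
    · rcases ht with ⟨h1, h2⟩ | ⟨h1, h2⟩ | ⟨h1, h2⟩ <;> first | simp at h1 | simp [h2]
  · refine ⟨fun t => σ * (C t * D t), fun t => (hS t).congr_deriv (by ring),
      fun t => (((hC t).mul (hD t)).const_mul σ).congr_deriv ?_, fun t => ?_, fun t ht => ?_⟩
    · have := hC2 t; have := hD2 t; grind
    · have := hC2 t; have := hD2 t; grind
    · rcases ht with ⟨h1, h2⟩ | ⟨h1, h2⟩ | ⟨h1, h2⟩ <;> first | simp at h1 | simp [h2]
  · refine ⟨fun t => σ * (C t * (D t * D t)) - (σ * k ^ 2) * (C t * (S t * S t)), fun t =>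
      ((hS t).mul (hD t)).congr_deriv (by ring),
      fun t => ((((hC t).mul ((hD t).mul (hD t))).const_mul σ).sub
        (((hC t).mul ((hS t).mul (hS t))).const_mul (σ * k ^ 2))).congr_deriv ?_, fun t => ?_, fun t ht => ?_⟩
    · have := hC2 t; have := hD2 t; simp only [Pi.mul_apply]; grind
    · have := hC2 t; have := hD2 t; grind
    · rcases ht with ⟨h1, h2⟩ | ⟨h1, h2⟩ | ⟨h1, h2⟩ <;> first | simp at h1 | simp [h2]
  · refine ⟨fun t => σ * (D t * (C t * C t)) - (D t * (S t * S t)), fun t =>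
      ((hS t).mul (hC t)).congr_deriv (by ring),
      fun t => ((((hD t).mul ((hC t).mul (hC t))).const_mul σ).sub
        (((hD t).mul ((hS t).mul (hS t))))).congr_deriv ?_, fun t => ?_, fun t ht => ?_⟩
    · have := hC2 t; have := hD2 t; simp only [Pi.mul_apply]; grind
    · have := hC2 t; have := hD2 t; grind
    · rcases ht with ⟨h1, h2⟩ | ⟨h1, h2⟩ | ⟨h1, h2⟩ <;> first | simp at h1 | simp [h2]
  · refine ⟨fun t => σ * ((C t * C t) * (D t * D t)) - ((S t * S t) * (D t * D t)) -
      (σ * k ^ 2) * ((S t * S t) * (C t * C t)), fun t =>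
      (((hS t).mul (hC t)).mul (hD t)).congr_deriv (by simp only [Pi.mul_apply]; ring),
      fun t => ((((((hC t).mul (hC t)).mul ((hD t).mul (hD t))).const_mul σ).sub
        (((hS t).mul (hS t)).mul ((hD t).mul (hD t)))).sub
        ((((hS t).mul (hS t)).mul ((hC t).mul (hC t))).const_mul (σ * k ^ 2))).congr_deriv ?_,
      fun t => ?_, fun t ht => ?_⟩
    · have := hC2 t; have := hD2 t; simp only [Pi.mul_apply]; grind
    · have := hC2 t; have := hD2 t; grind
    · rcases ht with ⟨h1, h2⟩ | ⟨h1, h2⟩ | ⟨h1, h2⟩ <;> simp at h1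

/-- Transformation of Lamé's equation to algebraic form. -/
theorem IsJacobiTriple.exists_deriv_lameReal (h : IsJacobiTriple σ k S C D) {a b c : ℕ}
    (ha : a ≤ 1) (hb : b ≤ 1) (hc : c ≤ 1) (P : ℝ[X]) : ∃ w₁ : ℝ → ℝ,
      (∀ t, HasDerivAt (lameReal a b c P S C D) (w₁ t) t) ∧
      (∀ t, HasDerivAt w₁ (σ * lamePre a b c S C D t * lameOp k a b c P (S t ^ 2)) t) ∧
      ∀ t, (a = 0 ∧ S t = 0 ∨ b = 0 ∧ C t = 0 ∨ c = 0 ∧ D t = 0) → w₁ t = 0 := by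
  obtain ⟨f₁, hf, hf₁, hfx, hf0⟩ := h.exists_deriv_lamePre ha hb hc
  have hσ := h.sq_sign
  have hS := h.hasDerivAt_S
  have hC := h.hasDerivAt_C
  have hD := h.hasDerivAt_D
  have hx : ∀ t, HasDerivAt (fun t => S t ^ 2) (2 * σ * S t * C t * D t) t := fun t =>
    ((hS t).pow 2).congr_deriv (by simp; ring)
  have hP : ∀ Q : ℝ[X], ∀ t, HasDerivAt (fun t => Q.eval (S t ^ 2))
      ((derivative Q).eval (S t ^ 2) * (2 * σ * S t * C t * D t)) t := fun Q t =>
    HasDerivAt.comp (h₂ := fun x => Q.eval x) t (Q.hasDerivAt (S t ^ 2)) (hx t)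
  have hx₁ : ∀ t, HasDerivAt (fun t => 2 * σ * S t * C t * D t) (2 * σ * ((1 - S t ^ 2) *
      (1 - k ^ 2 * S t ^ 2) - S t ^ 2 * (1 - k ^ 2 * S t ^ 2) -
      k ^ 2 * S t ^ 2 * (1 - S t ^ 2))) t := fun t => by
    refine ((((hS t).const_mul (2 * σ)).mul (hC t)).mul (hD t)).congr_deriv ?_
    have := h.sq_C t; have := h.sq_D t
    simp only [Pi.mul_apply]
    grind
  have hsq : ∀ t, (2 * σ * S t * C t * D t) ^ 2 =
      4 * σ * (S t ^ 2 * (1 - S t ^ 2) * (1 - k ^ 2 * S t ^ 2)) := fun t => by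
    have := h.sq_C t; have := h.sq_D t
    grind
  refine ⟨fun t => f₁ t * P.eval (S t ^ 2) + lamePre a b c S C D t *
    ((derivative P).eval (S t ^ 2) * (2 * σ * S t * C t * D t)),
    fun t => (hf t).mul (hP P t), fun t => ?_, fun t ht => ?_⟩
  · refine (((hf₁ t).mul (hP P t)).add
      ((hf t).mul ((hP (derivative P) t).mul (hx₁ t)))).congr_deriv ?_
    have e1 := hfx t
    have e2 := hsq t
    simp only [Pi.mul_apply, lameOp]
    linear_combination 2 * (derivative P).eval (S t ^ 2) * e1 +
      lamePre a b c S C D t * (derivative (derivative P)).eval (S t ^ 2) * e2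
  · have : S t = 0 ∨ C t = 0 ∨ D t = 0 := by tauto
    simp only [hf0 t ht]
    rcases this with h | h | h <;> simp [h]

theorem isJacobiTriple_lower (hk : k ∈ Ioo (0 : ℝ) 1) :
    IsJacobiTriple 1 k (sn k) (cn k) (dn k) where
  sq_sign := by norm_num
  hasDerivAt_S t := by simpa using hasDerivAt_sn hk t
  hasDerivAt_C t := hasDerivAt_cn hk t
  hasDerivAt_D t := by simpa using hasDerivAt_dn hk t
  sq_C t := by rw [cn_sq]; ring
  sq_D t := dn_sq hk t

/-- These are `sn`, `i cn` and `dn` at `K + iK' - is`. Multiplying `cn` by `i` makes all three real,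
at the price of the sign `σ = -1`. -/
theorem isJacobiTriple_upper (hk : k ∈ Ioo (0 : ℝ) 1) :
    IsJacobiTriple (-1) k (fun s => dn (kc k) s / k) (fun s => kc k / k * cn (kc k) s)
      (fun s => kc k * sn (kc k) s) where
  sq_sign := by norm_num
  hasDerivAt_S t := by
    refine ((hasDerivAt_dn (kc_mem hk) t).div_const k).congr_deriv ?_
    have := hk.1.ne'
    field_simp
  hasDerivAt_C t := by
    refine ((hasDerivAt_cn (kc_mem hk) t).const_mul (kc k / k)).congr_deriv ?_
    have := hk.1.ne'
    field_simp
  hasDerivAt_D t := by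
    refine ((hasDerivAt_sn (kc_mem hk) t).const_mul (kc k)).congr_deriv ?_
    have := hk.1.ne'
    field_simp
  sq_C t := by
    have := hk.1.ne'
    rw [mul_pow, div_pow, div_pow, cn_sq, dn_sq (kc_mem hk)]
    field_simp
    have := kc_sq hk
    grind
  sq_D t := by
    have := hk.1.ne'
    rw [mul_pow, div_pow, dn_sq (kc_mem hk)]
    field_simp
    ring

variable {κ : Fin 3 → Fin 2} {P : ℝ[X]}

theorem lameW_eq (hk : k ∈ Ioo (0 : ℝ) 1) (κ : Fin 3 → Fin 2) (P : ℝ[X]) (t : ℝ) :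
    lameW k κ P t = (lameReal (κ 0) (κ 1) (κ 2) P (sn k) (cn k) (dn k) t : ℝ) := by
  have hk' := kc_mem hk
  have h1 : cden k (t : ℂ) = 1 := by simp [cden, cn_zero hk', sn_zero hk']
  have h2 : csn k (t : ℂ) = (sn k t : ℂ) := by
    simp [csn, h1, dn_zero hk', sn_zero hk']
  have h3 : ccn k (t : ℂ) = (cn k t : ℂ) := by
    simp [ccn, h1, cn_zero hk', sn_zero hk']
  have h4 : cdn k (t : ℂ) = (dn k t : ℂ) := by
    simp [cdn, h1, dn_zero hk', sn_zero hk', cn_zero hk']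
  have h5 : aeval ((sn k t : ℂ) ^ 2) P = ((P.eval (sn k t ^ 2) : ℝ) : ℂ) := by
    rw [← Complex.ofReal_pow]
    exact (aeval_algebraMap_apply_eq_algebraMap_eval (A := ℂ) (sn k t ^ 2) P)
  rw [lameW, lameFun, h2, h3, h4, h5, lameReal, lamePre]
  push_cast
  ring

/-- On the line with real part `K` one has `sn = 1` and `cn = 0`, so each complex formula keeps a
single term. The quarter-period formulas of modulus `k'` turn the common denominator into `(k /
dn)²`. -/
theorem lameV_eq (hk : k ∈ Ioo (0 : ℝ) 1) (κ : Fin 3 → Fin 2) (P : ℝ[X]) {s : ℝ}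
    (hs : s ∈ Icc 0 (ellK (kc k))) :
    lameV k κ P s = (-Complex.I) ^ (κ 1 : ℕ) *
      (lameReal (κ 0) (κ 1) (κ 2) P (fun s => dn (kc k) s / k)
      (fun s => kc k / k * cn (kc k) s) (fun s => kc k * sn (kc k) s) s : ℝ) := by
  have hk' := kc_mem hk
  have hk0 : (k : ℂ) ≠ 0 := by exact_mod_cast hk.1.ne'
  have hd := dn_pos hk' s
  have hd0 : (dn (kc k) s : ℂ) ≠ 0 := by exact_mod_cast hd.ne'
  set z : ℂ := (ellK k : ℂ) + Complex.I * (ellK (kc k) : ℂ) - Complex.I * (s : ℂ) with hz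
  have hre : z.re = ellK k := by simp [hz]
  have him : z.im = ellK (kc k) - s := by simp [hz]
  have e1 := sn_ellK_sub hk' hs
  have e2 := cn_ellK_sub hk' hs
  have e3 := dn_ellK_sub hk' hs
  rw [kc_kc hk] at e2 e3
  have h1 : cden k z = (k / dn (kc k) s) ^ 2 := by
    rw [cden, hre, him, sn_ellK hk, ← e3, dn_sq hk', cn_sq, kc_sq hk]; ring
  have h2 : csn k z = ((dn (kc k) s / k : ℝ) : ℂ) := by
    rw [csn, h1, hre, him, sn_ellK hk, cn_ellK hk, e3]
    push_cast
    field_simp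
    simp
  have h3 : ccn k z = -Complex.I * ((kc k / k * cn (kc k) s : ℝ) : ℂ) := by
    rw [ccn, h1, hre, him, sn_ellK hk, cn_ellK hk, dn_ellK hk, e1, e3]
    push_cast
    field_simp
    simp
  have h4 : cdn k z = ((kc k * sn (kc k) s : ℝ) : ℂ) := by
    rw [cdn, h1, hre, him, sn_ellK hk, cn_ellK hk, dn_ellK hk, e2, e3]
    push_cast
    field_simp
    simp
  have h5 : ∀ x : ℝ, aeval ((x : ℂ) ^ 2) P = ((P.eval (x ^ 2) : ℝ) : ℂ) := fun x => by
    rw [← Complex.ofReal_pow]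
    exact (aeval_algebraMap_apply_eq_algebraMap_eval (A := ℂ) (x ^ 2) P)
  rw [lameV, lameFun, h2, h3, h4, h5, lameReal, lamePre]
  push_cast
  ring

end LameEquation


/-! ### Locating the zeros of Lamé polynomials. -/

section LameZeros

variable {k : ℝ} {κ : Fin 3 → Fin 2} {P : ℝ[X]}

theorem image_sn_sq (hk : k ∈ Ioo (0 : ℝ) 1) :
    (fun t => sn k t ^ 2) '' Ioo 0 (ellK k) = Ioo 0 1 := by
  refine Subset.antisymm ?_ ?_
  · rintro _ ⟨t, ht, rfl⟩
    exact ⟨pow_pos (sn_pos hk ht) 2, sn_sq_lt_one hk ht⟩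
  · have := intermediate_value_Ioo (ellK_pos hk).le
      ((continuous_sn hk).pow 2).continuousOn (f := fun t => sn k t ^ 2)
    simpa [sn_zero hk, sn_ellK hk] using this

theorem injOn_sn_sq (hk : k ∈ Ioo (0 : ℝ) 1) :
    InjOn (fun t => sn k t ^ 2) (Ioo 0 (ellK k)) := fun _ hs _ ht h =>
  (strictMonoOn_sn hk).injOn (Ioo_subset_Icc_self hs) (Ioo_subset_Icc_self ht)
    ((pow_left_inj₀ (sn_pos hk hs).le (sn_pos hk ht).le two_ne_zero).1 h)

theorem sq_dn_div (hk : k ∈ Ioo (0 : ℝ) 1) (s : ℝ) :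
    (dn (kc k) s / k) ^ 2 = 1 / k ^ 2 - kc k ^ 2 / k ^ 2 * sn (kc k) s ^ 2 := by
  rw [div_pow, dn_sq (kc_mem hk)]; ring

theorem image_dn_sq (hk : k ∈ Ioo (0 : ℝ) 1) :
    (fun s => (dn (kc k) s / k) ^ 2) '' Ioo 0 (ellK (kc k)) = Ioo 1 (1 / k ^ 2) := by
  have hk' := kc_mem hk
  have hk0 := hk.1
  refine Subset.antisymm ?_ ?_
  · rintro _ ⟨t, ht, rfl⟩
    have h1 := pow_pos (sn_pos hk' ht) 2
    have h2 := sn_sq_lt_one hk' ht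
    have h3 : 0 < kc k ^ 2 / k ^ 2 := by have := hk'.1; positivity
    have h4 : 1 / k ^ 2 - kc k ^ 2 / k ^ 2 = 1 := by rw [kc_sq hk]; field_simp; ring
    simp only [sq_dn_div hk]
    constructor <;> nlinarith
  · have := intermediate_value_Ioo' (ellK_pos hk').le
      (((continuous_dn hk').div_const k).pow 2).continuousOn (f := fun s => (dn (kc k) s / k) ^ 2)
    simpa [dn_zero hk', dn_ellK hk', kc_kc hk, hk0.ne'] using this

theorem injOn_dn_sq (hk : k ∈ Ioo (0 : ℝ) 1) :
    InjOn (fun s => (dn (kc k) s / k) ^ 2) (Ioo 0 (ellK (kc k))) := fun s hs t ht h => by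
  have hk' := kc_mem hk
  have h3 : kc k ^ 2 / k ^ 2 ≠ 0 := by have := hk'.1; have := hk.1; positivity
  simp only [sq_dn_div hk] at h
  exact injOn_sn_sq hk' hs ht (mul_left_cancel₀ h3 (by linarith))

/-- The substitution is a bijection onto `(A, B)`, so zeros of `P ∘ φ` are counted by the roots in
that interval. It serves both for the `n` roots in `(0, 1)` and for the `m` roots in `(1, 1/k²)`. -/
theorem encard_zeros_comp {ι : Type*} [Fintype ι] {L A B : ℝ} {φ : ℝ → ℝ} {x : ι → ℝ}
    (hinj : InjOn φ (Ioo 0 L)) (himg : φ '' Ioo 0 L = Ioo A B) (hx : Function.Injective x)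
    (hxm : ∀ i, x i ∈ Ioo A B) (hP : ∀ z ∈ Ioo A B, P.eval z = 0 ↔ z ∈ range x) :
    {t ∈ Ioo 0 L | P.eval (φ t) = 0}.encard = Fintype.card ι := by
  have h1 : φ '' {t ∈ Ioo 0 L | P.eval (φ t) = 0} = range x := by
    ext z
    constructor
    · rintro ⟨t, ⟨ht, htP⟩, rfl⟩
      exact (hP _ (himg ▸ mem_image_of_mem φ ht)).1 htP
    · intro hz
      obtain ⟨i, rfl⟩ := hz
      obtain ⟨t, ht, hti⟩ : x i ∈ φ '' Ioo 0 L := himg ▸ hxm i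
      exact ⟨t, ⟨ht, by rw [hti]; exact (hP _ (hxm i)).2 ⟨i, rfl⟩⟩, hti⟩
  rw [← (hinj.mono (sep_subset _ _)).encard_image, h1, ← image_univ, hx.injOn.encard_image,
    encard_univ, ENat.card_eq_coe_fintype_card]

theorem lamePre_lower_ne_zero (hk : k ∈ Ioo (0 : ℝ) 1) (a b c : ℕ) {t : ℝ}
    (ht : t ∈ Ioo 0 (ellK k)) : lamePre a b c (sn k) (cn k) (dn k) t ≠ 0 := by
  have := sn_pos hk ht
  have := cn_pos hk ht
  have := dn_pos hk t
  unfold lamePre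
  positivity

theorem lamePre_upper_ne_zero (hk : k ∈ Ioo (0 : ℝ) 1) (a b c : ℕ) {s : ℝ}
    (hs : s ∈ Ioo 0 (ellK (kc k))) : lamePre a b c (fun s => dn (kc k) s / k)
      (fun s => kc k / k * cn (kc k) s) (fun s => kc k * sn (kc k) s) s ≠ 0 := by
  have hk' := kc_mem hk
  have := sn_pos hk' hs
  have := cn_pos hk' hs
  have := dn_pos hk' s
  have := hk.1
  have := hk'.1
  unfold lamePre
  positivity

/-- Stieltjes' polynomial in the normalization of Lamé's equation. -/
theorem exists_lame_polynomial (hk : k ∈ Ioo (0 : ℝ) 1) (m n : ℕ) (κ : Fin 3 → Fin 2) :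
    ∃ (P : ℝ[X]) (h : ℝ), P.degree = ((m + n : ℕ) : WithBot ℕ) ∧
      (∀ x, lameOp k (κ 0) (κ 1) (κ 2) P x = (sphereLam m n κ * k ^ 2 * x - h) * P.eval x) ∧
      {t ∈ Ioo 0 (ellK k) | lameReal (κ 0) (κ 1) (κ 2) P (sn k) (cn k) (dn k) t = 0}.encard = n ∧
      {s ∈ Ioo 0 (ellK (kc k)) | lameReal (κ 0) (κ 1) (κ 2) P (fun s => dn (kc k) s / k)
        (fun s => kc k / k * cn (kc k) s) (fun s => kc k * sn (kc k) s) s = 0}.encard = m := by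
  have hk0 := hk.1
  have he : 1 < 1 / k ^ 2 := by
    rw [lt_div_iff₀ (by positivity)]; nlinarith [hk.2]
  -- In the variable `x = sn²` the singular points are `0`, `1`, `1/k²`, and the prefactor with
  -- parities `κ` produces the charges `1 + 2κ`, which are never zero.
  obtain ⟨x, s, hinj, hl, hr, hode⟩ := exists_stieltjes_polynomial he
    (a := 1 + 2 * (κ 0 : ℕ)) (b := 1 + 2 * (κ 1 : ℕ)) (c := 1 + 2 * (κ 2 : ℕ))
    (by lia) (by lia) (by lia) n m
  set P : ℝ[X] := ∏ i, (X - C (x i)) with hP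
  have hzero : ∀ z, P.eval z = 0 ↔ ∃ i, x i = z := fun z => by
    rw [hP, eval_prod, Finset.prod_eq_zero_iff]
    simp only [Finset.mem_univ, true_and, eval_sub, eval_X, eval_C, sub_eq_zero, eq_comm]
  refine ⟨P, ((κ 0 : ℕ) + (κ 1 : ℕ)) ^ 2 + k ^ 2 * ((κ 0 : ℕ) + (κ 2 : ℕ)) ^ 2 - 2 * k ^ 2 * s,
    ?_, fun z => ?_, ?_, ?_⟩
  · rw [hP, degree_prod_of_monic _ _ fun i _ => monic_X_sub_C _]
    simp [add_comm]
  · have h1 := hode P rfl z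
    have e1 : lameOp k (κ 0) (κ 1) (κ 2) P z = 2 * k ^ 2 *
        (2 * (z * (z - 1) * (z - 1 / k ^ 2)) * (derivative (derivative P)).eval z +
        ((1 + 2 * (κ 0 : ℕ) : ℕ) * ((z - 1) * (z - 1 / k ^ 2)) +
          (1 + 2 * (κ 1 : ℕ) : ℕ) * (z * (z - 1 / k ^ 2)) +
          (1 + 2 * (κ 2 : ℕ) : ℕ) * (z * (z - 1))) * (derivative P).eval z) +
        (((κ 0 : ℕ) + (κ 1 : ℕ) + (κ 2 : ℕ)) * ((κ 0 : ℕ) + (κ 1 : ℕ) + (κ 2 : ℕ) + 1) * k ^ 2 * z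
          - (((κ 0 : ℕ) + (κ 1 : ℕ)) ^ 2 + k ^ 2 * ((κ 0 : ℕ) + (κ 2 : ℕ)) ^ 2)) * P.eval z := by
      unfold lameOp
      push_cast
      field_simp
      ring
    -- With `N = m + n` the coefficients of `k² z` add up to `2N (2N + 1 + 2|κ|) + |κ| (|κ| + 1)`,
    -- which is `ℓ (ℓ + 1)` for `ℓ = 2N + |κ|`.
    rw [e1, h1, sphereLam, ell, Fin.sum_univ_three]
    push_cast
    ring
  · have h1 : {t ∈ Ioo 0 (ellK k) | lameReal (κ 0) (κ 1) (κ 2) P (sn k) (cn k) (dn k) t = 0} =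
        {t ∈ Ioo 0 (ellK k) | P.eval (sn k t ^ 2) = 0} := by
      ext t
      refine and_congr_right fun ht => ?_
      rw [lameReal, mul_eq_zero, or_iff_right (lamePre_lower_ne_zero hk _ _ _ ht)]
    rw [h1, encard_zeros_comp (φ := fun t => sn k t ^ 2) (injOn_sn_sq hk) (image_sn_sq hk)
      (hinj.comp Sum.inl_injective) hl, Fintype.card_fin]
    intro z hz
    rw [hzero]
    constructor
    · rintro ⟨i | i, hi⟩
      · exact ⟨i, hi⟩
      · exact absurd (hi ▸ (hr i).1) (not_lt.2 hz.2.le)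
    · rintro ⟨i, hi⟩
      exact ⟨_, hi⟩
  · have h1 : {s ∈ Ioo 0 (ellK (kc k)) | lameReal (κ 0) (κ 1) (κ 2) P (fun s => dn (kc k) s / k)
        (fun s => kc k / k * cn (kc k) s) (fun s => kc k * sn (kc k) s) s = 0} =
        {s ∈ Ioo 0 (ellK (kc k)) | P.eval ((dn (kc k) s / k) ^ 2) = 0} := by
      ext t
      refine and_congr_right fun ht => ?_
      rw [lameReal, mul_eq_zero, or_iff_right (lamePre_upper_ne_zero hk _ _ _ ht)]
    rw [h1, encard_zeros_comp (φ := fun s => (dn (kc k) s / k) ^ 2) (injOn_dn_sq hk)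
      (image_dn_sq hk) (hinj.comp Sum.inr_injective) hr, Fintype.card_fin]
    intro z hz
    rw [hzero]
    constructor
    · rintro ⟨i | i, hi⟩
      · exact absurd (hi ▸ (hl i).2) (not_lt.2 hz.1.le)
      · exact ⟨i, hi⟩
    · rintro ⟨i, hi⟩
      exact ⟨_, hi⟩

/-- One algebraic equation yields both Sturm–Liouville problems at `ε = 0`: only the sign `σ` and
the triple change, while `Λ` and `h` are shared. -/
theorem IsJacobiTriple.exists_isSLSolution {σ Λ h L : ℝ} {S C D r : ℝ → ℝ}
    (hT : IsJacobiTriple σ k S C D) {a b c : ℕ} (ha : a ≤ 1) (hb : b ≤ 1) (hc : c ≤ 1)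
    (hode : ∀ x, lameOp k a b c P x = (Λ * k ^ 2 * x - h) * P.eval x)
    (hr : ∀ t, r t = -(σ * (Λ * k ^ 2 * S t ^ 2 - h))) : ∃ w₁ : ℝ → ℝ,
      IsSLSolution L (fun _ => 1) r (lameReal a b c P S C D) w₁ ∧
      (∀ t, HasDerivAt (lameReal a b c P S C D) (w₁ t) t) ∧
      (∀ t, HasDerivAt w₁ (-(r t * lameReal a b c P S C D t)) t) ∧
      ∀ t, (a = 0 ∧ S t = 0 ∨ b = 0 ∧ C t = 0 ∨ c = 0 ∧ D t = 0) → w₁ t = 0 := by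
  obtain ⟨w₁, h1, h2, h3⟩ := hT.exists_deriv_lameReal ha hb hc P
  have h4 : ∀ t, HasDerivAt w₁ (-(r t * lameReal a b c P S C D t)) t := fun t =>
    (h2 t).congr_deriv (by rw [hode, hr, lameReal]; ring)
  refine ⟨w₁, ⟨fun x _ => (h1 x).hasDerivWithinAt, fun x _ => ?_⟩, h1, h4, h3⟩
  simpa using (h4 x).hasDerivWithinAt

theorem exists_ne_zero_of_encard {L : ℝ} (hL : 0 < L) {y : ℝ → ℝ} {n : ℕ}
    (hn : {x ∈ Ioo 0 L | y x = 0}.encard = n) : ∃ x ∈ Ioo 0 L, y x ≠ 0 := by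
  by_contra hcon
  push Not at hcon
  have : {t ∈ Ioo 0 L | y t = 0} = Ioo 0 L := by
    ext t; exact ⟨fun h => h.1, fun h => ⟨h, hcon t h⟩⟩
  rw [this, (Ioo_infinite hL).encard_eq] at hn
  simp at hn

/-- A trigonometric Lamé equation on `(0, K)` implies its algebraic form. -/
theorem lameOp_eq_of_forall_mem_Ioo (hk : k ∈ Ioo (0 : ℝ) 1) {a b c : ℕ} {Λ h : ℝ}
    (hode : ∀ t ∈ Ioo 0 (ellK k),
      lameOp k a b c P (sn k t ^ 2) = (Λ * k ^ 2 * sn k t ^ 2 - h) * P.eval (sn k t ^ 2)) (x : ℝ) :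
    lameOp k a b c P x = (Λ * k ^ 2 * x - h) * P.eval x := by
  set Q : ℝ[X] := 4 * (X * (1 - X) * (1 - C (k ^ 2) * X)) * derivative (derivative P) +
    2 * ((1 + 2 * (a : ℝ[X])) * ((1 - X) * (1 - C (k ^ 2) * X)) -
      (1 + 2 * (b : ℝ[X])) * (X * (1 - C (k ^ 2) * X)) -
      (1 + 2 * (c : ℝ[X])) * (C (k ^ 2) * X * (1 - X))) * derivative P +
    (C ((a + b + c) * (a + b + c + 1) * k ^ 2) * X - C ((a + b) ^ 2 + k ^ 2 * (a + c) ^ 2)) * P -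
    (C (Λ * k ^ 2) * X - C h) * P with hQ
  have hev : ∀ x, Q.eval x = lameOp k a b c P x - (Λ * k ^ 2 * x - h) * P.eval x := fun x => by
    simp only [hQ, lameOp, eval_add, eval_sub, eval_mul, eval_X, eval_C, eval_one, eval_natCast,
      eval_ofNat]
  -- The polynomial `Q` vanishes at all values of `sn²` on the open interval, an infinite set.
  have h0 : Q = 0 := by
    refine eq_zero_of_infinite_isRoot _ (((Ioo_infinite (ellK_pos hk)).image
      (injOn_sn_sq hk)).mono ?_)
    rintro _ ⟨t, ht, rfl⟩
    simp only [mem_ofPred_eq, IsRoot, hev, hode t ht, sub_self]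
  have := hev x
  rw [h0, eval_zero] at this
  linarith

end LameZeros


/-! ### Uniqueness and local description of the eigencurves. -/

section Eigencurves

variable {k : ℝ} {κ : Fin 3 → Fin 2}

/-- Brings the weight to the perturbative form `p² = 1 + ε g` with `g = k² cn²`. For the other
problem `g = -k'² cn²`. -/
theorem qFun_eq (hk : k ∈ Ioo (0 : ℝ) 1) {ε : ℝ} (hε : |ε| < 1) :
    qFun k (axisA k ε) 1 = fun t => √(1 + ε * (k ^ 2 * cn k t ^ 2)) := by
  funext t
  have h1 : 0 ≤ 1 + k ^ 2 * ε := by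
    rw [mul_comm]
    exact (one_add_mul_pos hε (by rw [abs_of_nonneg (sq_nonneg k)]; nlinarith [hk.1, hk.2])).le
  rw [qFun, axisA, Real.sq_sqrt h1]
  congr 1
  linear_combination cn_sq k t

theorem pFun_eq (hk : k ∈ Ioo (0 : ℝ) 1) {ε : ℝ} (hε : |ε| < 1) :
    pFun k 1 (axisC k ε) = fun s => √(1 + ε * (-kc k ^ 2 * cn (kc k) s ^ 2)) := by
  funext t
  have hk' := kc_mem hk
  have h1 : 0 ≤ 1 - kc k ^ 2 * ε := by
    have := one_add_mul_pos (g := -(kc k ^ 2)) hε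
      (by rw [abs_neg, abs_of_nonneg (sq_nonneg _)]; nlinarith [hk'.1, hk'.2])
    linarith
  rw [pFun, axisC, Real.sq_sqrt h1]
  congr 1
  linear_combination cn_sq (kc k) t

theorem abs_sq_mul_cn_sq_le (hk : k ∈ Ioo (0 : ℝ) 1) (t : ℝ) : |k ^ 2 * cn k t ^ 2| ≤ 1 := by
  rw [abs_of_nonneg (by positivity)]
  have := cn_sq_le_one k t
  have : k ^ 2 ≤ 1 := by nlinarith [hk.1, hk.2]
  nlinarith [sq_nonneg k, sq_nonneg (cn k t)]

theorem qFun_pos (hk : k ∈ Ioo (0 : ℝ) 1) {ε : ℝ} (hε : |ε| < 1) (t : ℝ) :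
    0 < qFun k (axisA k ε) 1 t := by
  rw [qFun_eq hk hε]
  exact Real.sqrt_pos.2 (one_add_mul_pos hε (abs_sq_mul_cn_sq_le hk t))

theorem pFun_pos (hk : k ∈ Ioo (0 : ℝ) 1) {ε : ℝ} (hε : |ε| < 1) (s : ℝ) :
    0 < pFun k 1 (axisC k ε) s := by
  rw [pFun_eq hk hε]
  refine Real.sqrt_pos.2 (one_add_mul_pos hε ?_)
  rw [neg_mul, abs_neg]
  exact abs_sq_mul_cn_sq_le (kc_mem hk) s

theorem continuous_qFun (hk : k ∈ Ioo (0 : ℝ) 1) (a b : ℝ) : Continuous (qFun k a b) := by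
  have := continuous_cn hk
  have := continuous_sn hk
  unfold qFun
  fun_prop

theorem continuous_pFun (hk : k ∈ Ioo (0 : ℝ) 1) (b c : ℝ) : Continuous (pFun k b c) := by
  have := continuous_cn (kc_mem hk)
  have := continuous_sn (kc_mem hk)
  unfold pFun
  fun_prop

theorem continuous_upper_potential (hk : k ∈ Ioo (0 : ℝ) 1) (H l : ℝ) :
    Continuous fun s => -H + l * dn (kc k) s ^ 2 := by
  have := continuous_dn (kc_mem hk)
  fun_prop

theorem continuous_lower_potential (hk : k ∈ Ioo (0 : ℝ) 1) (h l : ℝ) :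
    Continuous fun t => h - l * k ^ 2 * sn k t ^ 2 := by
  have := continuous_sn hk
  fun_prop

theorem IsUpperEigenvalue.not_of_lt (hk : k ∈ Ioo (0 : ℝ) 1) {m : ℕ} {ε l₁ l₂ H₁ H₂ : ℝ}
    (hε : |ε| < 1) (h₁ : IsUpperEigenvalue k κ m l₁ ε H₁) (h₂ : IsUpperEigenvalue k κ m l₂ ε H₂)
    (hlt : ∀ s ∈ Ioo 0 (ellK (kc k)), -H₁ + l₁ * dn (kc k) s ^ 2 < -H₂ + l₂ * dn (kc k) s ^ 2) :
    False := by
  have hL := ellK_pos (kc_mem hk)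
  refine HasSLEigenfunction.not_of_lt h₁ h₂ hL (pFun_pos hk hε)
    (continuous_pFun hk _ _) (continuous_upper_potential hk _ _)
    (continuous_upper_potential hk _ _) (fun x hx => ?_) hlt
  rw [← closure_Ioo hL.ne] at hx
  exact le_on_closure (fun s hs => (hlt s hs).le)
    (continuous_upper_potential hk _ _).continuousOn
    (continuous_upper_potential hk _ _).continuousOn hx

theorem IsLowerEigenvalue.not_of_lt (hk : k ∈ Ioo (0 : ℝ) 1) {n : ℕ} {ε l₁ l₂ h₁ h₂ : ℝ}
    (hε : |ε| < 1) (H₁ : IsLowerEigenvalue k κ n l₁ ε h₁) (H₂ : IsLowerEigenvalue k κ n l₂ ε h₂)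
    (hlt : ∀ t ∈ Ioo 0 (ellK k),
      h₁ - l₁ * k ^ 2 * sn k t ^ 2 < h₂ - l₂ * k ^ 2 * sn k t ^ 2) : False := by
  have hL := ellK_pos hk
  refine HasSLEigenfunction.not_of_lt H₁ H₂ hL (qFun_pos hk hε)
    (continuous_qFun hk _ _) (continuous_lower_potential hk _ _)
    (continuous_lower_potential hk _ _) (fun x hx => ?_) hlt
  rw [← closure_Ioo hL.ne] at hx
  exact le_on_closure (fun s hs => (hlt s hs).le)
    (continuous_lower_potential hk _ _).continuousOn
    (continuous_lower_potential hk _ _).continuousOn hx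

theorem IsUpperEigenvalue.unique (hk : k ∈ Ioo (0 : ℝ) 1) {m : ℕ} {ε l H₁ H₂ : ℝ}
    (hε : |ε| < 1) (h₁ : IsUpperEigenvalue k κ m l ε H₁) (h₂ : IsUpperEigenvalue k κ m l ε H₂) :
    H₁ = H₂ := by
  rcases lt_trichotomy H₁ H₂ with h | h | h
  · exact (h₂.not_of_lt hk hε h₁ fun s _ => by linarith).elim
  · exact h
  · exact (h₁.not_of_lt hk hε h₂ fun s _ => by linarith).elim

theorem IsLowerEigenvalue.unique (hk : k ∈ Ioo (0 : ℝ) 1) {n : ℕ} {ε l h₁ h₂ : ℝ}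
    (hε : |ε| < 1) (H₁ : IsLowerEigenvalue k κ n l ε h₁) (H₂ : IsLowerEigenvalue k κ n l ε h₂) :
    h₁ = h₂ := by
  rcases lt_trichotomy h₁ h₂ with h | h | h
  · exact (H₁.not_of_lt hk hε H₂ fun s _ => by linarith).elim
  · exact h
  · exact (H₂.not_of_lt hk hε H₁ fun s _ => by linarith).elim

/-- Together with `sn² < 1` this makes `k²` the slope that separates upper from lower eigencurves.
-/
theorem sq_lt_dn_sq (hk : k ∈ Ioo (0 : ℝ) 1) {s : ℝ} (hs : s ∈ Ioo 0 (ellK (kc k))) :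
    k ^ 2 < dn (kc k) s ^ 2 := by
  have hk' := kc_mem hk
  have h1 := sn_sq_lt_one hk' hs
  have h2 := kc_sq hk
  have h3 : 0 < kc k ^ 2 := pow_pos hk'.1 2
  rw [dn_sq hk']
  nlinarith

/-- The eigencurves meet at most once: secants of the upper curves have slope greater than `k²`,
secants of the lower curves have slope less than `k²`. -/
theorem IsIntersection.unique (hk : k ∈ Ioo (0 : ℝ) 1) {m n : ℕ} {ε l₁ l₂ : ℝ} (hε : |ε| < 1)
    (H₁ : IsIntersection k κ m n ε l₁) (H₂ : IsIntersection k κ m n ε l₂) : l₁ = l₂ := by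
  have key : ∀ {l₁ l₂ : ℝ}, IsIntersection k κ m n ε l₁ → IsIntersection k κ m n ε l₂ →
      ¬ l₁ < l₂ := by
    rintro l₁ l₂ ⟨h₁, u₁, d₁⟩ ⟨h₂, u₂, d₂⟩ hlt
    -- If the secant slope between two common points is at most `k²`, the upper potentials are
    -- strictly ordered; if it exceeds `k²`, the lower ones are. Either way Sturm comparison gives a
    -- contradiction.
    rcases le_or_gt (h₂ - h₁) (k ^ 2 * (l₂ - l₁)) with h | h
    · refine u₁.not_of_lt hk hε u₂ fun s hs => ?_
      have := sq_lt_dn_sq hk hs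
      nlinarith
    · refine d₁.not_of_lt hk hε d₂ fun t ht => ?_
      have := sn_sq_lt_one hk ht
      have : 0 < k ^ 2 := pow_pos hk.1 2
      have : k ^ 2 * (l₂ - l₁) * sn k t ^ 2 ≤ k ^ 2 * (l₂ - l₁) * 1 := by
        have : 0 ≤ k ^ 2 * (l₂ - l₁) := by nlinarith
        nlinarith
      linarith
  rcases lt_trichotomy l₁ l₂ with h | h | h
  · exact (key H₁ H₂ h).elim
  · exact h
  · exact (key H₂ H₁ h).elim

/-- The function is defined by choice; uniqueness for `|ε| < 1` identifies it with any eigenvalue at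
hand, in particular with the analytic branch. -/
theorem upperH_eq (hk : k ∈ Ioo (0 : ℝ) 1) {m : ℕ} {ε l H : ℝ} (hε : |ε| < 1)
    (h : IsUpperEigenvalue k κ m l ε H) : upperH k κ m l ε = H :=
  (Classical.epsilon_spec (p := IsUpperEigenvalue k κ m l ε) ⟨H, h⟩).unique hk hε h

theorem lowerH_eq (hk : k ∈ Ioo (0 : ℝ) 1) {n : ℕ} {ε l h : ℝ} (hε : |ε| < 1)
    (H : IsLowerEigenvalue k κ n l ε h) : lowerH k κ n l ε = h :=
  (Classical.epsilon_spec (p := IsLowerEigenvalue k κ n l ε) ⟨h, H⟩).unique hk hε H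

theorem eigenLam_eq (hk : k ∈ Ioo (0 : ℝ) 1) {m n : ℕ} {ε l : ℝ} (hε : |ε| < 1)
    (h : IsIntersection k κ m n ε l) : eigenLam k κ m n ε = l :=
  (Classical.epsilon_spec (p := IsIntersection k κ m n ε) ⟨l, h⟩).unique hk hε h

theorem eventually_abs_snd_lt (l : ℝ) : ∀ᶠ x : ℝ × ℝ in 𝓝 (l, 0), |x.2| < 1 := by
  have : ContinuousAt (fun x : ℝ × ℝ => |x.2|) (l, 0) := by fun_prop
  exact this.eventually_lt continuousAt_const (by simp)

/-- Local description of the upper eigencurve through an eigenfunction at `ε = 0`. -/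
theorem upper_summary (hk : k ∈ Ioo (0 : ℝ) 1) {m : ℕ} {Λ H : ℝ} {v v₁ : ℝ → ℝ}
    (hs : IsSLSolution (ellK (kc k)) (fun _ => 1) (fun s => -H + Λ * dn (kc k) s ^ 2) v v₁)
    (hb₀ : BdryCond (κ 2) v v₁ 0) (hbL : BdryCond (κ 1) v v₁ (ellK (kc k)))
    (hm : {s ∈ Ioo 0 (ellK (kc k)) | v s = 0}.encard = m) :
    (∀ᶠ x : ℝ × ℝ in 𝓝 (Λ, 0), IsUpperEigenvalue k κ m x.1 x.2 (upperH k κ m x.1 x.2)) ∧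
    upperH k κ m Λ 0 = H ∧
    AnalyticAt ℝ (fun x : ℝ × ℝ => upperH k κ m x.1 x.2) (Λ, 0) ∧
    0 < ∫ s in (0 : ℝ)..ellK (kc k), v s ^ 2 ∧
    deriv (fun l => upperH k κ m l 0) Λ * (∫ s in (0 : ℝ)..ellK (kc k), v s ^ 2) =
      ∫ s in (0 : ℝ)..ellK (kc k), dn (kc k) s ^ 2 * v s ^ 2 ∧
    deriv (fun ε => upperH k κ m Λ ε) 0 * (∫ s in (0 : ℝ)..ellK (kc k), v s ^ 2) =
      kc k ^ 2 * (-(1 / 2) * ∫ s in (0 : ℝ)..ellK (kc k), cn (kc k) s ^ 2 *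
        (v₁ s ^ 2 + (-H + Λ * dn (kc k) s ^ 2) * v s ^ 2)) := by
  have hk' := kc_mem hk
  have hL := ellK_pos hk'
  have hcn := continuous_cn hk'
  have hsn := continuous_sn hk'
  have hdn := continuous_dn hk'
  obtain ⟨a, ha, hva⟩ := exists_ne_zero_of_encard hL hm
  -- The general family is used with `μ = -H` and `ρ = -dn²`, so the branch `M` is minus the upper
  -- eigenvalue and signs flip in the derivatives.
  have hr : (fun s => -H + Λ * dn (kc k) s ^ 2) = fun s => -H - Λ * (-dn (kc k) s ^ 2) := by
    funext s; ring
  rw [hr] at hs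
  obtain ⟨M, hMa, hM0, hMev, hN, hl, hε⟩ := exists_analytic_eigenvalue hL
    (g := fun s => -kc k ^ 2 * cn (kc k) s ^ 2)
    (g₁ := fun s => -kc k ^ 2 * (2 * cn (kc k) s * (-(sn (kc k) s * dn (kc k) s))))
    (ρ := fun s => -dn (kc k) s ^ 2)
    (fun s => (((hasDerivAt_cn hk' s).pow 2).const_mul (-kc k ^ 2)).congr_deriv (by simp))
    (by fun_prop) (fun s => by rw [neg_mul, abs_neg]; exact abs_sq_mul_cn_sq_le hk' s)
    (by fun_prop) hs ⟨a, Ioo_subset_Icc_self ha, hva⟩ hb₀ hbL hm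
  have hev : ∀ᶠ x : ℝ × ℝ in 𝓝 (Λ, 0), IsUpperEigenvalue k κ m x.1 x.2 (-M x) := by
    filter_upwards [hMev, eventually_abs_snd_lt Λ] with x hx hxε
    rw [IsUpperEigenvalue, pFun_eq hk hxε]
    convert hx using 1
    funext s; ring
  have heq : (fun x : ℝ × ℝ => upperH k κ m x.1 x.2) =ᶠ[𝓝 (Λ, 0)] fun x => -M x := by
    filter_upwards [hev, eventually_abs_snd_lt Λ] with x hx hxε using upperH_eq hk hxε hx
  have c1 : ContinuousAt (fun l : ℝ => (l, (0 : ℝ))) Λ := by fun_prop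
  have c2 : ContinuousAt (fun ε : ℝ => (Λ, ε)) 0 := by fun_prop
  have d1 : deriv (fun l => upperH k κ m l 0) Λ = -deriv (fun l => M (l, 0)) Λ := by
    rw [← deriv.fun_neg]; exact Filter.EventuallyEq.deriv_eq (c1.eventually heq)
  have d2 : deriv (fun ε => upperH k κ m Λ ε) 0 = -deriv (fun ε => M (Λ, ε)) 0 := by
    rw [← deriv.fun_neg]; exact Filter.EventuallyEq.deriv_eq (c2.eventually heq)
  refine ⟨?_, ?_, hMa.neg.congr heq.symm, hN, ?_, ?_⟩
  · filter_upwards [hev, heq] with x hx hx'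
    rw [hx']; exact hx
  · have h' : upperH k κ m Λ 0 = -M (Λ, 0) := heq.self_of_nhds
    rw [h', hM0, neg_neg]
  · rw [d1, neg_mul, hl, ← intervalIntegral.integral_neg]
    congr 1; funext s; ring
  · rw [d2, neg_mul, hε, ← neg_mul, ← intervalIntegral.integral_const_mul,
      ← intervalIntegral.integral_const_mul, ← intervalIntegral.integral_const_mul]
    congr 1; funext s; ring

/-- Local description of the lower eigencurve through an eigenfunction at `ε = 0`. -/
theorem lower_summary (hk : k ∈ Ioo (0 : ℝ) 1) {n : ℕ} {Λ h : ℝ} {w w₁ : ℝ → ℝ}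
    (hs : IsSLSolution (ellK k) (fun _ => 1) (fun t => h - Λ * k ^ 2 * sn k t ^ 2) w w₁)
    (hb₀ : BdryCond (κ 0) w w₁ 0) (hbL : BdryCond (κ 1) w w₁ (ellK k))
    (hn : {t ∈ Ioo 0 (ellK k) | w t = 0}.encard = n) :
    (∀ᶠ x : ℝ × ℝ in 𝓝 (Λ, 0), IsLowerEigenvalue k κ n x.1 x.2 (lowerH k κ n x.1 x.2)) ∧
    lowerH k κ n Λ 0 = h ∧
    AnalyticAt ℝ (fun x : ℝ × ℝ => lowerH k κ n x.1 x.2) (Λ, 0) ∧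
    0 < ∫ t in (0 : ℝ)..ellK k, w t ^ 2 ∧
    deriv (fun l => lowerH k κ n l 0) Λ * (∫ t in (0 : ℝ)..ellK k, w t ^ 2) =
      k ^ 2 * ∫ t in (0 : ℝ)..ellK k, sn k t ^ 2 * w t ^ 2 ∧
    deriv (fun ε => lowerH k κ n Λ ε) 0 * (∫ t in (0 : ℝ)..ellK k, w t ^ 2) =
      k ^ 2 * (-(1 / 2) * ∫ t in (0 : ℝ)..ellK k, cn k t ^ 2 *
        (w₁ t ^ 2 + (h - Λ * k ^ 2 * sn k t ^ 2) * w t ^ 2)) := by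
  have hL := ellK_pos hk
  have hcn := continuous_cn hk
  have hsn := continuous_sn hk
  have hdn := continuous_dn hk
  obtain ⟨a, ha, hva⟩ := exists_ne_zero_of_encard hL hn
  have hr : (fun t => h - Λ * k ^ 2 * sn k t ^ 2) = fun t => h - Λ * (k ^ 2 * sn k t ^ 2) := by
    funext s; ring
  rw [hr] at hs
  obtain ⟨M, hMa, hM0, hMev, hN, hl, hε⟩ := exists_analytic_eigenvalue hL
    (g := fun s => k ^ 2 * cn k s ^ 2)
    (g₁ := fun s => k ^ 2 * (2 * cn k s * (-(sn k s * dn k s))))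
    (ρ := fun s => k ^ 2 * sn k s ^ 2)
    (fun s => (((hasDerivAt_cn hk s).pow 2).const_mul (k ^ 2)).congr_deriv (by simp))
    (by fun_prop) (abs_sq_mul_cn_sq_le hk)
    (by fun_prop) hs ⟨a, Ioo_subset_Icc_self ha, hva⟩ hb₀ hbL hn
  have hev : ∀ᶠ x : ℝ × ℝ in 𝓝 (Λ, 0), IsLowerEigenvalue k κ n x.1 x.2 (M x) := by
    filter_upwards [hMev, eventually_abs_snd_lt Λ] with x hx hxε
    rw [IsLowerEigenvalue, qFun_eq hk hxε]
    convert hx using 1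
    funext s; ring
  have heq : (fun x : ℝ × ℝ => lowerH k κ n x.1 x.2) =ᶠ[𝓝 (Λ, 0)] M := by
    filter_upwards [hev, eventually_abs_snd_lt Λ] with x hx hxε using lowerH_eq hk hxε hx
  have c1 : ContinuousAt (fun l : ℝ => (l, (0 : ℝ))) Λ := by fun_prop
  have c2 : ContinuousAt (fun ε : ℝ => (Λ, ε)) 0 := by fun_prop
  have d1 : deriv (fun l => lowerH k κ n l 0) Λ = deriv (fun l => M (l, 0)) Λ :=
    Filter.EventuallyEq.deriv_eq (c1.eventually heq)
  have d2 : deriv (fun ε => lowerH k κ n Λ ε) 0 = deriv (fun ε => M (Λ, ε)) 0 :=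
    Filter.EventuallyEq.deriv_eq (c2.eventually heq)
  refine ⟨?_, ?_, hMa.congr heq.symm, hN, ?_, ?_⟩
  · filter_upwards [hev, heq] with x hx hx'
    rw [hx']; exact hx
  · have h' : lowerH k κ n Λ 0 = M (Λ, 0) := heq.self_of_nhds
    rw [h', hM0]
  · rw [d1, hl, ← intervalIntegral.integral_const_mul]
    congr 1; funext s; ring
  · rw [d2, hε, ← intervalIntegral.integral_const_mul,
      ← intervalIntegral.integral_const_mul, ← intervalIntegral.integral_const_mul]
    congr 1; funext s; ring

/-- Integration by parts for the derivative with respect to `ε`. -/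
theorem integral_mul_deriv_mul {L : ℝ} {c c₁ w w₁ w₂ : ℝ → ℝ} (hc : ∀ t, HasDerivAt c (c₁ t) t)
    (hw : ∀ t, HasDerivAt w (w₁ t) t) (hw₁ : ∀ t, HasDerivAt w₁ (w₂ t) t) (hc₁ : Continuous c₁)
    (hw₂ : Continuous w₂) (h0 : w 0 * w₁ 0 = 0) (hL : w L * w₁ L = 0) :
    -(1 / 2) * ∫ t in (0 : ℝ)..L, c t ^ 2 * (w₁ t ^ 2 - w₂ t * w t) =
      ∫ t in (0 : ℝ)..L, c t * w t * (c₁ t * w₁ t + c t * w₂ t) := by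
  have cc : Continuous c := continuous_iff_continuousAt.2 fun t => (hc t).continuousAt
  have cw : Continuous w := continuous_iff_continuousAt.2 fun t => (hw t).continuousAt
  have cw₁ : Continuous w₁ := continuous_iff_continuousAt.2 fun t => (hw₁ t).continuousAt
  -- The two integrands differ by the derivative of `c² w w₁ / 2`, which vanishes at both ends by
  -- the boundary conditions.
  have h := intervalIntegral.integral_eq_sub_of_hasDerivAt (a := 0) (b := L)
    (f := fun t => (1 / 2) * (c t ^ 2 * (w t * w₁ t)))
    (f' := fun t => c t * w t * (c₁ t * w₁ t + c t * w₂ t) -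
      -(1 / 2) * (c t ^ 2 * (w₁ t ^ 2 - w₂ t * w t)))
    (fun t _ => ((((hc t).pow 2).mul ((hw t).mul (hw₁ t))).const_mul (1 / 2)).congr_deriv (by
      simp; ring))
    (Continuous.intervalIntegrable (by fun_prop) _ _)
  rw [intervalIntegral.integral_sub (Continuous.intervalIntegrable (by fun_prop) _ _)
    (Continuous.intervalIntegrable (by fun_prop) _ _), intervalIntegral.integral_const_mul,
    h0, hL] at h
  linarith

end Eigencurves


/-! ### Lamé polynomials as eigenfunctions of both problems. -/

section LamePolynomials

variable {k : ℝ} {κ : Fin 3 → Fin 2} {P : ℝ[X]}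

/-- The restriction of `sn^{κ₁} cn^{κ₂} dn^{κ₃} P(sn²)` to the real axis. -/
noncomputable def lowerLame (k : ℝ) (κ : Fin 3 → Fin 2) (P : ℝ[X]) : ℝ → ℝ :=
  lameReal (κ 0) (κ 1) (κ 2) P (sn k) (cn k) (dn k)

/-- The restriction of `sn^{κ₁} cn^{κ₂} dn^{κ₃} P(sn²)` to the segment from `K + i K'` to `K`,
up to the factor `(-i)^{κ₂}`. -/
noncomputable def upperLame (k : ℝ) (κ : Fin 3 → Fin 2) (P : ℝ[X]) : ℝ → ℝ :=
  lameReal (κ 0) (κ 1) (κ 2) P (fun s => dn (kc k) s / k)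
    (fun s => kc k / k * cn (kc k) s) (fun s => kc k * sn (kc k) s)

theorem BdryCond.mul_eq_zero {j : Fin 2} {y y₁ : ℝ → ℝ} {x : ℝ} (h : BdryCond j y y₁ x) :
    y x * y₁ x = 0 := by
  unfold BdryCond at h
  split_ifs at h <;> simp [h]

theorem bdryCond_of {j : Fin 2} {y y₁ : ℝ → ℝ} {x : ℝ} (h0 : (j : ℕ) = 0 → y₁ x = 0)
    (h1 : (j : ℕ) ≠ 0 → y x = 0) : BdryCond j y y₁ x := by
  unfold BdryCond
  split_ifs with h
  · exact h0 (by simp [h])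
  · exact h1 fun h' => h (Fin.ext h')

theorem exists_lowerLame_deriv (hk : k ∈ Ioo (0 : ℝ) 1) {Λ h : ℝ}
    (hode : ∀ x, lameOp k (κ 0) (κ 1) (κ 2) P x = (Λ * k ^ 2 * x - h) * P.eval x) :
    ∃ w₁ : ℝ → ℝ, IsSLSolution (ellK k) (fun _ => 1) (fun t => h - Λ * k ^ 2 * sn k t ^ 2)
        (lowerLame k κ P) w₁ ∧
      (∀ t, HasDerivAt (lowerLame k κ P) (w₁ t) t) ∧
      (∀ t, HasDerivAt w₁ (-((h - Λ * k ^ 2 * sn k t ^ 2) * lowerLame k κ P t)) t) ∧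
      BdryCond (κ 0) (lowerLame k κ P) w₁ 0 ∧ BdryCond (κ 1) (lowerLame k κ P) w₁ (ellK k) := by
  obtain ⟨w₁, h1, h2, h3, h4⟩ := (isJacobiTriple_lower hk).exists_isSLSolution (L := ellK k)
    (r := fun t => h - Λ * k ^ 2 * sn k t ^ 2) (a := κ 0) (b := κ 1) (c := κ 2)
    (by lia) (by lia) (by lia) hode (fun t => by ring)
  have s0 := sn_zero hk
  have cK := cn_ellK hk
  refine ⟨w₁, h1, h2, h3, bdryCond_of (fun h => h4 0 (.inl ⟨h, s0⟩)) (fun h => ?_),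
    bdryCond_of (fun h => h4 _ (.inr (.inl ⟨h, cK⟩))) (fun h => ?_)⟩
  · simp [lowerLame, lameReal, lamePre, s0, h]
  · simp [lowerLame, lameReal, lamePre, cK, h]

theorem exists_upperLame_deriv (hk : k ∈ Ioo (0 : ℝ) 1) {Λ h : ℝ}
    (hode : ∀ x, lameOp k (κ 0) (κ 1) (κ 2) P x = (Λ * k ^ 2 * x - h) * P.eval x) :
    ∃ v₁ : ℝ → ℝ, IsSLSolution (ellK (kc k)) (fun _ => 1) (fun s => -h + Λ * dn (kc k) s ^ 2)
        (upperLame k κ P) v₁ ∧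
      (∀ s, HasDerivAt (upperLame k κ P) (v₁ s) s) ∧
      (∀ s, HasDerivAt v₁ (-((-h + Λ * dn (kc k) s ^ 2) * upperLame k κ P s)) s) ∧
      BdryCond (κ 2) (upperLame k κ P) v₁ 0 ∧
      BdryCond (κ 1) (upperLame k κ P) v₁ (ellK (kc k)) := by
  have hk0 := hk.1.ne'
  have hk' := kc_mem hk
  obtain ⟨w₁, h1, h2, h3, h4⟩ := (isJacobiTriple_upper hk).exists_isSLSolution (L := ellK (kc k))
    (r := fun s => -h + Λ * dn (kc k) s ^ 2) (a := κ 0) (b := κ 1) (c := κ 2)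
    (by lia) (by lia) (by lia) hode (fun t => by field_simp; ring)
  have s0 := sn_zero hk'
  have cK := cn_ellK hk'
  refine ⟨w₁, h1, h2, h3,
    bdryCond_of (fun h => h4 0 (.inr (.inr ⟨h, by simp [s0]⟩))) (fun h => ?_),
    bdryCond_of (fun h => h4 _ (.inr (.inl ⟨h, by simp [cK]⟩))) (fun h => ?_)⟩
  · simp [upperLame, lameReal, lamePre, s0, h]
  · simp [upperLame, lameReal, lamePre, cK, h]

theorem zeros_lameW (hk : k ∈ Ioo (0 : ℝ) 1) (κ : Fin 3 → Fin 2) (P : ℝ[X]) :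
    {t ∈ Ioo 0 (ellK k) | lameW k κ P t = 0} = {t ∈ Ioo 0 (ellK k) | lowerLame k κ P t = 0} := by
  ext t
  simp [lameW_eq hk, lowerLame]

theorem zeros_lameV (hk : k ∈ Ioo (0 : ℝ) 1) (κ : Fin 3 → Fin 2) (P : ℝ[X]) :
    {s ∈ Ioo 0 (ellK (kc k)) | lameV k κ P s = 0} =
      {s ∈ Ioo 0 (ellK (kc k)) | upperLame k κ P s = 0} := by
  ext s
  refine and_congr_right fun hs => ?_
  rw [lameV_eq hk κ P (Ioo_subset_Icc_self hs)]
  simp [upperLame]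

theorem deriv_deriv_lameW (hk : k ∈ Ioo (0 : ℝ) 1) (κ : Fin 3 → Fin 2) (P : ℝ[X]) (t : ℝ) :
    deriv (deriv (lameW k κ P)) t =
      ((lamePre (κ 0) (κ 1) (κ 2) (sn k) (cn k) (dn k) t *
        lameOp k (κ 0) (κ 1) (κ 2) P (sn k t ^ 2) : ℝ) : ℂ) := by
  obtain ⟨w₁, h1, h2, -⟩ := (isJacobiTriple_lower hk).exists_deriv_lameReal
    (a := κ 0) (b := κ 1) (c := κ 2) (by lia) (by lia) (by lia) P
  have e : lameW k κ P =
      fun t => ((lameReal (κ 0) (κ 1) (κ 2) P (sn k) (cn k) (dn k) t : ℝ) : ℂ) :=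
    funext (lameW_eq hk κ P)
  have e1 : deriv (lameW k κ P) = fun t => ((w₁ t : ℝ) : ℂ) := by
    rw [e]; exact funext fun t => (h1 t).ofReal_comp.deriv
  rw [e1, (h2 t).ofReal_comp.deriv, one_mul]

/-- The algebraic form of the differential equation of a Lamé polynomial. -/
theorem IsLamePolynomial.lameOp_eq (hk : k ∈ Ioo (0 : ℝ) 1) {m n : ℕ}
    (hP : IsLamePolynomial k κ m n P) (x : ℝ) : lameOp k (κ 0) (κ 1) (κ 2) P x =
      (sphereLam m n κ * k ^ 2 * x - lowerH k κ n (sphereLam m n κ) 0) * P.eval x := by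
  refine lameOp_eq_of_forall_mem_Ioo hk (fun t ht => ?_) x
  have h := hP.lame_eq t
  rw [deriv_deriv_lameW hk, lameW_eq hk] at h
  norm_cast at h
  rw [lameReal] at h
  refine mul_left_cancel₀ (lamePre_lower_ne_zero hk (κ 0) (κ 1) (κ 2) ht) ?_
  linear_combination h

/-- The constant `h` of the algebraic equation need not be known in advance: the restriction to the
real axis is an eigenfunction with `n` zeros, and uniqueness makes `h` the value of `lowerH`. -/
theorem isLamePolynomial_of_lameOp_eq (hk : k ∈ Ioo (0 : ℝ) 1) {m n : ℕ} {h : ℝ}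
    (hdeg : P.degree = ((m + n : ℕ) : WithBot ℕ))
    (hode : ∀ x, lameOp k (κ 0) (κ 1) (κ 2) P x = (sphereLam m n κ * k ^ 2 * x - h) * P.eval x)
    (hn : {t ∈ Ioo 0 (ellK k) | lowerLame k κ P t = 0}.encard = n)
    (hm : {s ∈ Ioo 0 (ellK (kc k)) | upperLame k κ P s = 0}.encard = m) :
    IsLamePolynomial k κ m n P := by
  obtain ⟨w₁, hs, -, -, hb₀, hbL⟩ := exists_lowerLame_deriv hk hode
  obtain ⟨-, hh, -⟩ := lower_summary hk hs hb₀ hbL hn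
  refine ⟨hdeg, fun t => ?_, by rwa [zeros_lameV hk], by rwa [zeros_lameW hk]⟩
  rw [deriv_deriv_lameW hk, lameW_eq hk, hode, hh]
  norm_cast
  rw [lameReal]
  ring

theorem exists_isLamePolynomial (hk : k ∈ Ioo (0 : ℝ) 1) (m n : ℕ) (κ : Fin 3 → Fin 2) :
    ∃ P : ℝ[X], IsLamePolynomial k κ m n P := by
  obtain ⟨P, h, hdeg, hode, hn, hm⟩ := exists_lame_polynomial hk m n κ
  exact ⟨P, isLamePolynomial_of_lameOp_eq hk hdeg hode hn hm⟩

end LamePolynomials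

/-! ### Passage from real eigenfunctions to complex-valued Lamé functions. -/

section Integrals

theorem integral_eq_const_mul_ofReal {L : ℝ} (hL : 0 ≤ L) {F : ℝ → ℂ} {G : ℝ → ℝ} {z : ℂ}
    (h : ∀ t ∈ Ioo 0 L, F t = z * (G t : ℂ)) :
    ∫ t in (0 : ℝ)..L, F t = z * ((∫ t in (0 : ℝ)..L, G t : ℝ) : ℂ) := by
  rw [intervalIntegral.integral_congr_Ioo_of_le hL h, intervalIntegral.integral_const_mul,
    intervalIntegral.integral_ofReal]

theorem deriv_mul_deriv_of_eq_const_mul {L : ℝ} {f : ℝ → ℂ} {c c₁ w w₁ w₂ : ℝ → ℝ} {z : ℂ}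
    (hf : ∀ t ∈ Ioo 0 L, f t = z * (w t : ℂ)) (hc : ∀ t, HasDerivAt c (c₁ t) t)
    (hw : ∀ t, HasDerivAt w (w₁ t) t) (hw₁ : ∀ t, HasDerivAt w₁ (w₂ t) t) {t : ℝ}
    (ht : t ∈ Ioo 0 L) :
    deriv (fun t' : ℝ => (c t' : ℂ) * deriv f t') t =
      z * ((c₁ t * w₁ t + c t * w₂ t : ℝ) : ℂ) := by
  have h1 : ∀ t ∈ Ioo 0 L, deriv f t = z * (w₁ t : ℂ) := fun t ht => by
    have : f =ᶠ[𝓝 t] fun t => z * (w t : ℂ) := by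
      filter_upwards [Ioo_mem_nhds ht.1 ht.2] using hf
    rw [this.deriv_eq]
    exact ((hw t).ofReal_comp.const_mul z).deriv
  have h2 : (fun t' : ℝ => (c t' : ℂ) * deriv f t') =ᶠ[𝓝 t]
      fun t' => z * ((c t' * w₁ t' : ℝ) : ℂ) := by
    filter_upwards [Ioo_mem_nhds ht.1 ht.2] with t' ht'
    rw [h1 t' ht']
    push_cast
    ring
  rw [h2.deriv_eq]
  exact ((((hc t).mul (hw₁ t)).ofReal_comp).const_mul z).deriv

/-- The integral formulas for the derivatives of an eigenvalue in terms of a complex multiple `f` of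
the real eigenfunction `w`. -/
theorem eigenvalue_deriv_formulas {L : ℝ} (hL : 0 ≤ L) {f : ℝ → ℂ} {c c₁ g r w w₁ : ℝ → ℝ} {z : ℂ}
    {j₀ j₁ : Fin 2} {A d₁ d₂ : ℝ} (hz : z ≠ 0) (hf : ∀ t ∈ Icc 0 L, f t = z * (w t : ℂ))
    (hc : ∀ t, HasDerivAt c (c₁ t) t) (hc₁ : Continuous c₁) (hr : Continuous r)
    (hw : ∀ t, HasDerivAt w (w₁ t) t) (hw₁ : ∀ t, HasDerivAt w₁ (-(r t * w t)) t)
    (hb₀ : BdryCond j₀ w w₁ 0) (hbL : BdryCond j₁ w w₁ L)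
    (hN : 0 < ∫ t in (0 : ℝ)..L, w t ^ 2)
    (h₁ : d₁ * (∫ t in (0 : ℝ)..L, w t ^ 2) = ∫ t in (0 : ℝ)..L, g t ^ 2 * w t ^ 2)
    (h₂ : d₂ * (∫ t in (0 : ℝ)..L, w t ^ 2) =
      A ^ 2 * (-(1 / 2) * ∫ t in (0 : ℝ)..L, c t ^ 2 * (w₁ t ^ 2 + r t * w t ^ 2))) :
    (d₁ : ℂ) = (∫ t in (0 : ℝ)..L, (g t : ℂ) ^ 2 * f t ^ 2) / (∫ t in (0 : ℝ)..L, f t ^ 2) ∧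
    (d₂ : ℂ) = ((A : ℂ) ^ 2 * ∫ t in (0 : ℝ)..L, (c t : ℂ) * f t *
      deriv (fun t' : ℝ => (c t' : ℂ) * deriv f t') t) / (∫ t in (0 : ℝ)..L, f t ^ 2) := by
  have hf' : ∀ t ∈ Ioo 0 L, f t = z * (w t : ℂ) := fun t ht => hf t (Ioo_subset_Icc_self ht)
  have cw : Continuous w := continuous_iff_continuousAt.2 fun t => (hw t).continuousAt
  have i0 : ∫ t in (0 : ℝ)..L, f t ^ 2 = z ^ 2 * ((∫ t in (0 : ℝ)..L, w t ^ 2 : ℝ) : ℂ) :=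
    integral_eq_const_mul_ofReal hL fun t ht => by rw [hf' t ht]; push_cast; ring
  have i1 : ∫ t in (0 : ℝ)..L, (g t : ℂ) ^ 2 * f t ^ 2 =
      z ^ 2 * ((∫ t in (0 : ℝ)..L, g t ^ 2 * w t ^ 2 : ℝ) : ℂ) :=
    integral_eq_const_mul_ofReal hL fun t ht => by rw [hf' t ht]; push_cast; ring
  have i2 : ∫ t in (0 : ℝ)..L, (c t : ℂ) * f t *
      deriv (fun t' : ℝ => (c t' : ℂ) * deriv f t') t =
      z ^ 2 * ((∫ t in (0 : ℝ)..L, c t * w t * (c₁ t * w₁ t + c t * (-(r t * w t))) : ℝ) : ℂ) :=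
    integral_eq_const_mul_ofReal hL fun t ht => by
      rw [deriv_mul_deriv_of_eq_const_mul hf' hc hw hw₁ ht, hf' t ht]; push_cast; ring
  have hp := integral_mul_deriv_mul hc hw hw₁ hc₁ (hr.mul cw).neg hb₀.mul_eq_zero hbL.mul_eq_zero
  have he : (fun t => c t ^ 2 * (w₁ t ^ 2 + r t * w t ^ 2)) =
      fun t => c t ^ 2 * (w₁ t ^ 2 - -(r t * w t) * w t) := by funext t; ring
  rw [he, hp] at h₂
  -- The constant `z` may be imaginary, but every integral carries the same factor `z²`, which
  -- cancels in the quotients.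
  have hN' : z ^ 2 * ((∫ t in (0 : ℝ)..L, w t ^ 2 : ℝ) : ℂ) ≠ 0 :=
    mul_ne_zero (pow_ne_zero 2 hz) (by exact_mod_cast hN.ne')
  rw [i0, i1, i2, eq_div_iff hN', eq_div_iff hN', ← h₁]
  refine ⟨by push_cast; ring, ?_⟩
  have h₂' := congrArg (fun x : ℝ => (x : ℂ)) h₂
  simp only [Complex.ofReal_mul, Complex.ofReal_pow] at h₂'
  linear_combination z ^ 2 * h₂'

end Integrals


/-! ### Assembly: transversal crossing of the eigencurves at the sphere. -/

section Main

variable {k : ℝ} {κ : Fin 3 → Fin 2} {P : ℝ[X]} {m n : ℕ}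

theorem IsLamePolynomial.encard_zeros_lowerLame (hk : k ∈ Ioo (0 : ℝ) 1)
    (hP : IsLamePolynomial k κ m n P) :
    {t ∈ Ioo 0 (ellK k) | lowerLame k κ P t = 0}.encard = n := by
  rw [← zeros_lameW hk]; exact hP.zeros_w

theorem IsLamePolynomial.encard_zeros_upperLame (hk : k ∈ Ioo (0 : ℝ) 1)
    (hP : IsLamePolynomial k κ m n P) :
    {s ∈ Ioo 0 (ellK (kc k)) | upperLame k κ P s = 0}.encard = m := by
  rw [← zeros_lameV hk]; exact hP.zeros_v

/-- At the sphere the eigencurves have a common point. -/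
theorem upperH_sphere (hk : k ∈ Ioo (0 : ℝ) 1) (m n : ℕ) (κ : Fin 3 → Fin 2) :
    upperH k κ m (sphereLam m n κ) 0 = lowerH k κ n (sphereLam m n κ) 0 := by
  obtain ⟨P, hP⟩ := exists_isLamePolynomial hk m n κ
  obtain ⟨v₁, hs, -, -, hb₀, hbL⟩ := exists_upperLame_deriv hk (hP.lameOp_eq hk)
  -- The upper eigenfunction comes from the same polynomial, so its eigenvalue is the same constant,
  -- already known to be the lower eigenvalue.
  exact (upper_summary hk hs hb₀ hbL (hP.encard_zeros_upperLame hk)).2.1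

theorem analyticAt_upperH (hk : k ∈ Ioo (0 : ℝ) 1) (m n : ℕ) (κ : Fin 3 → Fin 2) :
    (∀ᶠ x : ℝ × ℝ in 𝓝 (sphereLam m n κ, 0),
      IsUpperEigenvalue k κ m x.1 x.2 (upperH k κ m x.1 x.2)) ∧
    AnalyticAt ℝ (fun x : ℝ × ℝ => upperH k κ m x.1 x.2) (sphereLam m n κ, 0) := by
  obtain ⟨P, hP⟩ := exists_isLamePolynomial hk m n κ
  obtain ⟨v₁, hs, -, -, hb₀, hbL⟩ := exists_upperLame_deriv hk (hP.lameOp_eq hk)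
  have h := upper_summary hk hs hb₀ hbL (hP.encard_zeros_upperLame hk)
  exact ⟨h.1, h.2.2.1⟩

theorem analyticAt_lowerH (hk : k ∈ Ioo (0 : ℝ) 1) (m n : ℕ) (κ : Fin 3 → Fin 2) :
    (∀ᶠ x : ℝ × ℝ in 𝓝 (sphereLam m n κ, 0),
      IsLowerEigenvalue k κ n x.1 x.2 (lowerH k κ n x.1 x.2)) ∧
    AnalyticAt ℝ (fun x : ℝ × ℝ => lowerH k κ n x.1 x.2) (sphereLam m n κ, 0) := by
  obtain ⟨P, hP⟩ := exists_isLamePolynomial hk m n κ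
  obtain ⟨w₁, hs, -, -, hb₀, hbL⟩ := exists_lowerLame_deriv hk (hP.lameOp_eq hk)
  have h := lower_summary hk hs hb₀ hbL (hP.encard_zeros_lowerLame hk)
  exact ⟨h.1, h.2.2.1⟩

theorem upperH_deriv_formulas (hk : k ∈ Ioo (0 : ℝ) 1) (hP : IsLamePolynomial k κ m n P) :
    ((deriv (fun l => upperH k κ m l 0) (sphereLam m n κ) : ℝ) : ℂ) =
        (∫ s in (0 : ℝ)..ellK (kc k), (dn (kc k) s : ℂ) ^ 2 * lameV k κ P s ^ 2) /
          (∫ s in (0 : ℝ)..ellK (kc k), lameV k κ P s ^ 2) ∧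
      ((deriv (fun ε => upperH k κ m (sphereLam m n κ) ε) 0 : ℝ) : ℂ) =
        ((kc k : ℂ) ^ 2 * ∫ s in (0 : ℝ)..ellK (kc k),
          (cn (kc k) s : ℂ) * lameV k κ P s *
            deriv (fun s' : ℝ => (cn (kc k) s' : ℂ) * deriv (lameV k κ P) s') s) /
          (∫ s in (0 : ℝ)..ellK (kc k), lameV k κ P s ^ 2) := by
  have hk' := kc_mem hk
  have hsn := continuous_sn hk'
  have hdn := continuous_dn hk'
  obtain ⟨v₁, hs, hv, hv₁, hb₀, hbL⟩ := exists_upperLame_deriv hk (hP.lameOp_eq hk)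
  obtain ⟨-, -, -, hN, h₁, h₂⟩ := upper_summary hk hs hb₀ hbL (hP.encard_zeros_upperLame hk)
  exact eigenvalue_deriv_formulas (ellK_pos hk').le (z := (-Complex.I) ^ (κ 1 : ℕ))
    (pow_ne_zero _ (neg_ne_zero.2 Complex.I_ne_zero)) (fun s hs => lameV_eq hk κ P hs)
    (hasDerivAt_cn hk') (by fun_prop) (by fun_prop) hv hv₁ hb₀ hbL hN h₁ h₂

theorem lowerH_deriv_formulas (hk : k ∈ Ioo (0 : ℝ) 1) (hP : IsLamePolynomial k κ m n P) :
    ((deriv (fun l => lowerH k κ n l 0) (sphereLam m n κ) : ℝ) : ℂ) =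
        ((k : ℂ) ^ 2 * ∫ t in (0 : ℝ)..ellK k, (sn k t : ℂ) ^ 2 * lameW k κ P t ^ 2) /
          (∫ t in (0 : ℝ)..ellK k, lameW k κ P t ^ 2) ∧
      ((deriv (fun ε => lowerH k κ n (sphereLam m n κ) ε) 0 : ℝ) : ℂ) =
        ((k : ℂ) ^ 2 * ∫ t in (0 : ℝ)..ellK k,
          (cn k t : ℂ) * lameW k κ P t *
            deriv (fun t' : ℝ => (cn k t' : ℂ) * deriv (lameW k κ P) t') t) /
          (∫ t in (0 : ℝ)..ellK k, lameW k κ P t ^ 2) := by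
  have hsn := continuous_sn hk
  have hdn := continuous_dn hk
  obtain ⟨w₁, hs, hw, hw₁, hb₀, hbL⟩ := exists_lowerLame_deriv hk (hP.lameOp_eq hk)
  obtain ⟨-, -, -, hN, h₁, h₂⟩ := lower_summary hk hs hb₀ hbL (hP.encard_zeros_lowerLame hk)
  have h₁' : k ^ 2 * ∫ t in (0 : ℝ)..ellK k, sn k t ^ 2 * lowerLame k κ P t ^ 2 =
      ∫ t in (0 : ℝ)..ellK k, (k * sn k t) ^ 2 * lowerLame k κ P t ^ 2 := by
    rw [← intervalIntegral.integral_const_mul]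
    congr 1; funext t; ring
  have h := eigenvalue_deriv_formulas (ellK_pos hk).le (z := 1) (g := fun t => k * sn k t)
    one_ne_zero (fun t _ => (lameW_eq hk κ P t).trans (one_mul _).symm)
    (hasDerivAt_cn hk) (by fun_prop) (by fun_prop) hw hw₁ hb₀ hbL hN
    (h₁.trans h₁') h₂
  refine ⟨h.1.trans ?_, h.2⟩
  rw [← intervalIntegral.integral_const_mul]
  congr 2
  funext t
  push_cast
  ring

/-- The derivative is the average of `dn²` with weight `v²`, and `dn² > k²` inside the interval
while `v` is nonzero at some interior point. -/
theorem sq_lt_deriv_upperH (hk : k ∈ Ioo (0 : ℝ) 1) (m n : ℕ) (κ : Fin 3 → Fin 2) :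
    k ^ 2 < deriv (fun l => upperH k κ m l 0) (sphereLam m n κ) := by
  have hk' := kc_mem hk
  have hL := ellK_pos hk'
  have hdn := continuous_dn hk'
  obtain ⟨P, hP⟩ := exists_isLamePolynomial hk m n κ
  obtain ⟨v₁, hs, hv, -, hb₀, hbL⟩ := exists_upperLame_deriv hk (hP.lameOp_eq hk)
  have hm := hP.encard_zeros_upperLame hk
  obtain ⟨-, -, -, hN, h₁, -⟩ := upper_summary hk hs hb₀ hbL hm
  have cv : Continuous (upperLame k κ P) :=
    continuous_iff_continuousAt.2 fun t => (hv t).continuousAt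
  obtain ⟨a, ha, hva⟩ := exists_ne_zero_of_encard hL hm
  have hpos : 0 < ∫ s in (0 : ℝ)..ellK (kc k),
      (dn (kc k) s ^ 2 * upperLame k κ P s ^ 2 - k ^ 2 * upperLame k κ P s ^ 2) := by
    have hle : ∀ s ∈ Ioo 0 (ellK (kc k)),
        0 ≤ dn (kc k) s ^ 2 * upperLame k κ P s ^ 2 - k ^ 2 * upperLame k κ P s ^ 2 :=
      fun s hs => by nlinarith [sq_lt_dn_sq hk hs, sq_nonneg (upperLame k κ P s)]
    have hcont : Continuous fun s =>
        dn (kc k) s ^ 2 * upperLame k κ P s ^ 2 - k ^ 2 * upperLame k κ P s ^ 2 := by fun_prop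
    refine intervalIntegral.integral_pos hL hcont.continuousOn (fun s hs => ?_)
      ⟨a, Ioo_subset_Icc_self ha, ?_⟩
    · have hs' : s ∈ closure (Ioo 0 (ellK (kc k))) := by
        rw [closure_Ioo hL.ne]; exact Ioc_subset_Icc_self hs
      exact le_on_closure hle continuousOn_const hcont.continuousOn hs'
    · have := pow_pos (abs_pos.2 hva) 2
      rw [sq_abs] at this
      nlinarith [sq_lt_dn_sq hk ha]
  rw [intervalIntegral.integral_sub (Continuous.intervalIntegrable (by fun_prop) _ _)
    (Continuous.intervalIntegrable (by fun_prop) _ _), intervalIntegral.integral_const_mul,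
    ← h₁, ← sub_mul] at hpos
  linarith [pos_of_mul_pos_left hpos hN.le]

/-- The derivative is an average of `k² sn²`. The weak inequality suffices for transversality, since
the upper bound is strict. -/
theorem deriv_lowerH_le_sq (hk : k ∈ Ioo (0 : ℝ) 1) (m n : ℕ) (κ : Fin 3 → Fin 2) :
    deriv (fun l => lowerH k κ n l 0) (sphereLam m n κ) ≤ k ^ 2 := by
  have hL := ellK_pos hk
  have hsn := continuous_sn hk
  obtain ⟨P, hP⟩ := exists_isLamePolynomial hk m n κ
  obtain ⟨w₁, hs, hw, -, hb₀, hbL⟩ := exists_lowerLame_deriv hk (hP.lameOp_eq hk)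
  obtain ⟨-, -, -, hN, h₁, -⟩ := lower_summary hk hs hb₀ hbL (hP.encard_zeros_lowerLame hk)
  have cw : Continuous (lowerLame k κ P) :=
    continuous_iff_continuousAt.2 fun t => (hw t).continuousAt
  have hle : ∫ t in (0 : ℝ)..ellK k, sn k t ^ 2 * lowerLame k κ P t ^ 2 ≤
      ∫ t in (0 : ℝ)..ellK k, lowerLame k κ P t ^ 2 :=
    intervalIntegral.integral_mono_on hL.le (Continuous.intervalIntegrable (by fun_prop) _ _)
      (Continuous.intervalIntegrable (by fun_prop) _ _) fun t _ => by
        have := cn_sq k t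
        nlinarith [sq_nonneg (cn k t), sq_nonneg (lowerLame k κ P t)]
  refine le_of_mul_le_mul_right ?_ hN
  rw [h₁]
  exact mul_le_mul_of_nonneg_left hle (sq_nonneg k)

theorem hasDerivAt_comp_prod {U : ℝ × ℝ → ℝ} {φ : ℝ → ℝ} {l ε φ' : ℝ}
    (hU : DifferentiableAt ℝ U (l, ε)) (hφ : HasDerivAt φ φ' ε) (hl : φ ε = l) :
    HasDerivAt (fun x => U (φ x, x))
      (deriv (fun l => U (l, ε)) l * φ' + deriv (fun x => U (l, x)) ε) ε := by
  have hc : HasDerivAt (fun x => (φ x, x)) (φ', (1 : ℝ)) ε := hφ.prodMk (hasDerivAt_id ε)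
  have h1 : HasDerivAt (fun l => U (l, ε)) (fderiv ℝ U (l, ε) (1, 0)) l :=
    hU.hasFDerivAt.comp_hasDerivAt l ((hasDerivAt_id l).prodMk (hasDerivAt_const l ε))
  have h2 : HasDerivAt (fun x => U (l, x)) (fderiv ℝ U (l, ε) (0, 1)) ε :=
    hU.hasFDerivAt.comp_hasDerivAt ε ((hasDerivAt_const ε l).prodMk (hasDerivAt_id ε))
  have hU' : HasFDerivAt U (fderiv ℝ U (l, ε)) (φ ε, ε) := by rw [hl]; exact hU.hasFDerivAt
  refine (hU'.comp_hasDerivAt (f := fun x => (φ x, x)) ε hc).congr_deriv ?_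
  rw [h1.deriv, h2.deriv, show ((φ', (1 : ℝ)) : ℝ × ℝ) = φ' • ((1 : ℝ), (0 : ℝ)) + (0, 1) by simp,
    map_add, map_smul, smul_eq_mul, mul_comm]

/-- The crossing point of two transversal analytic families of curves is analytic. -/
theorem exists_analyticAt_crossing {U V : ℝ × ℝ → ℝ} {l : ℝ} (hU : AnalyticAt ℝ U (l, 0))
    (hV : AnalyticAt ℝ V (l, 0)) (h0 : U (l, 0) = V (l, 0))
    (hd : deriv (fun x => U (x, 0)) l - deriv (fun x => V (x, 0)) l ≠ 0) :
    ∃ φ : ℝ → ℝ, AnalyticAt ℝ φ 0 ∧ φ 0 = l ∧ (∀ᶠ ε in 𝓝 0, U (φ ε, ε) = V (φ ε, ε)) ∧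
      deriv φ 0 = -((deriv (fun ε => U (l, ε)) 0 - deriv (fun ε => V (l, ε)) 0) /
        (deriv (fun x => U (x, 0)) l - deriv (fun x => V (x, 0)) l)) := by
  -- The coordinates are swapped because the implicit function theorem solves for the last one, here
  -- `l` as a function of `ε`.
  have hF : AnalyticAt ℝ (fun x : ℝ × ℝ => U (x.2, x.1) - V (x.2, x.1)) (0, l) := by
    have hs : AnalyticAt ℝ (fun x : ℝ × ℝ => (x.2, x.1)) (0, l) :=
      analyticAt_snd.prod analyticAt_fst
    exact (AnalyticAt.fun_comp (f := fun x : ℝ × ℝ => (x.2, x.1)) hU hs).sub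
      (AnalyticAt.fun_comp (f := fun x : ℝ × ℝ => (x.2, x.1)) hV hs)
  have hp : ∀ {W : ℝ × ℝ → ℝ}, AnalyticAt ℝ W (l, 0) →
      HasDerivAt (fun x => W (x, 0)) (deriv (fun x => W (x, 0)) l) l := fun hW =>
    (hW.differentiableAt.comp (f := fun x : ℝ => (x, (0 : ℝ))) l (by fun_prop)).hasDerivAt
  obtain ⟨φ, hφ, hφ0, hev⟩ := exists_analyticAt_implicit hF ((hp hU).sub (hp hV)) hd
  have hev' : ∀ᶠ ε in 𝓝 0, U (φ ε, ε) = V (φ ε, ε) := by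
    filter_upwards [hev] with ε hε
    simp only [h0, sub_self] at hε
    exact sub_eq_zero.1 hε
  refine ⟨φ, hφ, hφ0, hev', ?_⟩
  have hφ' := hφ.differentiableAt.hasDerivAt
  have h1 := hasDerivAt_comp_prod hU.differentiableAt hφ' hφ0
  have h2 := hasDerivAt_comp_prod hV.differentiableAt hφ' hφ0
  -- Both curves have the same derivative along the crossing point: `U_l φ' + U_ε = V_l φ' + V_ε`,
  -- to be solved for `φ'`.
  have h3 := h1.unique (h2.congr_of_eventuallyEq hev')
  rw [← neg_div, eq_div_iff hd]
  linear_combination h3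

theorem exists_analyticAt_intersection (hk : k ∈ Ioo (0 : ℝ) 1) (m n : ℕ) (κ : Fin 3 → Fin 2)
    (hd : deriv (fun l => upperH k κ m l 0) (sphereLam m n κ)
      - deriv (fun l => lowerH k κ n l 0) (sphereLam m n κ) ≠ 0) :
    ∃ φ : ℝ → ℝ, AnalyticAt ℝ φ 0 ∧ φ 0 = sphereLam m n κ ∧
      (∀ᶠ ε in 𝓝 0, IsIntersection k κ m n ε (φ ε)) ∧
      deriv φ 0 = -((deriv (fun ε => upperH k κ m (sphereLam m n κ) ε) 0
          - deriv (fun ε => lowerH k κ n (sphereLam m n κ) ε) 0) /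
        (deriv (fun l => upperH k κ m l 0) (sphereLam m n κ)
          - deriv (fun l => lowerH k κ n l 0) (sphereLam m n κ))) := by
  obtain ⟨hUe, hU⟩ := analyticAt_upperH hk m n κ
  obtain ⟨hVe, hV⟩ := analyticAt_lowerH hk m n κ
  obtain ⟨φ, hφ, hφ0, hev, hφ'⟩ := exists_analyticAt_crossing hU hV (upperH_sphere hk m n κ) hd
  refine ⟨φ, hφ, hφ0, ?_, hφ'⟩
  have hc : Tendsto (fun ε => (φ ε, ε)) (𝓝 0) (𝓝 (sphereLam m n κ, 0)) := by
    have := hφ.continuousAt.tendsto.prodMk_nhds (tendsto_id (x := 𝓝 (0 : ℝ)))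
    rwa [hφ0] at this
  filter_upwards [hev, hc.eventually hUe, hc.eventually hVe] with ε h1 h2 h3
  exact ⟨_, h2, by rw [h1]; exact h3⟩

end Main

end NearSphere

theorem mainTheorem6 (k : ℝ) (hk : k ∈ Ioo (0 : ℝ) 1) (m n : ℕ) (κ : Fin 3 → Fin 2) :
    -- the objects are well defined near `(Λ, 0)`
    (∀ᶠ x : ℝ × ℝ in 𝓝 (sphereLam m n κ, 0),
      (∃! H : ℝ, IsUpperEigenvalue k κ m x.1 x.2 H) ∧
      (∃! h : ℝ, IsLowerEigenvalue k κ n x.1 x.2 h)) ∧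
    (∀ᶠ ε : ℝ in 𝓝 0, ∃! l : ℝ, IsIntersection k κ m n ε l) ∧
    (∃ P : ℝ[X], IsLamePolynomial k κ m n P) ∧
    eigenLam k κ m n 0 = sphereLam m n κ ∧
    -- analyticity of the eigenvalue functions and their partial derivatives
    AnalyticAt ℝ (fun x : ℝ × ℝ => upperH k κ m x.1 x.2) (sphereLam m n κ, 0) ∧
    AnalyticAt ℝ (fun x : ℝ × ℝ => lowerH k κ n x.1 x.2) (sphereLam m n κ, 0) ∧
    (∀ P : ℝ[X], IsLamePolynomial k κ m n P →
      ((deriv (fun l => upperH k κ m l 0) (sphereLam m n κ) : ℝ) : ℂ) =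
        (∫ s in (0 : ℝ)..ellK (kc k), (dn (kc k) s : ℂ) ^ 2 * lameV k κ P s ^ 2) /
          (∫ s in (0 : ℝ)..ellK (kc k), lameV k κ P s ^ 2) ∧
      ((deriv (fun ε => upperH k κ m (sphereLam m n κ) ε) 0 : ℝ) : ℂ) =
        ((kc k : ℂ) ^ 2 * ∫ s in (0 : ℝ)..ellK (kc k),
          (cn (kc k) s : ℂ) * lameV k κ P s *
            deriv (fun s' : ℝ => (cn (kc k) s' : ℂ) * deriv (lameV k κ P) s') s) /
          (∫ s in (0 : ℝ)..ellK (kc k), lameV k κ P s ^ 2) ∧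
      ((deriv (fun l => lowerH k κ n l 0) (sphereLam m n κ) : ℝ) : ℂ) =
        ((k : ℂ) ^ 2 * ∫ t in (0 : ℝ)..ellK k, (sn k t : ℂ) ^ 2 * lameW k κ P t ^ 2) /
          (∫ t in (0 : ℝ)..ellK k, lameW k κ P t ^ 2) ∧
      ((deriv (fun ε => lowerH k κ n (sphereLam m n κ) ε) 0 : ℝ) : ℂ) =
        ((k : ℂ) ^ 2 * ∫ t in (0 : ℝ)..ellK k,
          (cn k t : ℂ) * lameW k κ P t *
            deriv (fun t' : ℝ => (cn k t' : ℂ) * deriv (lameW k κ P) t') t) /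
          (∫ t in (0 : ℝ)..ellK k, lameW k κ P t ^ 2)) ∧
    -- analyticity of the eigenvalue and its derivative at the sphere
    AnalyticAt ℝ (eigenLam k κ m n) 0 ∧
    deriv (fun l => upperH k κ m l 0) (sphereLam m n κ)
      - deriv (fun l => lowerH k κ n l 0) (sphereLam m n κ) ≠ 0 ∧
    deriv (eigenLam k κ m n) 0 =
      -((deriv (fun ε => upperH k κ m (sphereLam m n κ) ε) 0
          - deriv (fun ε => lowerH k κ n (sphereLam m n κ) ε) 0) /
        (deriv (fun l => upperH k κ m l 0) (sphereLam m n κ)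
          - deriv (fun l => lowerH k κ n l 0) (sphereLam m n κ))) := by
  obtain ⟨hUe, hU⟩ := analyticAt_upperH hk m n κ
  obtain ⟨hVe, hV⟩ := analyticAt_lowerH hk m n κ
  have hd : deriv (fun l => upperH k κ m l 0) (sphereLam m n κ)
      - deriv (fun l => lowerH k κ n l 0) (sphereLam m n κ) ≠ 0 :=
    (sub_pos.2 ((deriv_lowerH_le_sq hk m n κ).trans_lt (sq_lt_deriv_upperH hk m n κ))).ne'
  obtain ⟨φ, hφ, hφ0, hφI, hφ'⟩ := exists_analyticAt_intersection hk m n κ hd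
  have habs : ∀ᶠ ε : ℝ in 𝓝 0, |ε| < 1 :=
    (continuous_abs.tendsto' (0 : ℝ) 0 abs_zero).eventually_lt_const one_pos
  have heq : eigenLam k κ m n =ᶠ[𝓝 0] φ := by
    -- Since the crossing is unique for each small `ε`, the chosen solution `eigenLam` coincides
    -- with the analytic branch `φ` near `0` and inherits its value and derivative.
    filter_upwards [hφI, habs] with ε hI hε using eigenLam_eq hk hε hI
  refine ⟨?_, ?_, exists_isLamePolynomial hk m n κ, heq.self_of_nhds.trans hφ0, hU, hV,
    fun P hP => ?_, hφ.congr heq.symm, hd, heq.deriv_eq.trans hφ'⟩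
  · filter_upwards [hUe, hVe, eventually_abs_snd_lt (sphereLam m n κ)] with x h1 h2 hx
    exact ⟨⟨_, h1, fun H hH => hH.unique hk hx h1⟩, ⟨_, h2, fun h hh => hh.unique hk hx h2⟩⟩
  · filter_upwards [hφI, habs] with ε hI hε
    exact ⟨_, hI, fun l hl => hl.unique hk hε hI⟩
  · obtain ⟨h1, h2⟩ := upperH_deriv_formulas hk hP
    obtain ⟨h3, h4⟩ := lowerH_deriv_formulas hk hP
    exact ⟨h1, h2, h3, h4⟩
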